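/- Let $G$ be an abelian group and $k\ge 3$ an integer. A $k$-colored sum-free set of size $L$ in $G$ is a collection of $k$-tuples $(x_{1,j},x_{2,j},\dots,x_{k,j})_{j=1}^{L}$ of elements of $G$ such that for all $j_1,\dots,j_k\in\{1,\dots,L\}$ one has $x_{1,j_1}+x_{2,j_2}+\dots+x_{k,j_k}=0$ if and only if $j_1=j_2=\dots=j_k$. For integers $m\ge 2$ and $k\ge 3$ let $$\Gamma_{m,k}=\min_{0<\gamma<1}\frac{1+\gamma+\dots+\gamma^{m-1}}{\gamma^{(m-1)/k}}.$$ Theorem. Let $m\ge 2$ and $k\ge 3$ be integers. (a) There is a constant $C=C(m,k)$ such that for every integer $n\ge 0$ there exists a $k$-colored sum-free set in $\mathbb{Z}_m^n$ of size at least $(\Gamma_{m,k})^{\,n-C\sqrt{n}}$. (b) If $m$ is a prime power, then for every integer $n\ge 0$ every $k$-colored sum-free set in $\mathbb{Z}_m^n$ has size at most $(\Gamma_{m,k})^{n}$; thus for prime powers $m$ the bound in (a) is tight up to lower-order terms in the exponent. -/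

import Mathlib

/-- A family of `L` many `k`-tuples `(x 1 j, …, x k j)`, `j = 1, …, L`, of elements of an abelian
group is a `k`-colored sum-free set (of size `L`) if `x 1 j₁ + ⋯ + x k j_k = 0` holds exactly
when `j₁ = ⋯ = j_k`. -/
def IsColoredSumFree {G : Type*} [AddCommGroup G] {k L : ℕ} (x : Fin k → Fin L → G) : Prop :=
  ∀ j : Fin k → Fin L, ∑ i, x i (j i) = 0 ↔ ∀ a b : Fin k, j a = j b

/-- The function `(1 + γ + ⋯ + γ^(m-1)) / γ^((m-1)/k)` of a real number `γ`. -/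
noncomputable def gammaFun (m k : ℕ) (γ : ℝ) : ℝ :=
  (∑ i ∈ Finset.range m, γ ^ i) / γ ^ (((m : ℝ) - 1) / (k : ℝ))

/-- The constant `Γ_{m,k}`, the minimum of `gammaFun m k` over the open interval `(0, 1)`.
That the infimum is an attained minimum for `m ≥ 2` and `k ≥ 3` is `isLeast_gammaConst`. -/
noncomputable def gammaConst (m k : ℕ) : ℝ :=
  sInf (gammaFun m k '' Set.Ioo 0 1)

theorem isLeast_gammaConst {m k : ℕ} (hm : 2 ≤ m) (hk : 3 ≤ k) :
    IsLeast (gammaFun m k '' Set.Ioo 0 1) (gammaConst m k) := by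
  have hm' : (2 : ℝ) ≤ m := by exact_mod_cast hm
  have hk' : (3 : ℝ) ≤ k := by exact_mod_cast hk
  obtain ⟨s, hs⟩ : ∃ s : ℝ, s = ((m : ℝ) - 1) / (k : ℝ) := ⟨_, rfl⟩
  have hs0 : 0 < s := by rw [hs]; apply div_pos <;> linarith
  have hg : gammaFun m k = fun γ => (∑ i ∈ Finset.range m, γ ^ i) / γ ^ s := by
    funext γ; rw [gammaFun, hs]
  have hg1 : gammaFun m k 1 = m := by rw [hg]; simp
  -- the derivative at `1` is positive
  have hsum : (∑ i ∈ Finset.range m, (i : ℝ)) = m * (m - 1) / 2 := by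
    have h : ∀ N : ℕ, (∑ i ∈ Finset.range N, (i : ℝ)) = N * (N - 1) / 2 := by
      intro N
      induction N with
      | zero => simp
      | succ N ih => rw [Finset.sum_range_succ, ih]; push_cast; ring
    exact h m
  have hder : HasDerivAt (gammaFun m k) (m * (m - 1) / 2 - m * s) 1 := by
    rw [hg]
    have h1 : HasDerivAt (fun γ : ℝ => ∑ i ∈ Finset.range m, γ ^ i)
        (∑ i ∈ Finset.range m, (i : ℝ) * 1 ^ (i - 1)) 1 :=
      HasDerivAt.fun_sum fun i _ => hasDerivAt_pow i 1
    have h2 : HasDerivAt (fun γ : ℝ => γ ^ s) (s * 1 ^ (s - 1)) 1 :=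
      Real.hasDerivAt_rpow_const (Or.inl one_ne_zero)
    have h3 := h1.fun_div h2 (by simp)
    simpa [hsum] using h3
  have hd : 0 < (m : ℝ) * (m - 1) / 2 - m * s := by
    have : s ≤ ((m : ℝ) - 1) / 3 := by
      rw [hs]; exact div_le_div_of_nonneg_left (by linarith) (by norm_num) hk'
    nlinarith
  have hcont : ContinuousOn (gammaFun m k) (Set.Ioi 0) := by
    rw [hg]
    refine ContinuousOn.div (by fun_prop) ?_ ?_
    · exact fun x hx =>
        (Real.continuousAt_rpow_const x s (Or.inl (ne_of_gt hx))).continuousWithinAt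
    · exact fun x hx => (Real.rpow_pos_of_pos hx s).ne'
  -- near `0` the function is larger than its value at `1`
  obtain ⟨ε, hε⟩ : ∃ ε : ℝ, ε = (m : ℝ) ^ (-s⁻¹) := ⟨_, rfl⟩
  have hε0 : 0 < ε := by rw [hε]; positivity
  have hε1 : ε < 1 := by
    rw [hε]; exact Real.rpow_lt_one_of_one_lt_of_neg (by linarith) (by simpa using hs0)
  have hεs : ε ^ s = (m : ℝ)⁻¹ := by
    rw [hε, ← Real.rpow_mul (by positivity), neg_mul, inv_mul_cancel₀ hs0.ne', Real.rpow_neg_one]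
  have hsmall : ∀ γ : ℝ, 0 < γ → γ < ε → (m : ℝ) ≤ gammaFun m k γ := by
    intro γ h0 h1
    have h2 : γ ^ s ≤ (m : ℝ)⁻¹ := hεs ▸ Real.rpow_le_rpow h0.le h1.le hs0.le
    have h3 : (1 : ℝ) ≤ ∑ i ∈ Finset.range m, γ ^ i := by
      have := Finset.single_le_sum (f := fun i => γ ^ i) (s := Finset.range m)
        (fun i _ => by positivity) (Finset.mem_range.mpr (by omega : 0 < m))
      simpa using this
    have h4 : (m : ℝ) * γ ^ s ≤ 1 := by
      calc (m : ℝ) * γ ^ s ≤ m * (m : ℝ)⁻¹ := by gcongr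
        _ = 1 := mul_inv_cancel₀ (by positivity)
    rw [hg]
    change (m : ℝ) ≤ (∑ i ∈ Finset.range m, γ ^ i) / γ ^ s
    rw [le_div_iff₀ (Real.rpow_pos_of_pos h0 s)]
    linarith
  obtain ⟨c, hc, hcmin⟩ := isCompact_Icc.exists_isMinOn (Set.nonempty_Icc.mpr hε1.le)
    (hcont.mono fun x (hx : x ∈ Set.Icc ε 1) => lt_of_lt_of_le hε0 hx.1)
  have hc1 : c < 1 := by
    refine lt_of_le_of_ne hc.2 fun h => ?_
    subst h
    have hslope := (hasDerivAt_iff_tendsto_slope.mp hder).mono_left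
      (nhdsWithin_mono (1 : ℝ) fun x (hx : x ∈ Set.Iio (1 : ℝ)) => ne_of_lt hx)
    have hev := hslope.eventually (lt_mem_nhds hd)
    obtain ⟨x, ⟨hx, hx1⟩, hxε⟩ := ((hev.and self_mem_nhdsWithin).and
      (nhdsWithin_le_nhds (lt_mem_nhds hε1))).exists
    rw [slope_def_field] at hx
    have hx1' : x < 1 := hx1
    have hle : gammaFun m k 1 ≤ gammaFun m k x := hcmin ⟨le_of_lt hxε, hx1'.le⟩
    have : (gammaFun m k x - gammaFun m k 1) / (x - 1) ≤ 0 :=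
      div_nonpos_of_nonneg_of_nonpos (by linarith) (by linarith)
    linarith
  have hleast : IsLeast (gammaFun m k '' Set.Ioo 0 1) (gammaFun m k c) := by
    refine ⟨⟨c, ⟨lt_of_lt_of_le hε0 hc.1, hc1⟩, rfl⟩, ?_⟩
    rintro _ ⟨y, hy, rfl⟩
    rcases lt_or_ge y ε with h | h
    · have h1 : gammaFun m k c ≤ gammaFun m k 1 := hcmin ⟨hε1.le, le_rfl⟩
      linarith [hsmall y hy.1 h]
    · exact hcmin ⟨h, hy.2.le⟩
  rw [gammaConst, hleast.csInf_eq]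
  exact hleast

/-!
# Colored sum-free sets in `(ℤ/m)^n`

**Upper bound.** Let `m = p ^ r`. By Lucas' theorem `N ↦ N.choose (m - 1)` modulo `p` is the indicator
of `m ∣ N + 1`, so after shifting one colour by `1` the relation `∑ i, x i (j i) = 0` is detected by
a product of binomial coefficients of integer sums. Vandermonde's identity expands it into products
of one function per colour, in each of which some colour has degree at most `(m - 1) n / k`.
Instead of the slice rank of a diagonal tensor, the argument uses that subspaces of a function space
contain subspaces of products of their elements with subadditive codimension
(`card_le_sum_codim`). This bounds the family by `k` times the number of monomials of low degree,
which is at most `k * Γ ^ n`; powers of the family remove the factor `k`.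

**Lower bound.** Let `γ` minimise `gammaFun` and let `ψ a` be proportional to `γ ^ a` on
`{0, …, m - 1}`. Vanishing of the derivative at `γ` says that `ψ` has mean `(m - 1) / k`, and its
entropy is `log Γ`.

* *Coupling* (`exists_coupling`). As `ψ` is decreasing, it is the common marginal of a distribution
  of product form `π τ = exp (∑ i, θ (τ i))` on the `k`-tuples `τ` with sum `m - 1`. It is found as a
  critical point of a convex function. Coercivity comes down to a statement on functions `f` with
  `∑ i, f (τ i) ≥ 0` for all tuples: up to a linear function which sums to zero over each tuple, their
  prefix sums are nonnegative (`exists_shift_prefix_nonneg`).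

* *Entropy* (`entropy_slope_le`). Among the subspaces `U` of the space of differences of two tuples
  with a common entry, the entropy lost by reducing `π` modulo `U`, per dimension of `U`, is largest
  for the full space, because entropy is submodular and the symmetric group on the other entries
  acts irreducibly on that space.

* *Typical sequences* (`exists_typical_class`). By Chebyshev's inequality and the pigeonhole
  principle there is a set of `exp (n H(π) - O(√n))` sequences of `n` tuples, with common marginals,
  all of which are typical. A sequence of tuples is read as `k` rows, vectors in `{0, …, m - 1} ^ n`.

* *Hashing* (`exists_card_isolated`). The rows are hashed by a random affine map to `𝔽_p ^ ν`, and a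
  sequence is kept if all its rows but one have the same hash, in a set in which no element is the mean
  of others (Behrend's construction). The entropy inequality shows that as soon as `p ^ ν` exceeds
  `exp (n Φ + O(√n))`, where `Φ = (H(π) - log Γ) / (k - 2)`, most kept sequences share no row with
  another kept one. Any sequence composed of rows of kept sequences is again kept, so the rows of the
  remaining sequences form, after a shift of one colour, a colored sum-free set
  (`exists_isColoredSumFree_of_mix`).

Its size is about `exp (n H(π)) / (p ^ ν) ^ (k - 2)`, which is `exp (n log Γ - O(√n))`; with `p` about
`exp √n` the dimension `ν` is `O(√n)`, so that the factor `exp (O(ν))` lost in Behrend's construction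
is harmless.
-/

/-! ### Tuples with prescribed sum on which a function is negative -/

/-- `f` has negative sums over all final segments `[x, i]` of `[0, i]`. -/
def NegSuffixSums (f : ℕ → ℝ) (i : ℕ) : Prop :=
  ∀ x ≤ i, ∑ a ∈ Finset.Ico x (i + 1), f a < 0

/-- `h` has negative sums over all initial segments `[0, t]` of `[0, B]`. -/
def NegPrefixSums (h : ℕ → ℝ) (B : ℕ) : Prop :=
  ∀ t ≤ B, ∑ x ∈ Finset.range (t + 1), h x < 0

/-- There are lists `l` of `n` numbers, one for every sum `B - t` with `t ≤ B`, such that the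
values `∑ f` on these lists are dominated by a function of `t` with negative prefix sums. -/
def Reach (f : ℕ → ℝ) (n B : ℕ) : Prop :=
  ∃ h : ℕ → ℝ, (∀ t ≤ B, ∃ l : List ℕ, l.length = n ∧ l.sum + t = B ∧ (l.map f).sum ≤ h t) ∧
    NegPrefixSums h B

theorem NegSuffixSums.reverse {f : ℕ → ℝ} {i : ℕ} (hf : NegSuffixSums f i) :
    NegPrefixSums (fun t => f (i - t)) i := by
  intro t ht
  have h := hf (i - t) (by omega)
  rw [Finset.sum_Ico_eq_sum_range] at h
  have e : i + 1 - (i - t) = t + 1 := by omega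
  rw [e, ← Finset.sum_range_reflect] at h
  refine lt_of_le_of_lt (le_of_eq (Finset.sum_congr rfl fun x hx => ?_)) h
  have := Finset.mem_range.mp hx
  change f (i - x) = f _
  congr 1; omega

theorem NegSuffixSums.reach {f : ℕ → ℝ} {i : ℕ} (hf : NegSuffixSums f i) : Reach f 1 i :=
  ⟨fun t => f (i - t), fun t ht => ⟨[i - t], by simp, by simp; omega, by simp⟩, hf.reverse⟩

/-- If `h` is dominated by the sum of `f` and `g` along every antidiagonal, then its prefix sums are
bounded by prefix sums of `f` and of `g`. The bound is the expectation of `∑ f x + g y` over the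
points `(x, y)` of a uniformly random lattice path from `(0, 0)` to `(p, q)`, whose coordinates are
equidistributed; the induction removes the last step of the path. -/
theorem sum_range_le_of_le_add {f g h : ℕ → ℝ} {a b : ℕ}
    (H : ∀ u ≤ a, ∀ v ≤ b, h (u + v) ≤ f u + g v) :
    ∀ N p q : ℕ, p + q = N → p ≤ a → q ≤ b → ∑ x ∈ Finset.range (N + 1), h x ≤
      ((p : ℝ) + q + 1) / (p + 1) * ∑ x ∈ Finset.range (p + 1), f x +
      ((p : ℝ) + q + 1) / (q + 1) * ∑ x ∈ Finset.range (q + 1), g x := by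
  intro N
  induction N with
  | zero =>
    intro p q hpq hp hq
    obtain rfl : p = 0 := by omega
    obtain rfl : q = 0 := by omega
    have := H 0 hp 0 hq
    simpa using this
  | succ N ih =>
    intro p q hpq hp hq
    rw [Finset.sum_range_succ h (N + 1)]
    have hlast : h (N + 1) ≤ f p + g q := hpq ▸ H p hp q hq
    rcases p with _ | p
    · obtain rfl : q = N + 1 := by omega
      have h1 := ih 0 N (by omega) hp (by omega)
      rw [Finset.sum_range_succ g (N + 1)]
      simp only [Nat.cast_zero, zero_add, Finset.sum_range_one, Nat.cast_add, Nat.cast_one,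
        div_one] at h1 ⊢
      rw [div_self (by positivity), one_mul] at h1 ⊢
      linarith
    rcases q with _ | q
    · obtain rfl : p = N := by omega
      have h1 := ih p 0 (by omega) (by omega) hq
      rw [Finset.sum_range_succ f (p + 1)]
      simp only [Nat.cast_zero, zero_add, Finset.sum_range_one, Nat.cast_add, Nat.cast_one,
        div_one, add_zero] at h1 ⊢
      rw [div_self (by positivity), one_mul] at h1 ⊢
      linarith
    have h1 := ih p (q + 1) (by omega) (by omega) hq
    have h2 := ih (p + 1) q (by omega) hp (by omega)
    rw [Finset.sum_range_succ f (p + 1)] at h2 ⊢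
    rw [Finset.sum_range_succ g (q + 1)] at h1 ⊢
    set F := ∑ x ∈ Finset.range (p + 1), f x
    set G := ∑ x ∈ Finset.range (q + 1), g x
    push_cast at h1 h2 ⊢
    have hp0 : (0 : ℝ) < p + 1 := by positivity
    have hq0 : (0 : ℝ) < q + 1 := by positivity
    have hs : (0 : ℝ) < (p + 1) + (q + 1) := by positivity
    -- the last step is horizontal with probability `(p + 1) / (p + q + 2)`
    have h3 := mul_le_mul_of_nonneg_left h1 (le_of_lt (div_pos hp0 hs))
    have h4 := mul_le_mul_of_nonneg_left h2 (le_of_lt (div_pos hq0 hs))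
    set S := ∑ x ∈ Finset.range (N + 1), h x
    have h5 : S = (p + 1 : ℝ) / ((p + 1) + (q + 1)) * S + (q + 1 : ℝ) / ((p + 1) + (q + 1)) * S := by
      rw [← add_mul, ← add_div, div_self hs.ne', one_mul]
    calc S + h (N + 1) ≤ _ := add_le_add (h5.le.trans (add_le_add h3 h4)) hlast
      _ = _ := by field_simp; ring

/-- The functions of `Reach` are combined by infimal convolution. -/
theorem Reach.add {f : ℕ → ℝ} {n n' a b : ℕ} (ha : Reach f n a) (hb : Reach f n' b) :
    Reach f (n + n') (a + b) := by
  obtain ⟨h, hl, hneg⟩ := ha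
  obtain ⟨g, gl, gneg⟩ := hb
  have hmin : ∀ t, t ≤ a + b → ∃ u v, u ≤ a ∧ v ≤ b ∧ u + v = t ∧
      ∀ u' ≤ a, ∀ v' ≤ b, u' + v' = t → h u + g v ≤ h u' + g v' := by
    intro t ht
    obtain ⟨⟨u, v⟩, huv, hm⟩ := Finset.exists_min_image
      ((Finset.range (a + 1) ×ˢ Finset.range (b + 1)).filter fun z => z.1 + z.2 = t)
      (fun z => h z.1 + g z.2) ⟨(min t a, t - min t a), by simp; omega⟩
    simp only [Finset.mem_filter, Finset.mem_product, Finset.mem_range] at huv hm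
    refine ⟨u, v, by omega, by omega, huv.2, fun u' hu' v' hv' e => ?_⟩
    exact hm (u', v') ⟨⟨by simp; omega, by simp; omega⟩, e⟩
  choose! U V hU hV hUV hle using hmin
  refine ⟨fun t => h (U t) + g (V t), fun t ht => ?_, fun t ht => ?_⟩
  · obtain ⟨l, l1, l2, l3⟩ := hl (U t) (hU t ht)
    obtain ⟨l', l1', l2', l3'⟩ := gl (V t) (hV t ht)
    refine ⟨l ++ l', by simp [l1, l1'], ?_, ?_⟩
    · have := hUV t ht
      simp only [List.sum_append]; omega
    · simp only [List.map_append, List.sum_append]; linarith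
  · have := sum_range_le_of_le_add (f := h) (g := g) (h := fun t => h (U t) + g (V t))
      (a := a) (b := b) (fun u hu v hv => hle _ (by omega) u hu v hv rfl) t (min t a) (t - min t a)
      (by omega) (by omega) (by omega)
    refine this.trans_lt (add_neg (mul_neg_of_pos_of_neg (by positivity) (hneg _ (by omega)))
      (mul_neg_of_pos_of_neg (by positivity) (gneg _ (by omega))))

theorem Reach.nsmul_add_nsmul {f : ℕ → ℝ} {i j : ℕ} (hi : Reach f 1 i) (hj : Reach f 1 j) :
    ∀ n p q : ℕ, p + q = n + 1 → Reach f (n + 1) (p * i + q * j) := by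
  intro n
  induction n with
  | zero =>
    intro p q h
    rcases p with _ | p
    · obtain rfl : q = 1 := by omega
      simpa using hj
    · obtain rfl : p = 0 := by omega
      obtain rfl : q = 0 := by omega
      simpa using hi
  | succ n ih =>
    intro p q h
    rcases p with _ | p
    · rcases q with _ | q
      · omega
      · convert! (ih 0 q (by omega)).add hj using 1; ring
    · convert! (ih p q (by omega)).add hi using 1; ring

theorem Reach.nsmul {f : ℕ → ℝ} {i : ℕ} (hi : Reach f 1 i) {n : ℕ} (hn : 1 ≤ n) :
    Reach f n (n * i) := by
  obtain ⟨n, rfl⟩ : ∃ n', n = n' + 1 := ⟨n - 1, by omega⟩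
  simpa using hi.nsmul_add_nsmul hi n (n + 1) 0 (by omega)

/-- Averaging over all ways to split a sum `s` between two families of lists. -/
theorem Reach.exists_list {f : ℕ → ℝ} {n n' a b s : ℕ} (ha : Reach f n a) (hb : Reach f n' b)
    (has : a ≤ s) (hbs : b ≤ s) (hs : s ≤ a + b) :
    ∃ l : List ℕ, l.length = n + n' ∧ l.sum = s ∧ (l.map f).sum < 0 := by
  obtain ⟨h, hl, hneg⟩ := ha
  obtain ⟨g, gl, gneg⟩ := hb
  obtain ⟨T, hT⟩ : ∃ T, T + s = a + b := ⟨a + b - s, by omega⟩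
  have h1 := hneg T (by omega)
  have h2 := gneg T (by omega)
  rw [← Finset.sum_range_reflect] at h2
  have h3 : ∑ x ∈ Finset.range (T + 1), (h x + g (T + 1 - 1 - x)) < 0 := by
    rw [Finset.sum_add_distrib]; linarith
  obtain ⟨x, hx, hx0⟩ := Finset.exists_lt_of_sum_lt (g := fun _ => (0 : ℝ)) (by simpa using h3)
  have hx := Finset.mem_range.mp hx
  obtain ⟨l, l1, l2, l3⟩ := hl x (by omega)
  obtain ⟨l', l1', l2', l3'⟩ := gl (T - x) (by omega)
  refine ⟨l ++ l', by simp [l1, l1'], ?_, ?_⟩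
  · simp only [List.sum_append]; omega
  · simp only [List.map_append, List.sum_append]; linarith

/-- Weighted averaging over the triples with sum `r` on the boundaries of the nested hexagons
`[d, N - d]³`, with weight `2N - r - d`: the resulting combination of prefix sums of `h` has only
nonnegative coefficients. -/
theorem NegPrefixSums.exists_triple {h : ℕ → ℝ} {N r : ℕ} (hneg : NegPrefixSums h N)
    (h1 : N < r) (h2 : 2 * r ≤ 3 * N) :
    ∃ a b c, a ≤ N ∧ b ≤ N ∧ c ≤ N ∧ a + b + c = r ∧ h a + h b + h c < 0 := by
  by_contra! hcon
  obtain ⟨M, rfl⟩ : ∃ M, r = N + M := ⟨r - N, by omega⟩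
  set S : ℕ → ℝ := fun t => ∑ x ∈ Finset.range t, h x with hS
  have hSs : ∀ t, S (t + 1) = S t + h t := fun t => Finset.sum_range_succ _ _
  have hS0 : S 0 = 0 := by simp [hS]
  have hSneg : ∀ t, t ≤ N → S (t + 1) < 0 := hneg
  -- triples `(d, x, r - d - x)` with `M ≤ x ≤ N - d`
  have hA : ∀ d, d < M → 0 ≤ ((N : ℝ) - M - d + 1) * h d + 2 * (S (N - d + 1) - S M) := by
    intro d hd
    have e : ∀ x ∈ Finset.Ico M (N - d + 1), 0 ≤ h d + h x + h (N - d + M - x) := by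
      intro x hx
      have := Finset.mem_Ico.mp hx
      exact hcon d x _ (by omega) (by omega) (by omega) (by omega)
    have e2 := Finset.sum_nonneg e
    rw [Finset.sum_add_distrib, Finset.sum_add_distrib] at e2
    have e3 : ∑ x ∈ Finset.Ico M (N - d + 1), h (N - d + M - x)
        = ∑ x ∈ Finset.Ico M (N - d + 1), h x := by
      rw [Finset.sum_Ico_reflect _ _ (by omega)]
      congr 2 <;> omega
    rw [e3, Finset.sum_const, Finset.sum_Ico_eq_sub _ (by omega), Nat.card_Ico, nsmul_eq_mul] at e2
    rw [Nat.cast_sub (by omega), Nat.cast_add, Nat.cast_sub (by omega)] at e2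
    simp only [hS]
    push_cast at e2
    linarith
  -- triples `(N - d, y, M + d - y)` with `d < y < M`
  have hB : ∀ d, d < M → 0 ≤ ((M : ℝ) - d - 1) * h (N - d) + 2 * (S M - S (d + 1)) := by
    intro d hd
    have e : ∀ x ∈ Finset.Ico (d + 1) M, 0 ≤ h (N - d) + h x + h (M + d - x) := by
      intro x hx
      have := Finset.mem_Ico.mp hx
      exact hcon _ x _ (by omega) (by omega) (by omega) (by omega)
    have e2 := Finset.sum_nonneg e
    rw [Finset.sum_add_distrib, Finset.sum_add_distrib] at e2
    have e3 : ∑ x ∈ Finset.Ico (d + 1) M, h (M + d - x) = ∑ x ∈ Finset.Ico (d + 1) M, h x := by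
      rw [Finset.sum_Ico_reflect _ _ (by omega)]
      congr 2 <;> omega
    rw [e3, Finset.sum_const, Finset.sum_Ico_eq_sub _ (by omega), Nat.card_Ico, nsmul_eq_mul] at e2
    rw [Nat.cast_sub (by omega)] at e2
    simp only [hS]
    push_cast at e2
    linarith
  have hMN : 2 * (M : ℝ) ≤ N := by exact_mod_cast (by omega : 2 * M ≤ N)
  -- the weighted partial sums telescope
  have key : ∀ D, D ≤ M → ∑ d ∈ Finset.range D, ((N : ℝ) - M - d) *
      (((N : ℝ) - M - d + 1) * h d + ((M : ℝ) - d - 1) * h (N - d)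
        + 2 * (S (N - d + 1) - S (d + 1))) =
      ((N : ℝ) - M - D + 1) * (N - M - D) * S D - (M - D) * (N - M - D + 1) * S (N - D + 1)
      + (N - M + 1) * M * S (N + 1) + (N - 2 * M) * ∑ d ∈ Finset.range D, S (N - d + 1) := by
    intro D
    induction D with
    | zero => intro _; simp [hS0]; ring
    | succ D ih =>
      intro hD
      rw [Finset.sum_range_succ, ih (by omega), Finset.sum_range_succ]
      have e1 : N - D + 1 = (N - (D + 1) + 1) + 1 := by omega
      have e2 : N - D = N - (D + 1) + 1 := by omega
      have e3 : h (N - D) = S (N - D + 1) - S (N - (D + 1) + 1) := by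
        rw [e1, hSs, ← e2]; ring
      have e4 : h D = S (D + 1) - S D := by rw [hSs]; ring
      rw [e3, e4]
      push_cast
      ring
  have hpos : 0 ≤ ∑ d ∈ Finset.range M, ((N : ℝ) - M - d) *
      (((N : ℝ) - M - d + 1) * h d + ((M : ℝ) - d - 1) * h (N - d)
        + 2 * (S (N - d + 1) - S (d + 1))) := by
    refine Finset.sum_nonneg fun d hd => mul_nonneg ?_ ?_
    · have : (d : ℝ) ≤ M := by exact_mod_cast (Finset.mem_range.mp hd).le
      linarith
    · have a1 := hA d (Finset.mem_range.mp hd)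
      have a2 := hB d (Finset.mem_range.mp hd)
      linarith
  rw [key M le_rfl] at hpos
  have hM1 : (1 : ℝ) ≤ M := by exact_mod_cast (by omega : 1 ≤ M)
  have t1 : ((N : ℝ) - M - M + 1) * (N - M - M) * S M ≤ 0 := by
    obtain ⟨M', rfl⟩ : ∃ M', M = M' + 1 := ⟨M - 1, by omega⟩
    have := hSneg M' (by omega)
    refine mul_nonpos_of_nonneg_of_nonpos (mul_nonneg ?_ ?_) this.le <;> push_cast at hMN ⊢ <;> linarith
  have t2 : (N - M + 1) * M * S (N + 1) < 0 :=
    mul_neg_of_pos_of_neg (mul_pos (by linarith) (by linarith)) (hSneg N le_rfl)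
  have t3 : (N - 2 * (M : ℝ)) * ∑ d ∈ Finset.range M, S (N - d + 1) ≤ 0 :=
    mul_nonpos_of_nonneg_of_nonpos (by linarith)
      (Finset.sum_nonpos fun d _ => (hSneg (N - d) (by omega)).le)
  have t4 : ((M : ℝ) - M) * (N - M - M + 1) * S (N - M + 1) = 0 := by ring
  linarith

/-- If `f` has negative suffix sums on `[0, i]` and on `[0, j]`, where `i < 2s/k ≤ j ≤ s`, then some
`k` numbers with sum `s` have a negative sum of `f`-values. -/
theorem exists_list_of_negSuffixSums {f : ℕ → ℝ} {i j s k : ℕ} (hk : 3 ≤ k)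
    (hi : NegSuffixSums f i) (hj : NegSuffixSums f j) (hik : k * i < 2 * s) (hjk : 2 * s ≤ k * j)
    (hjs : j ≤ s) : ∃ l : List ℕ, l.length = k ∧ l.sum = s ∧ (l.map f).sum < 0 := by
  have ri := hi.reach
  have rj := hj.reach
  by_cases h1 : k * i < s
  · -- one entry of type `j` against `k - 1` entries whose maximal sum is less than `s`
    have hq : ∃ q, q < k ∧ (k - q) * i + q * j < s ∧ s ≤ (k - (q + 1)) * i + (q + 1) * j := by
      by_contra! hcon
      have : ∀ q, q ≤ k → (k - q) * i + q * j < s := by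
        intro q
        induction q with
        | zero => intro _; simpa using h1
        | succ q ih => intro hq; exact hcon q (by omega) (ih (by omega))
      have := this k le_rfl
      simp at this; omega
    obtain ⟨q, hq, hlt, hle⟩ := hq
    obtain ⟨p, rfl⟩ : ∃ p, k = p + q + 1 := ⟨k - q - 1, by omega⟩
    have e1 : p + q + 1 - q = p + 1 := by omega
    have e2 : p + q + 1 - (q + 1) = p := by omega
    rw [e1] at hlt; rw [e2] at hle
    obtain ⟨n, hn⟩ : ∃ n, p + q = n + 1 := ⟨p + q - 1, by omega⟩
    have r := ri.nsmul_add_nsmul rj n p q hn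
    rw [hn]
    refine r.exists_list rj ?_ hjs ?_
    · nlinarith
    · nlinarith
  push Not at h1
  -- otherwise only entries of type `i` are used, in two nearly equal groups if possible
  by_cases h2 : (k - k / 2) * i ≤ s
  · have := (ri.nsmul (n := k / 2) (by omega)).exists_list (ri.nsmul (n := k - k / 2) (by omega))
      (s := s) (le_trans (Nat.mul_le_mul_right _ (by omega)) h2) h2
      (by rw [← add_mul, Nat.add_sub_cancel' (by omega)]; exact h1)
    rwa [Nat.add_sub_cancel' (by omega)] at this
  push Not at h2
  -- now `k` is odd: use pairs with sum `i` and one triple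
  rcases Nat.even_or_odd' k with ⟨p, rfl | rfl⟩
  · have : 2 * p - 2 * p / 2 = p := by omega
    rw [this] at h2; nlinarith
  obtain ⟨p, rfl⟩ : ∃ p', p = p' + 1 := ⟨p - 1, by omega⟩
  have e1 : 2 * (p + 1) + 1 - (2 * (p + 1) + 1) / 2 = p + 2 := by omega
  rw [e1] at h2
  have hpairs : ∀ n, ∃ l : List ℕ, l.length = 2 * n ∧ l.sum = n * i ∧ (l.map f).sum ≤ 0 := by
    intro n
    induction n with
    | zero => exact ⟨[], by simp⟩
    | succ n ih =>
      obtain ⟨l, l1, l2, l3⟩ := ih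
      obtain ⟨l', l1', l2', l3'⟩ := ri.exists_list ri le_rfl le_rfl (by omega : i ≤ i + i)
      refine ⟨l ++ l', by simp [l1, l1']; ring, by simp [l2, l2']; ring, ?_⟩
      simp only [List.map_append, List.sum_append]; linarith
  obtain ⟨l, l1, l2, l3⟩ := hpairs p
  have e2 : (p + 2) * i = p * i + 2 * i := by ring
  have e3 : (2 * (p + 1) + 1) * i = 2 * (p * i) + 3 * i := by ring
  obtain ⟨a, b, c, ha, hb, hc, habc, hlt⟩ := hi.reverse.exists_triple (r := 3 * i - (s - p * i))
    (by omega) (by omega)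
  refine ⟨(i - a) :: (i - b) :: (i - c) :: l, by simp [l1]; ring, ?_, ?_⟩
  · simp only [List.sum_cons, l2]; omega
  · simp only [List.map_cons, List.sum_cons]; linarith

/-- A smallest minimiser of a function on a finite set of natural numbers. -/
theorem exists_first_min (L : Finset ℕ) (hL : L.Nonempty) (S : ℕ → ℝ) :
    ∃ i ∈ L, (∀ l ∈ L, S i ≤ S l) ∧ ∀ l ∈ L, l < i → S i < S l := by
  obtain ⟨i, hi, hm⟩ := Finset.exists_min_image L (fun l => toLex (S l, l)) hL
  refine ⟨i, hi, fun l hl => ?_, fun l hl hlt => ?_⟩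
  · rcases Prod.Lex.le_iff.mp (hm l hl) with h | h
    · exact h.le
    · exact h.1.le
  · rcases Prod.Lex.le_iff.mp (hm l hl) with h | h
    · exact h
    · exact absurd h.2 (not_le.mpr hlt)

theorem negSuffixSums_of_first_min {f : ℕ → ℝ} {i : ℕ}
    (h0 : ∑ a ∈ Finset.range (i + 1), f a < 0)
    (h : ∀ l < i, ∑ a ∈ Finset.range (i + 1), f a < ∑ a ∈ Finset.range (l + 1), f a) :
    NegSuffixSums f i := by
  intro x hx
  rw [Finset.sum_Ico_eq_sub _ (by omega)]
  rcases x with _ | x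
  · simpa using h0
  · linarith [h x (by omega)]

/-- If `f` has nonnegative sum over all `k`-tuples with sum `s`, then after subtracting a multiple of
the linear function `a - s/k`, which has zero sum over all such tuples, all prefix sums of `f` on
`[0, s]` are nonnegative. Otherwise, a suitable multiple makes the prefix sums attain a strict first
negative minimum both at some `i < 2s/k` and at some `j ≥ 2s/k`. -/
theorem exists_shift_prefix_nonneg {f : ℕ → ℝ} {s k : ℕ} (hk : 3 ≤ k) (hs : 1 ≤ s)
    (hf : ∀ l : List ℕ, l.length = k → l.sum = s → 0 ≤ (l.map f).sum) :
    ∃ c : ℝ, ∀ t ≤ s, 0 ≤ ∑ a ∈ Finset.range (t + 1), (f a + c * ((s : ℝ) / k - a)) := by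
  have hk0 : (0 : ℝ) < k := by positivity
  set S : ℕ → ℝ := fun t => ∑ a ∈ Finset.range (t + 1), f a with hS
  set D : ℕ → ℝ := fun t => ∑ a ∈ Finset.range (t + 1), ((s : ℝ) / k - a) with hD
  have hDval : ∀ t, D t = (t + 1) * (s / k - t / 2) := by
    intro t
    simp only [hD]
    induction t with
    | zero => simp
    | succ t ih => rw [Finset.sum_range_succ, ih]; push_cast; ring
  have hSD : ∀ c t, ∑ a ∈ Finset.range (t + 1), (f a + c * ((s : ℝ) / k - a)) = S t + c * D t := by
    intro c t
    simp only [hS, hD]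
    rw [Finset.sum_add_distrib, Finset.mul_sum]
  simp only [hSD]
  set L := (Finset.range (s + 1)).filter fun t => k * t < 2 * s with hL
  have hDpos : ∀ t ∈ L, 0 < D t := by
    intro t ht
    have h1 := (Finset.mem_filter.mp ht).2
    rw [hDval]
    have h2 : (k : ℝ) * t < 2 * s := by exact_mod_cast h1
    have h3 : (t : ℝ) / 2 < s / k := by rw [div_lt_div_iff₀ (by norm_num) hk0]; linarith
    have : (0 : ℝ) < t + 1 := by positivity
    exact mul_pos this (by linarith)
  have hLne : L.Nonempty := ⟨0, by simp [hL]; omega⟩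
  obtain ⟨t0, ht0, hmax⟩ := Finset.exists_max_image L (fun t => -S t / D t) hLne
  set c0 := -S t0 / D t0 with hc0
  have hlow : ∀ t ∈ L, 0 ≤ S t + c0 * D t := by
    intro t ht
    have h1 := hmax t ht
    rw [div_le_iff₀ (hDpos t ht)] at h1
    linarith
  -- `c0` is the least multiple for which the prefix sums up to `2s/k` are nonnegative
  refine ⟨c0, fun t ht => ?_⟩
  by_contra! hneg
  -- for `c` slightly below `c0`, the global minimum stays beyond `2s/k`
  have hcont : ∀ t, Continuous fun c : ℝ => S t + c * D t := fun t => by fun_prop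
  have hev : ∀ᶠ c in nhdsWithin c0 (Set.Iio c0), (S t + c * D t < 0 ∧
      ∀ l ∈ L, S t + c * D t < S l + c * D l) ∧ c < c0 := by
    refine Filter.Eventually.and (Filter.Eventually.filter_mono nhdsWithin_le_nhds ?_)
      self_mem_nhdsWithin
    refine Filter.Eventually.and ((hcont t).continuousAt.eventually_lt continuousAt_const hneg) ?_
    rw [Filter.eventually_all_finset]
    intro l hl
    exact (hcont t).continuousAt.eventually_lt (hcont l).continuousAt (hneg.trans_le (hlow l hl))
  obtain ⟨c, ⟨hct, hcL⟩, hcc⟩ := hev.exists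
  obtain ⟨i, hiL, himin, hifirst⟩ := exists_first_min L hLne fun t => S t + c * D t
  obtain ⟨j, hj, hjmin, hjfirst⟩ := exists_first_min (Finset.range (s + 1)) (by simp)
    fun t => S t + c * D t
  have hjt := hjmin t (by simp; omega)
  have hjL : j ∉ L := fun h => absurd (hcL j h) (not_lt.mpr hjt)
  have hjs : j ≤ s := by simpa [Nat.lt_succ_iff] using hj
  have hjk : 2 * s ≤ k * j := by
    by_contra! h
    exact hjL (Finset.mem_filter.mpr ⟨hj, h⟩)
  have hik := (Finset.mem_filter.mp hiL).2
  have hi0 : S i + c * D i < 0 := by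
    refine (himin t0 ht0).trans_lt ?_
    have h1 : S t0 + c0 * D t0 = 0 := by
      rw [hc0, div_mul_cancel₀ _ (hDpos t0 ht0).ne']; ring
    nlinarith [hDpos t0 ht0]
  have ni : NegSuffixSums (fun a => f a + c * ((s : ℝ) / k - a)) i := by
    refine negSuffixSums_of_first_min (by rw [hSD]; exact hi0) fun l hl => ?_
    rw [hSD, hSD]
    refine hifirst l (Finset.mem_filter.mpr ⟨?_, by nlinarith⟩) hl
    have := Finset.mem_range.mp (Finset.mem_filter.mp hiL).1
    exact Finset.mem_range.mpr (by omega)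
  have nj : NegSuffixSums (fun a => f a + c * ((s : ℝ) / k - a)) j := by
    refine negSuffixSums_of_first_min (by rw [hSD]; exact hjt.trans_lt hct) fun l hl => ?_
    rw [hSD, hSD]
    exact hjfirst l (Finset.mem_range.mpr (by omega)) hl
  obtain ⟨l, l1, l2, l3⟩ := exists_list_of_negSuffixSums hk ni nj hik hjk hjs
  have h1 : ∀ l : List ℕ, (l.map fun a : ℕ => f a + c * ((s : ℝ) / k - a)).sum
      = (l.map f).sum + c * (l.length * ((s : ℝ) / k) - l.sum) := by
    intro l
    induction l with
    | nil => simp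
    | cons a l ih => simp only [List.map_cons, List.sum_cons, ih, List.length_cons]; push_cast; ring
  rw [h1, l1, l2, mul_div_cancel₀ _ hk0.ne', sub_self, mul_zero, add_zero] at l3
  exact absurd (hf l l1 l2) (not_le.mpr l3)

/-! ### A coupling with prescribed marginals -/

/-- The `k`-tuples of elements of `{0, …, m - 1}` with sum `m - 1`. -/
abbrev Simplex (m k : ℕ) : Type := {τ : Fin k → Fin m // ∑ i, (τ i : ℕ) + 1 = m}

/-- A function on `{0, …, m - 1}` with zero mean under a strictly decreasing distribution of mean
`(m - 1)/k`, and with nonpositive sum over all tuples in the simplex, is zero as soon as it vanishes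
at `0` and `1`. -/
theorem eq_zero_of_sum_simplex_nonpos {m k : ℕ} (hm : 2 ≤ m) (hk : 3 ≤ k) {ψ : ℕ → ℝ}
    (hanti : ∀ a, a + 1 < m → ψ (a + 1) < ψ a) (hpos : 0 < ψ (m - 1))
    (hsum : ∑ a ∈ Finset.range m, ψ a = 1)
    (hmean : k * ∑ a ∈ Finset.range m, ψ a * a = m - 1)
    {θ : ℕ → ℝ} (h0 : θ 0 = 0) (h1 : θ 1 = 0)
    (hθ : ∀ τ : Simplex m k, ∑ i, θ (τ.1 i) ≤ k * ∑ a ∈ Finset.range m, ψ a * θ a) :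
    ∀ a < m, θ a = 0 := by
  obtain ⟨s, rfl⟩ : ∃ s, m = s + 1 := ⟨m - 1, by omega⟩
  have hk0 : (0 : ℝ) < k := by positivity
  set μ := ∑ a ∈ Finset.range (s + 1), ψ a * θ a with hμ
  push_cast at hmean
  have hmean' : ∑ a ∈ Finset.range (s + 1), ψ a * a = s / k := by
    rw [eq_div_iff hk0.ne']; linarith
  have hf : ∀ l : List ℕ, l.length = k → l.sum = s → 0 ≤ (l.map fun a => μ - θ a).sum := by
    intro l hl hls
    subst hl
    have hle : ∀ i : Fin l.length, l.get i < s + 1 := by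
      intro i
      have := List.single_le_sum (l := l) (fun _ _ => Nat.zero_le _) (l.get i) (List.get_mem _ _)
      omega
    have := hθ ⟨fun i => ⟨l.get i, hle i⟩, by
      simp only
      rw [← hls]; simp [Fin.sum_univ_getElem]⟩
    have e : (l.map fun a => μ - θ a).sum = ∑ i : Fin l.length, (μ - θ (l.get i)) := by
      rw [← List.sum_ofFn]
      congr 1
      apply List.ext_get <;> simp
    rw [e, Finset.sum_sub_distrib]
    simp only [Finset.sum_const, Finset.card_univ, Fintype.card_fin, nsmul_eq_mul]
    linarith
  obtain ⟨c, hc⟩ := exists_shift_prefix_nonneg hk (by omega) hf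
  set g : ℕ → ℝ := fun a => μ - θ a + c * ((s : ℝ) / k - a) with hg
  -- summation by parts
  have habel : ∀ t, ∑ a ∈ Finset.range (t + 1), ψ a * g a = ψ t * ∑ a ∈ Finset.range (t + 1), g a +
      ∑ b ∈ Finset.range t, (ψ b - ψ (b + 1)) * ∑ a ∈ Finset.range (b + 1), g a := by
    intro t
    induction t with
    | zero => simp
    | succ t ih =>
      rw [Finset.sum_range_succ, ih, Finset.sum_range_succ (fun b =>
        (ψ b - ψ (b + 1)) * ∑ a ∈ Finset.range (b + 1), g a) t, Finset.sum_range_succ g (t + 1)]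
      ring
  have hzero : ∑ a ∈ Finset.range (s + 1), ψ a * g a = 0 := by
    have : ∀ a, ψ a * g a = μ * ψ a - ψ a * θ a + c * (s / k * ψ a - ψ a * a) := by
      intro a; simp only [hg]; ring
    simp only [this, Finset.sum_add_distrib, Finset.sum_sub_distrib, ← Finset.mul_sum, hsum, hmean']
    rw [← hμ]; ring
  rw [habel s] at hzero
  have hterm : ∀ b ∈ Finset.range s, 0 ≤ (ψ b - ψ (b + 1)) * ∑ a ∈ Finset.range (b + 1), g a := by
    intro b hb
    have := Finset.mem_range.mp hb
    exact mul_nonneg (by linarith [hanti b (by omega)]) (hc b (by omega))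
  simp only [Nat.add_sub_cancel] at hpos
  have hS : ∀ t ≤ s, ∑ a ∈ Finset.range (t + 1), g a = 0 := by
    have n1 := mul_nonneg hpos.le (hc s le_rfl)
    have n2 := Finset.sum_nonneg hterm
    have z1 : ψ s * ∑ a ∈ Finset.range (s + 1), g a = 0 := by linarith
    have z2 : ∑ b ∈ Finset.range s, (ψ b - ψ (b + 1)) * ∑ a ∈ Finset.range (b + 1), g a = 0 := by
      linarith
    intro t ht
    rcases ht.lt_or_eq with h | rfl
    · have := (Finset.sum_eq_zero_iff_of_nonneg hterm).mp z2 t (Finset.mem_range.mpr h)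
      rcases mul_eq_zero.mp this with h' | h'
      · linarith [hanti t (by omega)]
      · exact h'
    · exact (mul_eq_zero.mp z1).resolve_left hpos.ne'
  have hg0 : ∀ a ≤ s, g a = 0 := by
    intro a ha
    rcases a with _ | a
    · simpa using hS 0 ha
    · have e1 := hS (a + 1) ha
      rw [Finset.sum_range_succ, hS a (by omega)] at e1
      linarith
  have g0 := hg0 0 (by omega)
  have g1 := hg0 1 (by omega)
  simp only [hg, h0, h1] at g0 g1
  push_cast at g0 g1
  have hc0 : c = 0 := by linarith
  intro a ha
  have ga := hg0 a (by omega)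
  simp only [hg] at ga
  rw [hc0] at ga g0
  linarith

/-- The exponent in the convex function whose critical points give couplings with marginals `ψ`. -/
noncomputable def simplexForm {m k : ℕ} (ψ : ℕ → ℝ) (τ : Simplex m k) (θ : Fin m → ℝ) : ℝ :=
  ∑ i, θ (τ.1 i) - k * ∑ a : Fin m, ψ a * θ a

theorem simplexForm_add_smul {m k : ℕ} (ψ : ℕ → ℝ) (τ : Simplex m k) (θ d : Fin m → ℝ) (t : ℝ) :
    simplexForm ψ τ (θ + t • d) = simplexForm ψ τ θ + t * simplexForm ψ τ d := by
  simp only [simplexForm, Pi.add_apply, Pi.smul_apply, smul_eq_mul, mul_add, Finset.sum_add_distrib,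
    mul_sub, Finset.mul_sum]
  have : ∀ a : Fin m, (k : ℝ) * (ψ a * (t * d a)) = t * (k * (ψ a * d a)) := fun a => by ring
  simp only [this]
  ring

theorem simplexForm_smul {m k : ℕ} (ψ : ℕ → ℝ) (τ : Simplex m k) (d : Fin m → ℝ) (t : ℝ) :
    simplexForm ψ τ (t • d) = t * simplexForm ψ τ d := by
  have h := simplexForm_add_smul ψ τ 0 d t
  simpa [simplexForm] using h

theorem continuous_simplexForm {m k : ℕ} (ψ : ℕ → ℝ) (τ : Simplex m k) :
    Continuous (simplexForm ψ τ) := by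
  unfold simplexForm; fun_prop

/-- The convex function `∑ τ, exp (simplexForm ψ τ θ)` has a critical point: it is invariant under
adding affine functions to `θ`, and coercive on the functions `θ` vanishing at `0` and `1`. -/
theorem exists_critical_simplexForm {m k : ℕ} (hm : 2 ≤ m) (hk : 3 ≤ k) {ψ : ℕ → ℝ}
    (hanti : ∀ a, a + 1 < m → ψ (a + 1) < ψ a) (hpos : 0 < ψ (m - 1))
    (hsum : ∑ a ∈ Finset.range m, ψ a = 1)
    (hmean : k * ∑ a ∈ Finset.range m, ψ a * a = m - 1) :
    ∃ θ : Fin m → ℝ, ∀ d : Fin m → ℝ,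
      ∑ τ : Simplex m k, Real.exp (simplexForm ψ τ θ) * simplexForm ψ τ d = 0 := by
  set z0 : Fin m := ⟨0, by omega⟩ with hz0
  set z1 : Fin m := ⟨1, by omega⟩ with hz1
  set K : Set (Fin m → ℝ) := {θ | θ z0 = 0 ∧ θ z1 = 0} with hK
  have hKclosed : IsClosed K :=
    (isClosed_eq (continuous_apply z0) continuous_const).inter
      (isClosed_eq (continuous_apply z1) continuous_const)
  set G : (Fin m → ℝ) → ℝ := fun θ => ∑ τ : Simplex m k, max (simplexForm ψ τ θ) 0 with hG
  have hGcont : Continuous G := by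
    refine continuous_finsetSum _ fun τ _ => ?_
    exact (continuous_simplexForm ψ τ).max continuous_const
  have hGpos : ∀ θ ∈ K, θ ≠ 0 → 0 < G θ := by
    intro θ hθ hne
    by_contra! hle
    have hall : ∀ τ : Simplex m k, simplexForm ψ τ θ ≤ 0 := by
      intro τ
      have h1 : max (simplexForm ψ τ θ) 0 ≤ G θ :=
        Finset.single_le_sum (f := fun τ : Simplex m k => max (simplexForm ψ τ θ) 0)
          (fun _ _ => le_max_right _ _) (Finset.mem_univ τ)
      exact (le_max_left _ _).trans (h1.trans hle)
    apply hne
    set θ' : ℕ → ℝ := fun a => if h : a < m then θ ⟨a, h⟩ else 0 with hθ'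
    have hθθ : ∀ a : Fin m, θ' a = θ a := fun a => by simp [hθ']
    have := eq_zero_of_sum_simplex_nonpos hm hk hanti hpos hsum hmean (θ := θ')
      (by rw [← hθ.1, ← hθθ]) (by rw [← hθ.2, ← hθθ]) (fun τ => by
        have h2 := hall τ
        rw [Finset.sum_range]
        simp only [hθθ]
        unfold simplexForm at h2
        linarith)
    ext a
    rw [← hθθ, this a a.2]; rfl
  -- coercivity, by homogeneity and compactness of the unit sphere
  obtain ⟨c, hc0, hc⟩ : ∃ c > 0, ∀ θ ∈ K, c * ‖θ‖ ≤ G θ := by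
    have hcomp : IsCompact (Metric.sphere (0 : Fin m → ℝ) 1 ∩ K) :=
      (isCompact_sphere _ _).inter_right hKclosed
    have hscale : ∀ c, (∀ θ ∈ Metric.sphere (0 : Fin m → ℝ) 1 ∩ K, c ≤ G θ) →
        ∀ θ ∈ K, c * ‖θ‖ ≤ G θ := by
      intro c h θ hθ
      by_cases h0 : θ = 0
      · subst h0
        simp only [norm_zero, mul_zero]
        exact Finset.sum_nonneg fun _ _ => le_max_right _ _
      have hn : 0 < ‖θ‖ := norm_pos_iff.mpr h0
      have h1 := h (‖θ‖⁻¹ • θ) ⟨by simp [norm_smul, hn.ne'], by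
        constructor
        · simp [hθ.1]
        · simp [hθ.2]⟩
      have h2 : G (‖θ‖⁻¹ • θ) = ‖θ‖⁻¹ * G θ := by
        simp only [hG, simplexForm_smul, Finset.mul_sum]
        refine Finset.sum_congr rfl fun τ _ => ?_
        rw [mul_max_of_nonneg _ _ (inv_nonneg.mpr hn.le), mul_zero]
      rw [h2, inv_mul_eq_div, le_div_iff₀ hn] at h1
      exact h1
    rcases (Metric.sphere (0 : Fin m → ℝ) 1 ∩ K).eq_empty_or_nonempty with he | hne
    · exact ⟨1, one_pos, hscale 1 fun θ hθ => by rw [he] at hθ; exact hθ.elim⟩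
    · obtain ⟨θ, hθ, hmin⟩ := hcomp.exists_isMinOn hne hGcont.continuousOn
      refine ⟨G θ, hGpos θ hθ.2 ?_, hscale _ fun x hx => hmin hx⟩
      rintro rfl
      simpa using hθ.1
  set Ψ : (Fin m → ℝ) → ℝ := fun θ => ∑ τ : Simplex m k, Real.exp (simplexForm ψ τ θ) with hΨ
  have hΨcont : Continuous Ψ :=
    continuous_finsetSum _ fun τ _ => Real.continuous_exp.comp (continuous_simplexForm ψ τ)
  have hGΨ : ∀ θ, G θ ≤ Ψ θ := fun θ => Finset.sum_le_sum fun τ _ =>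
    max_le (by linarith [Real.add_one_le_exp (simplexForm ψ τ θ)]) (Real.exp_pos _).le
  have h0K : (0 : Fin m → ℝ) ∈ K := ⟨rfl, rfl⟩
  have hΨ0 : 0 ≤ Ψ 0 := Finset.sum_nonneg fun _ _ => (Real.exp_pos _).le
  obtain ⟨θ, hθ, hmin⟩ := ((isCompact_closedBall (0 : Fin m → ℝ) (Ψ 0 / c)).inter_right
    hKclosed).exists_isMinOn ⟨0, by simp; positivity, h0K⟩ hΨcont.continuousOn
  have hglob : ∀ x ∈ K, Ψ θ ≤ Ψ x := by
    intro x hx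
    by_cases hb : ‖x‖ ≤ Ψ 0 / c
    · exact hmin ⟨by simpa using hb, hx⟩
    · push Not at hb
      rw [div_lt_iff₀ hc0] at hb
      have h1 : Ψ θ ≤ Ψ 0 := hmin ⟨by simp; positivity, h0K⟩
      have h2 := hc x hx
      have h3 := hGΨ x
      linarith
  have hcrit : ∀ d ∈ K, ∑ τ : Simplex m k, Real.exp (simplexForm ψ τ θ) * simplexForm ψ τ d = 0 := by
    intro d hd
    have hder : HasDerivAt (fun t : ℝ => Ψ (θ + t • d))
        (∑ τ : Simplex m k, Real.exp (simplexForm ψ τ θ) * simplexForm ψ τ d) 0 := by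
      simp only [hΨ, simplexForm_add_smul]
      refine HasDerivAt.fun_sum fun τ _ => ?_
      have h1 : HasDerivAt (fun t : ℝ => simplexForm ψ τ θ + t * simplexForm ψ τ d)
          (simplexForm ψ τ d) 0 := by
        simpa using ((hasDerivAt_id (0 : ℝ)).mul_const (simplexForm ψ τ d)).const_add
          (simplexForm ψ τ θ)
      simpa using h1.exp
    refine IsLocalMin.hasDerivAt_eq_zero (Filter.Eventually.of_forall fun t => ?_) hder
    simp only [zero_smul, add_zero]
    refine hglob _ ⟨?_, ?_⟩
    · simp [hθ.2.1, hd.1]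
    · simp [hθ.2.2, hd.2]
  refine ⟨θ, fun d => ?_⟩
  -- the form does not see the affine part of `d`
  set aff : Fin m → ℝ := fun a => d z0 + (d z1 - d z0) * (a : ℕ) with haff
  have hAff : ∀ τ : Simplex m k, simplexForm ψ τ aff = 0 := by
    intro τ
    have e1 : ∑ i, ((τ.1 i : ℕ) : ℝ) = m - 1 := by
      have h2 := τ.2
      have : (∑ i, ((τ.1 i : ℕ) : ℝ)) + 1 = m := by exact_mod_cast h2
      linarith
    have e2 : ∑ a : Fin m, ψ a = 1 := by rw [← hsum, Finset.sum_range]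
    have e3 : (k : ℝ) * ∑ a : Fin m, ψ a * (a : ℕ) = m - 1 := by rw [← hmean, Finset.sum_range]
    have e4 : ∀ a : Fin m, ψ a * (d z0 + (d z1 - d z0) * (a : ℕ))
        = d z0 * ψ a + (d z1 - d z0) * (ψ a * (a : ℕ)) := fun a => by ring
    simp only [simplexForm, haff, Finset.sum_add_distrib, ← Finset.mul_sum, e4, e1, e2]
    simp only [Finset.sum_const, Finset.card_univ, Fintype.card_fin, nsmul_eq_mul]
    rw [mul_add, mul_left_comm _ (d z1 - d z0), e3]
    ring
  have hmem : d - aff ∈ K := by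
    constructor <;> simp [haff, hz0, hz1]
  have hsub : ∀ τ : Simplex m k, simplexForm ψ τ d = simplexForm ψ τ (d - aff) := by
    intro τ
    have h1 := simplexForm_add_smul ψ τ d aff (-1)
    rw [hAff τ, mul_zero, add_zero] at h1
    rw [← h1]; congr 1; ext a; simp; ring
  simp only [hsub]
  exact hcrit _ hmem

/-- Permuting the entries of a tuple in the simplex. -/
def Simplex.perm {m k : ℕ} (σ : Equiv.Perm (Fin k)) : Simplex m k ≃ Simplex m k where
  toFun τ := ⟨τ.1 ∘ σ, by
    have := τ.2
    rw [← Equiv.sum_comp σ (fun i => (τ.1 i : ℕ))] at this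
    exact this⟩
  invFun τ := ⟨τ.1 ∘ σ.symm, by
    have := τ.2
    rw [← Equiv.sum_comp σ.symm (fun i => (τ.1 i : ℕ))] at this
    exact this⟩
  left_inv τ := by ext; simp
  right_inv τ := by ext; simp

instance {m k : ℕ} [NeZero m] [NeZero k] : Nonempty (Simplex m k) :=
  ⟨⟨fun i => if i = 0 then ⟨m - 1, Nat.sub_lt (Nat.pos_of_ne_zero (NeZero.ne m)) one_pos⟩
      else ⟨0, Nat.pos_of_ne_zero (NeZero.ne m)⟩, by
    have h : ∀ i : Fin k, ((if i = 0 then (⟨m - 1, Nat.sub_lt (Nat.pos_of_ne_zero (NeZero.ne m))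
        one_pos⟩ : Fin m) else ⟨0, Nat.pos_of_ne_zero (NeZero.ne m)⟩ : Fin m) : ℕ)
        = if i = 0 then m - 1 else 0 := by
      intro i; split_ifs <;> rfl
    simp only [h, Finset.sum_ite_eq', Finset.mem_univ, if_true]
    have := Nat.pos_of_ne_zero (NeZero.ne m)
    omega⟩⟩

/-- A strictly decreasing distribution `ψ` on `{0, …, m - 1}` of mean `(m - 1)/k` is the common
marginal of a product-form distribution on the `k`-tuples with sum `m - 1`. -/
theorem exists_coupling {m k : ℕ} (hm : 2 ≤ m) (hk : 3 ≤ k) {ψ : ℕ → ℝ}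
    (hanti : ∀ a, a + 1 < m → ψ (a + 1) < ψ a) (hpos : 0 < ψ (m - 1))
    (hsum : ∑ a ∈ Finset.range m, ψ a = 1)
    (hmean : k * ∑ a ∈ Finset.range m, ψ a * a = m - 1) :
    ∃ θ : Fin m → ℝ, ∀ (i : Fin k) (a : Fin m),
      ∑ τ : Simplex m k with τ.1 i = a, Real.exp (∑ j, θ (τ.1 j)) = ψ a := by
  obtain ⟨θ, hθ⟩ := exists_critical_simplexForm hm hk hanti hpos hsum hmean
  have : NeZero m := ⟨by omega⟩
  have : NeZero k := ⟨by omega⟩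
  have hk0 : (k : ℝ) ≠ 0 := by positivity
  set Z := ∑ τ : Simplex m k, Real.exp (simplexForm ψ τ θ) with hZ
  have hZ0 : 0 < Z := Finset.sum_pos (fun _ _ => Real.exp_pos _) Finset.univ_nonempty
  set μ := ∑ a : Fin m, ψ a * θ a with hμ
  refine ⟨fun a => θ a - μ - Real.log Z / k, fun i a => ?_⟩
  have hexp : ∀ τ : Simplex m k, Real.exp (∑ j, (θ (τ.1 j) - μ - Real.log Z / k))
      = Real.exp (simplexForm ψ τ θ) / Z := by
    intro τ
    rw [← Real.exp_log hZ0, ← Real.exp_sub, Real.exp_log hZ0]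
    congr 1
    simp only [Finset.sum_sub_distrib, Finset.sum_const, Finset.card_univ, Fintype.card_fin,
      nsmul_eq_mul, simplexForm]
    rw [mul_div_cancel₀ _ hk0]
  simp only [hexp]
  rw [← Finset.sum_div, div_eq_iff hZ0.ne']
  -- the critical point equation is tested on the indicator of `a`
  have hind : ∀ τ : Simplex m k, simplexForm ψ τ (fun b => if b = a then 1 else 0)
      = ∑ j, (if τ.1 j = a then (1 : ℝ) else 0) - k * ψ a := by
    intro τ; simp [simplexForm]
  have h1 := hθ fun b => if b = a then 1 else 0
  simp only [hind, mul_sub, Finset.sum_sub_distrib, ← Finset.sum_mul] at h1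
  rw [← hZ] at h1
  simp only [Finset.mul_sum] at h1
  rw [Finset.sum_comm] at h1
  have hsym : ∀ j : Fin k, ∑ τ : Simplex m k, Real.exp (simplexForm ψ τ θ) *
      (if τ.1 j = a then (1 : ℝ) else 0) = ∑ τ : Simplex m k with τ.1 i = a,
        Real.exp (simplexForm ψ τ θ) := by
    intro j
    rw [Finset.sum_filter, ← Equiv.sum_comp (Simplex.perm (Equiv.swap i j))]
    refine Finset.sum_congr rfl fun τ _ => ?_
    have e : simplexForm ψ (Simplex.perm (Equiv.swap i j) τ) θ = simplexForm ψ τ θ := by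
      unfold simplexForm
      congr 1
      exact Equiv.sum_comp (Equiv.swap i j) fun l => θ (τ.1 l)
    have e2 : (Simplex.perm (Equiv.swap i j) τ).1 j = τ.1 i := by simp [Simplex.perm]
    rw [e, e2]; simp
  simp only [hsym, Finset.sum_const, Finset.card_univ, Fintype.card_fin, nsmul_eq_mul] at h1
  have h2 : (k : ℝ) * (∑ τ : Simplex m k with τ.1 i = a, Real.exp (simplexForm ψ τ θ) - ψ a * Z)
      = 0 := by linarith
  linarith [(mul_eq_zero.mp h2).resolve_left hk0]

/-! ### Entropy of partitions -/

section
variable {T : Type*} [Fintype T]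

open Classical in
/-- The mass of the class of `τ` under the relation `r`. -/
noncomputable def relMass (π : T → ℝ) (r : T → T → Prop) (τ : T) : ℝ :=
  ∑ τ' with r τ τ', π τ'

/-- The entropy of the partition into classes of the equivalence relation `r`. -/
noncomputable def relEntropy (π : T → ℝ) (r : T → T → Prop) : ℝ :=
  ∑ τ, π τ * -Real.log (relMass π r τ)

variable {π : T → ℝ} {a b y : T → T → Prop}

theorem relMass_pos (hπ : ∀ τ, 0 < π τ) (ha : Equivalence a) (τ : T) : 0 < relMass π a τ :=
  Finset.sum_pos (fun _ _ => hπ _) ⟨τ, by simpa using ha.refl τ⟩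

theorem relMass_congr (ha : Equivalence a) {τ τ' : T} (h : a τ τ') :
    relMass π a τ = relMass π a τ' := by
  unfold relMass
  congr 1
  ext x
  simp only [Finset.mem_filter, Finset.mem_univ, true_and]
  exact ⟨fun h' => ha.trans (ha.symm h) h', fun h' => ha.trans h h'⟩

theorem relMass_le_of_imp (hπ : ∀ τ, 0 < π τ) (h : ∀ τ τ', a τ τ' → b τ τ') (τ : T) :
    relMass π a τ ≤ relMass π b τ := by
  unfold relMass
  refine Finset.sum_le_sum_of_subset_of_nonneg (fun x hx => ?_) fun _ _ _ => (hπ _).le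
  simp only [Finset.mem_filter, Finset.mem_univ, true_and] at hx ⊢
  exact h _ _ hx

theorem relEntropy_anti (hπ : ∀ τ, 0 < π τ) (ha : Equivalence a)
    (h : ∀ τ τ', a τ τ' → b τ τ') : relEntropy π b ≤ relEntropy π a := by
  refine Finset.sum_le_sum fun τ _ => mul_le_mul_of_nonneg_left ?_ (hπ τ).le
  exact neg_le_neg (Real.log_le_log (relMass_pos hπ ha τ) (relMass_le_of_imp hπ h τ))

/-- Submodularity of the entropy of partitions: the common refinement of two partitions together
with any common coarsening has at most the total entropy of the two. -/
theorem relEntropy_submodular (hπ : ∀ τ, 0 < π τ) (hsum : ∑ τ, π τ = 1) (ha : Equivalence a)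
    (hb : Equivalence b) (hy : Equivalence y) (hay : ∀ τ τ', a τ τ' → y τ τ')
    (hby : ∀ τ τ', b τ τ' → y τ τ') :
    relEntropy π (fun τ τ' => a τ τ' ∧ b τ τ') + relEntropy π y ≤ relEntropy π a + relEntropy π b := by
  classical
  set c : T → T → Prop := fun τ τ' => a τ τ' ∧ b τ τ' with hc
  have hceq : Equivalence c := ⟨fun τ => ⟨ha.refl τ, hb.refl τ⟩,
    fun h => ⟨ha.symm h.1, hb.symm h.2⟩, fun h h' => ⟨ha.trans h.1 h'.1, hb.trans h.2 h'.2⟩⟩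
  have pa := relMass_pos hπ ha
  have pb := relMass_pos hπ hb
  have pc := relMass_pos hπ hceq
  have py := relMass_pos hπ hy
  -- the mean of `π_a π_b / (π_c π_y)` is at most `1`, and `log x ≤ x - 1`
  have hcore : ∑ τ, π τ * (relMass π a τ * relMass π b τ / (relMass π c τ * relMass π y τ)) ≤ 1 := by
    have h1 : ∀ τ, π τ * (relMass π a τ * relMass π b τ / (relMass π c τ * relMass π y τ))
        = ∑ α, ∑ β, π α * π β *
          (if a τ α ∧ b τ β then π τ / (relMass π c τ * relMass π y τ) else 0) := by
      intro τ
      have : relMass π a τ * relMass π b τ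
          = ∑ α, ∑ β, π α * π β * if a τ α ∧ b τ β then (1 : ℝ) else 0 := by
        unfold relMass
        rw [Finset.sum_filter, Finset.sum_filter, Finset.sum_mul_sum]
        refine Finset.sum_congr rfl fun α _ => Finset.sum_congr rfl fun β _ => ?_
        by_cases h1 : a τ α <;> by_cases h2 : b τ β <;> simp [h1, h2]
      rw [mul_div_assoc', mul_comm (π τ), mul_div_assoc, this, Finset.sum_mul]
      refine Finset.sum_congr rfl fun α _ => ?_
      rw [Finset.sum_mul]
      refine Finset.sum_congr rfl fun β _ => ?_
      split_ifs <;> ring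
    simp only [h1]
    rw [Finset.sum_comm]
    have h2 : ∀ α β, ∑ τ, (if a τ α ∧ b τ β then π τ / (relMass π c τ * relMass π y τ) else 0)
        ≤ if y α β then (relMass π y α)⁻¹ else 0 := by
      intro α β
      by_cases hex : ∃ τ0, a τ0 α ∧ b τ0 β
      · -- the `τ` with `a τ α` and `b τ β` form one class of `c`, inside the class of `α` for `y`
        obtain ⟨τ0, h0⟩ := hex
        rw [if_pos (hy.trans (hy.symm (hay _ _ h0.1)) (hby _ _ h0.2)), ← Finset.sum_filter]
        have h3 : ∀ τ ∈ Finset.univ.filter fun τ => a τ α ∧ b τ β,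
            π τ / (relMass π c τ * relMass π y τ) = π τ / (relMass π c τ0 * relMass π y α) := by
          intro τ hτ
          have hτ := (Finset.mem_filter.mp hτ).2
          rw [relMass_congr hceq (τ := τ) (τ' := τ0)
            ⟨ha.trans hτ.1 (ha.symm h0.1), hb.trans hτ.2 (hb.symm h0.2)⟩,
            relMass_congr hy (hay _ _ hτ.1)]
        rw [Finset.sum_congr rfl h3, ← Finset.sum_div]
        have h4 : ∑ τ with a τ α ∧ b τ β, π τ = relMass π c τ0 := by
          unfold relMass
          congr 1
          ext τ
          simp only [Finset.mem_filter, Finset.mem_univ, true_and, hc]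
          exact ⟨fun h => ⟨ha.trans h0.1 (ha.symm h.1), hb.trans h0.2 (hb.symm h.2)⟩,
            fun h => ⟨ha.trans (ha.symm h.1) h0.1, hb.trans (hb.symm h.2) h0.2⟩⟩
        rw [h4, div_mul_eq_div_div, div_self (pc τ0).ne', one_div]
      · push Not at hex
        rw [Finset.sum_eq_zero fun τ _ => if_neg fun h => hex τ h.1 h.2]
        split_ifs
        · exact (inv_pos.mpr (py α)).le
        · exact le_rfl
    calc ∑ α, ∑ τ, ∑ β, π α * π β *
          (if a τ α ∧ b τ β then π τ / (relMass π c τ * relMass π y τ) else 0)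
        = ∑ α, ∑ β, π α * π β * ∑ τ,
          (if a τ α ∧ b τ β then π τ / (relMass π c τ * relMass π y τ) else 0) := by
          refine Finset.sum_congr rfl fun α _ => ?_
          rw [Finset.sum_comm]
          simp only [Finset.mul_sum]
      _ ≤ ∑ α, ∑ β, π α * π β * (if y α β then (relMass π y α)⁻¹ else 0) :=
          Finset.sum_le_sum fun α _ => Finset.sum_le_sum fun β _ =>
            mul_le_mul_of_nonneg_left (h2 α β) (mul_pos (hπ α) (hπ β)).le
      _ = ∑ α, π α := by
          refine Finset.sum_congr rfl fun α _ => ?_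
          have : ∀ β, π α * π β * (if y α β then (relMass π y α)⁻¹ else 0)
              = π α * (relMass π y α)⁻¹ * if y α β then π β else 0 := by
            intro β; split_ifs <;> ring
          simp only [this]
          rw [← Finset.mul_sum, ← Finset.sum_filter]
          change π α * (relMass π y α)⁻¹ * relMass π y α = π α
          rw [mul_assoc, inv_mul_cancel₀ (py α).ne', mul_one]
      _ = 1 := hsum
  have hlog : ∀ τ, π τ * (Real.log (relMass π a τ) + Real.log (relMass π b τ)
      - Real.log (relMass π c τ) - Real.log (relMass π y τ))
      ≤ π τ * (relMass π a τ * relMass π b τ / (relMass π c τ * relMass π y τ)) - π τ := by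
    intro τ
    have h1 := Real.log_le_sub_one_of_pos
      (div_pos (mul_pos (pa τ) (pb τ)) (mul_pos (pc τ) (py τ)))
    rw [Real.log_div (mul_pos (pa τ) (pb τ)).ne' (mul_pos (pc τ) (py τ)).ne',
      Real.log_mul (pa τ).ne' (pb τ).ne', Real.log_mul (pc τ).ne' (py τ).ne'] at h1
    have := mul_le_mul_of_nonneg_left h1 (hπ τ).le
    linarith
  have h5 := Finset.sum_le_sum fun τ (_ : τ ∈ Finset.univ) => hlog τ
  rw [Finset.sum_sub_distrib, hsum] at h5
  have h6 : ∑ τ, π τ * (Real.log (relMass π a τ) + Real.log (relMass π b τ)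
      - Real.log (relMass π c τ) - Real.log (relMass π y τ))
      = relEntropy π c + relEntropy π y - relEntropy π a - relEntropy π b := by
    unfold relEntropy
    rw [← Finset.sum_add_distrib, ← Finset.sum_sub_distrib, ← Finset.sum_sub_distrib]
    exact Finset.sum_congr rfl fun τ _ => by ring
  linarith

end

/-! ### Entropy of tuples modulo a subspace -/

section
variable {K : Type*} [Field K] {m k : ℕ}

open Module

/-- A tuple in the simplex as a vector over `K`. -/
def Simplex.vec (K : Type*) [Field K] {m k : ℕ} (τ : Simplex m k) : Fin k → K :=
  fun i => ((τ.1 i : ℕ) : K)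

/-- Congruence of tuples in the simplex modulo a subspace of `K ^ k`. -/
def modRel (U : Submodule K (Fin k → K)) (τ τ' : Simplex m k) : Prop :=
  τ'.vec K - τ.vec K ∈ U

theorem modRel_equivalence (U : Submodule K (Fin k → K)) :
    Equivalence (modRel (m := m) U) where
  refl τ := by simp [modRel]
  symm {τ τ'} h := by
    unfold modRel at h ⊢
    rw [← neg_sub]; exact U.neg_mem h
  trans {x y z} h h' := by
    unfold modRel at h h' ⊢
    have := U.add_mem h' h
    rwa [sub_add_sub_cancel] at this

theorem sum_vec (τ : Simplex m k) : ∑ i, τ.vec K i + 1 = m := by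
  have := τ.2
  simp only [Simplex.vec]
  exact_mod_cast congrArg (Nat.cast : ℕ → K) this

theorem vec_injective (hinj : ∀ a b, a < m → b < m → (a : K) = b → a = b) {τ τ' : Simplex m k}
    {i : Fin k} (h : τ.vec K i = τ'.vec K i) : τ.1 i = τ'.1 i :=
  Fin.ext (hinj _ _ (τ.1 i).2 (τ'.1 i).2 h)

/-- The vectors with zero sum and with `j`-th coordinate zero: the possible differences of two tuples
in the simplex which agree at `j`. -/
def pinnedSubspace (K : Type*) [Field K] {k : ℕ} (j : Fin k) : Submodule K (Fin k → K) where
  carrier := {z | z j = 0 ∧ ∑ i, z i = 0}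
  zero_mem' := by simp
  add_mem' := by
    rintro z w ⟨h1, h2⟩ ⟨h3, h4⟩
    exact ⟨by simp [h1, h3], by simp [Finset.sum_add_distrib, h2, h4]⟩
  smul_mem' := by
    rintro c z ⟨h1, h2⟩
    exact ⟨by simp [h1], by simp [← Finset.mul_sum, h2]⟩

theorem mem_pinnedSubspace {j : Fin k} {z : Fin k → K} :
    z ∈ pinnedSubspace K j ↔ z j = 0 ∧ ∑ i, z i = 0 := Iff.rfl

theorem le_finrank_pinnedSubspace (j : Fin k) : k ≤ finrank K (pinnedSubspace K j) + 2 := by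
  set f : (Fin k → K) →ₗ[K] K × K :=
    (LinearMap.proj j).prod (∑ i, LinearMap.proj i) with hf
  have h1 := LinearMap.finrank_range_add_finrank_ker f
  have h2 := Submodule.finrank_le (LinearMap.range f)
  rw [finrank_fintype_fun_eq_card, Fintype.card_fin] at h1
  rw [finrank_prod, finrank_self] at h2
  have h3 : LinearMap.ker f = pinnedSubspace K j := by
    ext z
    simp [hf, mem_pinnedSubspace, LinearMap.mem_ker]
  rw [h3] at h1
  omega

/-- The subspace of zero-sum vectors vanishing at `j` is irreducible under the permutations of the
other coordinates: it is the standard representation of a symmetric group. -/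
theorem pinnedSubspace_le_of_invariant (hk : ((k - 1 : ℕ) : K) ≠ 0) {j : Fin k}
    {U : Submodule K (Fin k → K)} (hU : U ≤ pinnedSubspace K j) (hne : U ≠ ⊥)
    (hinv : ∀ a b : Fin k, a ≠ j → b ≠ j → ∀ z ∈ U, z ∘ Equiv.swap a b ∈ U) :
    pinnedSubspace K j ≤ U := by
  obtain ⟨z, hzU, hz0⟩ := (Submodule.ne_bot_iff _).mp hne
  obtain ⟨hzj, hzs⟩ := hU hzU
  obtain ⟨a, b, ha, hb, hab⟩ : ∃ a b, a ≠ j ∧ b ≠ j ∧ z a ≠ z b := by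
    by_contra! hcon
    obtain ⟨i, hi⟩ := Function.ne_iff.mp hz0
    have hij : i ≠ j := fun h => hi (by rw [h, hzj]; rfl)
    have h1 : ∑ l ∈ Finset.univ.erase j, z l = 0 := by
      rw [← hzs, ← Finset.add_sum_erase _ _ (Finset.mem_univ j), hzj, zero_add]
    rw [Finset.sum_congr rfl fun l hl => hcon l i (Finset.ne_of_mem_erase hl) hij,
      Finset.sum_const, Finset.card_erase_of_mem (Finset.mem_univ j), Finset.card_univ,
      Fintype.card_fin, nsmul_eq_mul] at h1
    exact hi ((mul_eq_zero.mp h1).resolve_left hk)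
  have hne' : a ≠ b := fun h => hab (by rw [h])
  have h1 : (Pi.single a 1 - Pi.single b 1 : Fin k → K) ∈ U := by
    have h2 := U.smul_mem (z b - z a)⁻¹ (U.sub_mem (hinv a b ha hb z hzU) hzU)
    convert! h2 using 1
    have h3 : z b - z a ≠ 0 := sub_ne_zero.mpr hab.symm
    funext l
    simp only [Pi.sub_apply, Pi.smul_apply, Function.comp_apply, smul_eq_mul]
    by_cases hla : l = a
    · subst hla
      rw [Equiv.swap_apply_left, Pi.single_eq_same, Pi.single_eq_of_ne hne', sub_zero,
        inv_mul_cancel₀ h3]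
    by_cases hlb : l = b
    · subst hlb
      rw [Equiv.swap_apply_right, Pi.single_eq_same, Pi.single_eq_of_ne hne'.symm, zero_sub,
        ← neg_sub (z l) (z a), mul_neg, inv_mul_cancel₀ h3]
    · rw [Equiv.swap_apply_of_ne_of_ne hla hlb, Pi.single_eq_of_ne hla, Pi.single_eq_of_ne hlb]
      simp
  have h2 : ∀ c, c ≠ j → (Pi.single c 1 - Pi.single b 1 : Fin k → K) ∈ U := by
    intro c hc
    by_cases hcb : c = b
    · subst hcb; simp
    have h3 := hinv a c ha hc _ h1
    convert! h3 using 1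
    funext l
    simp only [Pi.sub_apply, Function.comp_apply, Pi.single_apply]
    have e1 : Equiv.swap a c l = a ↔ l = c := by
      rw [Equiv.swap_apply_eq_iff, Equiv.swap_apply_left]
    have e2 : Equiv.swap a c l = b ↔ l = b := by
      rw [Equiv.swap_apply_eq_iff, Equiv.swap_apply_of_ne_of_ne hne'.symm (Ne.symm hcb)]
    simp only [e1, e2]
  intro w hw
  have e : w = ∑ c, w c • (Pi.single c 1 - Pi.single b 1 : Fin k → K) := by
    simp only [smul_sub, Finset.sum_sub_distrib]
    rw [← Finset.sum_smul, hw.2, zero_smul, sub_zero]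
    funext l
    simp [Finset.sum_apply, Pi.single_apply]
  rw [e]
  refine U.sum_mem fun c _ => ?_
  by_cases hc : c = j
  · rw [hc, hw.1, zero_smul]; exact U.zero_mem
  · exact U.smul_mem _ (h2 c hc)

theorem relEntropy_modRel_submodular {π : Simplex m k → ℝ} (hπ : ∀ τ, 0 < π τ)
    (hsum : ∑ τ, π τ = 1) (U V : Submodule K (Fin k → K)) :
    relEntropy π (modRel (U ⊓ V)) + relEntropy π (modRel (U ⊔ V))
      ≤ relEntropy π (modRel U) + relEntropy π (modRel V) := by
  have h := relEntropy_submodular hπ hsum (modRel_equivalence U) (modRel_equivalence V)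
    (modRel_equivalence (U ⊔ V)) (fun _ _ h => (le_sup_left : U ≤ U ⊔ V) h)
    (fun _ _ h => (le_sup_right : V ≤ U ⊔ V) h)
  exact h

/-- Permuting the coordinates of `U` does not change the entropy of a symmetric distribution
modulo `U`. -/
theorem relEntropy_modRel_map {π : Simplex m k → ℝ} (hsym : ∀ σ τ, π (Simplex.perm σ τ) = π τ)
    (σ : Equiv.Perm (Fin k)) (U : Submodule K (Fin k → K)) :
    relEntropy π (modRel (U.map (LinearEquiv.funCongrLeft K K σ).toLinearMap))
      = relEntropy π (modRel U) := by
  classical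
  unfold relEntropy
  rw [← Equiv.sum_comp (Simplex.perm σ)]
  refine Finset.sum_congr rfl fun τ _ => ?_
  rw [hsym]
  congr 3
  unfold relMass
  rw [Finset.sum_filter, Finset.sum_filter, ← Equiv.sum_comp (Simplex.perm σ)]
  refine Finset.sum_congr rfl fun τ' _ => ?_
  rw [hsym]
  have : modRel (U.map (LinearEquiv.funCongrLeft K K σ).toLinearMap) (Simplex.perm σ τ)
      (Simplex.perm σ τ') ↔ modRel U τ τ' := by
    unfold modRel
    have e : (Simplex.perm σ τ').vec K - (Simplex.perm σ τ).vec K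
        = LinearEquiv.funCongrLeft K K σ (τ'.vec K - τ.vec K) := rfl
    rw [e]
    refine ⟨?_, fun h => Submodule.mem_map_of_mem h⟩
    rintro ⟨w, hw, h⟩
    rwa [← LinearEquiv.injective _ h]
  simp only [this]

/-- Among the subspaces `U` of vectors vanishing at `j`, the entropy lost modulo `U` relative to the
dimension of `U` is largest for the full subspace. By submodularity there is a largest subspace
of maximal slope; by symmetry it is invariant under permutations of the coordinates other than `j`,
hence trivial or full. -/
theorem entropy_slope_le [Finite K] (hk : ((k - 1 : ℕ) : K) ≠ 0) {π : Simplex m k → ℝ}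
    (hπ : ∀ τ, 0 < π τ) (hsum : ∑ τ, π τ = 1) (hsym : ∀ σ τ, π (Simplex.perm σ τ) = π τ)
    {j : Fin k} {U : Submodule K (Fin k → K)} (hU : U ≤ pinnedSubspace K j) :
    finrank K (pinnedSubspace K j) *
        (relEntropy π (modRel (⊥ : Submodule K (Fin k → K))) - relEntropy π (modRel U))
      ≤ finrank K U * (relEntropy π (modRel (⊥ : Submodule K (Fin k → K)))
        - relEntropy π (modRel (pinnedSubspace K j))) := by
  classical
  set W := pinnedSubspace K j with hW
  set E : Submodule K (Fin k → K) → ℝ := fun U => relEntropy π (modRel U) with hE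
  set g : Submodule K (Fin k → K) → ℝ := fun U =>
    finrank K W * (E ⊥ - E U) - finrank K U * (E ⊥ - E W) with hg
  have hfin : Finite (Submodule K (Fin k → K)) :=
    Finite.of_injective (fun U => (U : Set (Fin k → K))) SetLike.coe_injective
  have hsuper : ∀ A B, g A + g B ≤ g (A ⊓ B) + g (A ⊔ B) := by
    intro A B
    have h1 := relEntropy_modRel_submodular hπ hsum A B
    have h2 := Submodule.finrank_sup_add_finrank_inf_eq A B
    have h3 : (finrank K (A ⊔ B : Submodule K (Fin k → K)) : ℝ)
        + finrank K (A ⊓ B : Submodule K (Fin k → K)) = finrank K A + finrank K B := by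
      exact_mod_cast h2
    have h4 : 0 ≤ (finrank K W : ℝ) * (E A + E B - E (A ⊓ B) - E (A ⊔ B)) :=
      mul_nonneg (Nat.cast_nonneg _) (by simp only [hE]; linarith)
    have h5 : g (A ⊓ B) + g (A ⊔ B) - g A - g B
        = finrank K W * (E A + E B - E (A ⊓ B) - E (A ⊔ B))
        - ((finrank K (A ⊔ B : Submodule K (Fin k → K)) : ℝ)
          + finrank K (A ⊓ B : Submodule K (Fin k → K)) - (finrank K A + finrank K B))
          * (E ⊥ - E W) := by
      simp only [hg]; ring
    rw [h3, sub_self, zero_mul, sub_zero] at h5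
    linarith
  suffices h : g U ≤ 0 by simp only [hg] at h; linarith
  have : Fintype (Submodule K (Fin k → K)) := Fintype.ofFinite _
  -- `g` is supermodular; take a maximum of `g` of largest dimension
  obtain ⟨M, hM, hmax⟩ := Finset.exists_max_image (Finset.univ.filter fun A => A ≤ W)
    (fun A => toLex (g A, finrank K A)) ⟨⊥, by simp⟩
  have hMW : M ≤ W := (Finset.mem_filter.mp hM).2
  have hmax' : ∀ A ≤ W, g A < g M ∨ g A = g M ∧ finrank K A ≤ finrank K M := fun A hA => by
    simpa using Prod.Lex.le_iff.mp (hmax A (by simpa using hA))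
  have hgM : ∀ A ≤ W, g A ≤ g M := fun A hA => by
    rcases hmax' A hA with h | h
    · exact h.le
    · exact h.1.le
  refine (hgM U hU).trans ?_
  have hinv : ∀ a b : Fin k, a ≠ j → b ≠ j → ∀ z ∈ M, z ∘ Equiv.swap a b ∈ M := by
    intro a b ha hb z hz
    set e := LinearEquiv.funCongrLeft K K (Equiv.swap a b) with he
    have hgmap : g (M.map e.toLinearMap) = g M := by
      have h1 : E (M.map e.toLinearMap) = E M := relEntropy_modRel_map hsym _ M
      have h2 : finrank K (M.map e.toLinearMap) = finrank K M := LinearEquiv.finrank_map_eq e M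
      simp only [hg, h1, h2]
    have hmapW : M.map e.toLinearMap ≤ W := by
      rintro _ ⟨w, hw, rfl⟩
      obtain ⟨h1, h2⟩ := hMW hw
      refine ⟨?_, ?_⟩
      · change w (Equiv.swap a b j) = 0
        rw [Equiv.swap_apply_of_ne_of_ne ha.symm hb.symm, h1]
      · change ∑ i, w (Equiv.swap a b i) = 0
        rw [Equiv.sum_comp (Equiv.swap a b) w, h2]
    have h1 := hsuper M (M.map e.toLinearMap)
    have h2 := hgM (M ⊓ M.map e.toLinearMap) (inf_le_left.trans hMW)
    have h3 := hmax' (M ⊔ M.map e.toLinearMap) (sup_le hMW hmapW)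
    have h4 : finrank K (M ⊔ M.map e.toLinearMap : Submodule K (Fin k → K)) ≤ finrank K M := by
      rcases h3 with h | h
      · linarith
      · exact h.2
    have h5 := Submodule.eq_of_le_of_finrank_le (le_sup_left : M ≤ M ⊔ M.map e.toLinearMap) h4
    rw [h5]
    exact le_sup_right (a := M) (Submodule.mem_map_of_mem hz)
  by_cases hbot : M = ⊥
  · rw [hbot]; simp [hg]
  · have : M = W := le_antisymm hMW (pinnedSubspace_le_of_invariant hk hMW hbot hinv)
    rw [this]; simp [hg]

theorem modRel_bot_iff (hinj : ∀ a b, a < m → b < m → (a : K) = b → a = b) {τ τ' : Simplex m k} :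
    modRel (⊥ : Submodule K (Fin k → K)) τ τ' ↔ τ' = τ := by
  unfold modRel
  rw [Submodule.mem_bot, sub_eq_zero]
  exact ⟨fun h => Subtype.ext (funext fun i => vec_injective hinj (congrFun h i)), fun h => h ▸ rfl⟩

theorem modRel_pinnedSubspace_iff (hinj : ∀ a b, a < m → b < m → (a : K) = b → a = b) {j : Fin k}
    {τ τ' : Simplex m k} : modRel (pinnedSubspace K j) τ τ' ↔ τ'.1 j = τ.1 j := by
  unfold modRel
  rw [mem_pinnedSubspace]
  constructor
  · exact fun h => vec_injective hinj (sub_eq_zero.mp h.1)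
  · intro h
    refine ⟨by simp [Simplex.vec, h], ?_⟩
    have h1 := sum_vec (K := K) τ
    have h2 := sum_vec (K := K) τ'
    simp only [Pi.sub_apply, Finset.sum_sub_distrib]
    rw [sub_eq_zero]
    exact add_right_cancel (h2.trans h1.symm)

end

/-! ### Concentration of sums of independent variables -/

section
variable {T : Type*} [Fintype T]

/-- The second moment of a sum of `n` independent centred variables plus a constant. -/
theorem sum_prod_mul_sq {π Z : T → ℝ} (hsum : ∑ τ, π τ = 1) (hZ : ∑ τ, π τ * Z τ = 0) (n : ℕ) :
    ∀ c : ℝ, ∑ e : Fin n → T, (∏ t, π (e t)) * (c + ∑ t, Z (e t)) ^ 2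
      = c ^ 2 + n * ∑ τ, π τ * Z τ ^ 2 := by
  induction n with
  | zero => intro c; simp
  | succ n ih =>
    intro c
    rw [← (Fin.consEquiv fun _ => T).sum_comp, Fintype.sum_prod_type]
    have h : ∀ τ : T, ∑ e : Fin n → T, (∏ t, π ((Fin.consEquiv fun _ => T) (τ, e) t)) *
        (c + ∑ t, Z ((Fin.consEquiv fun _ => T) (τ, e) t)) ^ 2
        = π τ * c ^ 2 + 2 * c * (π τ * Z τ) + π τ * Z τ ^ 2
          + π τ * (n * ∑ τ, π τ * Z τ ^ 2) := by
      intro τ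
      have h1 := ih (c + Z τ)
      simp only [Fin.consEquiv_apply, Fin.prod_univ_succ, Fin.sum_univ_succ, Fin.cons_zero,
        Fin.cons_succ, mul_assoc, ← Finset.mul_sum, ← add_assoc]
      rw [h1]
      ring
    simp only [h, Finset.sum_add_distrib, ← Finset.sum_mul, ← Finset.mul_sum, hsum, hZ]
    push_cast
    ring

theorem sum_prod_eq_one {π : T → ℝ} (hsum : ∑ τ, π τ = 1) (n : ℕ) :
    ∑ e : Fin n → T, ∏ t, π (e t) = 1 := by
  have := Finset.prod_univ_sum (fun _ : Fin n => (Finset.univ : Finset T)) fun _ τ => π τ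
  rw [Fintype.piFinset_univ] at this
  rw [← this]
  simp [hsum]

/-- Chebyshev's inequality for finitely many functions at once: with probability at least `1 / 2`
all their sums over `n` independent samples are within `O(√n)` of their means. -/
theorem exists_typical {ι : Type*} [Fintype ι] {π : T → ℝ} (hπ : ∀ τ, 0 < π τ)
    (hsum : ∑ τ, π τ = 1) (Y : ι → T → ℝ) :
    ∃ C : ℝ, 0 ≤ C ∧ ∀ n : ℕ, ∃ E : Finset (Fin n → T), 1 / 2 ≤ ∑ e ∈ E, ∏ t, π (e t) ∧
      ∀ e ∈ E, ∀ r, |∑ t, Y r (e t) - n * ∑ τ, π τ * Y r τ| ≤ C * √n := by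
  classical
  set Z : ι → T → ℝ := fun r τ => Y r τ - ∑ τ, π τ * Y r τ with hZ
  set v : ι → ℝ := fun r => ∑ τ, π τ * Z r τ ^ 2 with hv
  have hv0 : ∀ r, 0 ≤ v r := fun r =>
    Finset.sum_nonneg fun τ _ => mul_nonneg (hπ τ).le (sq_nonneg _)
  have hV : 0 ≤ ∑ r, v r := Finset.sum_nonneg fun r _ => hv0 r
  refine ⟨√(2 * ∑ r, v r + 1), Real.sqrt_nonneg _, fun n => ?_⟩
  set D : ℝ := 2 * ∑ r, v r + 1 with hD
  have hZ0 : ∀ r, ∑ τ, π τ * Z r τ = 0 := by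
    intro r
    simp only [hZ, mul_sub, Finset.sum_sub_distrib, ← Finset.sum_mul, hsum, one_mul, sub_self]
  have hP : ∀ e : Fin n → T, 0 ≤ ∏ t, π (e t) := fun e => Finset.prod_nonneg fun t _ => (hπ _).le
  set good : (Fin n → T) → Prop := fun e => ∀ r, (∑ t, Z r (e t)) ^ 2 ≤ D * n with hgood
  refine ⟨Finset.univ.filter good, ?_, fun e he r => ?_⟩
  · have hbad : ∑ e with ¬ good e, ∏ t, π (e t) ≤ 1 / 2 := by
      rcases Nat.eq_zero_or_pos n with h0 | hn
      · subst h0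
        rw [Finset.sum_eq_zero]
        · norm_num
        · intro e he
          exact absurd (fun r => by simp) (Finset.mem_filter.mp he).2
      have hn' : (0 : ℝ) < n := by exact_mod_cast hn
      have hDn : 0 < D * n := by positivity
      have h1 : ∀ e ∈ Finset.univ.filter (fun e => ¬ good e),
          ∏ t, π (e t) ≤ ∑ r, (∏ t, π (e t)) * (0 + ∑ t, Z r (e t)) ^ 2 / (D * n) := by
        intro e he
        have h2 := (Finset.mem_filter.mp he).2
        simp only [hgood] at h2
        push Not at h2
        obtain ⟨r, hr⟩ := h2
        refine le_trans ?_ (Finset.single_le_sum (f := fun r =>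
          (∏ t, π (e t)) * (0 + ∑ t, Z r (e t)) ^ 2 / (D * n)) (fun r _ =>
            div_nonneg (mul_nonneg (hP e) (sq_nonneg _)) hDn.le) (Finset.mem_univ r))
        rw [le_div_iff₀ hDn, zero_add]
        exact mul_le_mul_of_nonneg_left hr.le (hP e)
      refine (Finset.sum_le_sum h1).trans ((Finset.sum_le_univ_sum_of_nonneg fun e =>
        Finset.sum_nonneg fun r _ =>
          div_nonneg (mul_nonneg (hP e) (sq_nonneg _)) hDn.le).trans ?_)
      rw [Finset.sum_comm]
      simp only [← Finset.sum_div]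
      simp only [sum_prod_mul_sq hsum (hZ0 _)]
      rw [div_le_iff₀ hDn, hD]
      simp only [ne_eq, OfNat.ofNat_ne_zero, not_false_eq_true, zero_pow, zero_add,
        ← Finset.mul_sum]
      change (n : ℝ) * ∑ r, v r ≤ _
      nlinarith
    have h := sum_prod_eq_one hsum n
    rw [← Finset.sum_filter_add_sum_filter_not Finset.univ good] at h
    linarith
  · have h1 := (Finset.mem_filter.mp he).2 r
    have h2 : ∑ t, Z r (e t) = ∑ t, Y r (e t) - n * ∑ τ, π τ * Y r τ := by
      simp [hZ, Finset.sum_sub_distrib]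
    rw [← h2, ← Real.sqrt_mul (by positivity)]
    exact Real.abs_le_sqrt h1

end

/-! ### Sequences of tuples with given marginals -/

section
variable {m k n : ℕ}

/-- The number of positions at which the `i`-th entry of a sequence of tuples equals `a`. -/
def marginalCount (e : Fin n → Simplex m k) (i : Fin k) (a : Fin m) : ℕ :=
  (Finset.univ.filter fun t => (e t).1 i = a).card

theorem sum_apply_eq_sum_marginalCount (e : Fin n → Simplex m k) (i : Fin k) {M : Type*}
    [AddCommMonoid M] (f : Fin m → M) :
    ∑ t, f ((e t).1 i) = ∑ a, marginalCount e i a • f a := by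
  rw [← Finset.sum_fiberwise Finset.univ (fun t => (e t).1 i)]
  refine Finset.sum_congr rfl fun a _ => ?_
  rw [Finset.sum_congr rfl fun t ht => by rw [(Finset.mem_filter.mp ht).2], Finset.sum_const]
  rfl

/-- The mass of a sequence under a product weight depends only on its marginals. -/
theorem prod_eq_of_marginalCount_eq {π : Simplex m k → ℝ} {θ : Fin m → ℝ}
    (hθ : ∀ τ, π τ = Real.exp (∑ i, θ (τ.1 i))) {e e' : Fin n → Simplex m k}
    (h : marginalCount e = marginalCount e') : ∏ t, π (e t) = ∏ t, π (e' t) := by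
  simp only [hθ, ← Real.exp_sum]
  congr 1
  rw [Finset.sum_comm, Finset.sum_comm (s := Finset.univ) (t := Finset.univ)
    (f := fun t i => θ ((e' t).1 i))]
  simp only [sum_apply_eq_sum_marginalCount, h]

/-- Among the sequences of a set, one choice of marginals carries a polynomial fraction of the
mass. -/
theorem exists_marginalCount_mass {π : Simplex m k → ℝ} (E : Finset (Fin n → Simplex m k))
    (hE : 1 / 2 ≤ ∑ e ∈ E, ∏ t, π (e t)) :
    ∃ c : Fin k → Fin m → ℕ, 1 / (2 * ((n : ℝ) + 1) ^ (k * m))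
      ≤ ∑ e ∈ E with marginalCount e = c, ∏ t, π (e t) := by
  classical
  set f : (Fin n → Simplex m k) → (Fin k → Fin m → Fin (n + 1)) := fun e i a =>
    ⟨marginalCount e i a, Nat.lt_succ_of_le ((Finset.card_filter_le _ _).trans (by simp))⟩ with hf
  have h1 : ∑ c : Fin k → Fin m → Fin (n + 1), ∑ e ∈ E with f e = c, ∏ t, π (e t)
      = ∑ e ∈ E, ∏ t, π (e t) := Finset.sum_fiberwise E f _
  have hpos : (0 : ℝ) < 2 * ((n : ℝ) + 1) ^ (k * m) := by positivity
  obtain ⟨c, -, hc⟩ := Finset.exists_le_of_sum_le (s := Finset.univ)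
    (f := fun _ : Fin k → Fin m → Fin (n + 1) => 1 / (2 * ((n : ℝ) + 1) ^ (k * m)))
    (g := fun c => ∑ e ∈ E with f e = c, ∏ t, π (e t)) Finset.univ_nonempty (by
      rw [h1, Finset.sum_const, Finset.card_univ]
      refine le_trans (le_of_eq ?_) hE
      simp only [Fintype.card_pi, Fintype.card_fin, Finset.prod_const, Finset.card_univ,
        nsmul_eq_mul, Nat.cast_pow, Nat.cast_add, Nat.cast_one]
      rw [← pow_mul, mul_comm m k]
      field_simp)
  refine ⟨fun i a => c i a, hc.trans (le_of_eq ?_)⟩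
  congr 1
  ext e
  simp only [Finset.mem_filter]
  refine and_congr_right fun _ => ?_
  constructor
  · rintro rfl; rfl
  · intro h
    funext i a
    exact Fin.ext (congrFun (congrFun h i) a)

open Classical in
/-- Count of the sequences with the same mass as `e` which are termwise related to `e`. -/
theorem card_mul_prod_le_prod_relMass {T : Type*} [Fintype T] {π : T → ℝ} (hπ : ∀ τ, 0 < π τ)
    (r : T → T → Prop) (e : Fin n → T) (E : Finset (Fin n → T))
    (hE : ∀ e' ∈ E, ∏ t, π (e' t) = ∏ t, π (e t)) (hr : ∀ e' ∈ E, ∀ t, r (e t) (e' t)) :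
    (E.card : ℝ) * ∏ t, π (e t) ≤ ∏ t, relMass π r (e t) := by
  unfold relMass
  rw [Finset.prod_univ_sum, ← nsmul_eq_mul, ← Finset.sum_const,
    ← Finset.sum_congr rfl hE]
  refine Finset.sum_le_sum_of_subset_of_nonneg (fun e' he' => ?_) fun _ _ _ =>
    Finset.prod_nonneg fun t _ => (hπ _).le
  simpa [Fintype.mem_piFinset] using hr e' he'

theorem relMass_eq_self {T : Type*} [Fintype T] {π : T → ℝ} {r : T → T → Prop}
    (hr : ∀ τ τ', r τ τ' ↔ τ' = τ) (τ : T) : relMass π r τ = π τ := by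
  classical
  unfold relMass
  rw [Finset.sum_filter]
  simp [hr]

/-- Typical sequences with common marginals: there are nearly `exp (n H)` of them, `H` the entropy
of `π`, and for every equivalence relation `r` each has at most about `exp (n (H - H_r))`
sequences with the same marginals termwise related to it. -/
theorem exists_typical_class {π : Simplex m k → ℝ} {θ : Fin m → ℝ}
    (hθ : ∀ τ, π τ = Real.exp (∑ i, θ (τ.1 i))) (hsum : ∑ τ, π τ = 1) :
    ∃ C : ℝ, 0 ≤ C ∧ ∀ n : ℕ, ∃ (c : Fin k → Fin m → ℕ) (E : Finset (Fin n → Simplex m k)),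
      (∀ e ∈ E, marginalCount e = c) ∧
      Real.exp (n * relEntropy π Eq - C * √n) / (2 * ((n : ℝ) + 1) ^ (k * m)) ≤ E.card ∧
      ∀ r : Simplex m k → Simplex m k → Prop, Equivalence r → ∀ e ∈ E,
        ∀ D : Finset (Fin n → Simplex m k),
        (∀ e' ∈ D, marginalCount e' = c ∧ ∀ t, r (e t) (e' t)) →
        (D.card : ℝ) ≤ Real.exp (n * (relEntropy π Eq - relEntropy π r) + 2 * C * √n) := by
  classical
  have hπ : ∀ τ, 0 < π τ := fun τ => by rw [hθ]; exact Real.exp_pos _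
  -- one constant for all relations: later the relations depend on a prime growing with `n`
  obtain ⟨C, hC, H⟩ := exists_typical hπ hsum
    fun (r : Simplex m k → Simplex m k → Prop) τ => -Real.log (relMass π r τ)
  refine ⟨C, hC, fun n => ?_⟩
  obtain ⟨E₁, hE₁, htyp⟩ := H n
  obtain ⟨c, hc⟩ := exists_marginalCount_mass E₁ hE₁
  have hexp : ∀ r : Simplex m k → Simplex m k → Prop, Equivalence r → ∀ e : Fin n → Simplex m k,
      ∏ t, relMass π r (e t) = Real.exp (-∑ t, -Real.log (relMass π r (e t))) := by
    intro r hr e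
    rw [Finset.sum_neg_distrib, neg_neg, Real.exp_sum]
    exact Finset.prod_congr rfl fun t _ => (Real.exp_log (relMass_pos hπ hr _)).symm
  have heq : ∀ e : Fin n → Simplex m k, ∏ t, π (e t) = ∏ t, relMass π Eq (e t) := fun e =>
    Finset.prod_congr rfl fun t _ => (relMass_eq_self (fun _ _ => eq_comm) _).symm
  have hpos : ∀ e : Fin n → Simplex m k, 0 < ∏ t, π (e t) := fun e =>
    Finset.prod_pos fun t _ => hπ _
  have htyp' : ∀ e ∈ E₁, ∀ r : Simplex m k → Simplex m k → Prop,
      |∑ t, -Real.log (relMass π r (e t)) - n * relEntropy π r| ≤ C * √n := htyp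
  refine ⟨c, E₁.filter fun e => marginalCount e = c, fun e he => (Finset.mem_filter.mp he).2, ?_, ?_⟩
  · have h1 : ∀ e ∈ E₁.filter (fun e => marginalCount e = c),
        ∏ t, π (e t) ≤ Real.exp (-(n * relEntropy π Eq - C * √n)) := by
      intro e he
      rw [heq, hexp _ eq_equivalence]
      have := (abs_le.mp (htyp' e (Finset.mem_filter.mp he).1 Eq)).1
      exact Real.exp_le_exp.mpr (by linarith)
    have h2 := hc.trans (Finset.sum_le_card_nsmul _ _ _ h1)
    rw [nsmul_eq_mul, Real.exp_neg, ← div_eq_mul_inv, le_div_iff₀ (Real.exp_pos _)] at h2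
    rw [div_eq_mul_one_div, mul_comm]
    exact h2
  · intro r hr e he D hD
    obtain ⟨he₁, hec⟩ := Finset.mem_filter.mp he
    have h1 := card_mul_prod_le_prod_relMass hπ r e D
      (fun e' he' => prod_eq_of_marginalCount_eq hθ ((hD e' he').1.trans hec.symm))
      fun e' he' => (hD e' he').2
    have h2 := (abs_le.mp (htyp' e he₁ r)).1
    have h3 := (abs_le.mp (htyp' e he₁ Eq)).2
    rw [← le_div_iff₀ (hpos e), heq, hexp r hr, hexp Eq eq_equivalence, ← Real.exp_sub] at h1
    exact h1.trans (Real.exp_le_exp.mpr (by linarith))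

end

/-! ### Sets in which no element is the mean of others -/

/-- No element of `A` is the mean of a non-constant family of elements of `A` indexed by `J`. -/
def MeanFree (J : Type*) [Fintype J] {G : Type*} [AddCommGroup G] (A : Finset G) : Prop :=
  ∀ (a : J → G) (b : G), (∀ j, a j ∈ A) → b ∈ A → ∑ j, a j = Fintype.card J • b → ∀ j, a j = b

/-- Behrend's construction: points of a sphere with coordinates so small that their sums do not
wrap around modulo `p`. -/
theorem exists_meanFree (J : Type*) [Fintype J] [Nonempty J] {p d : ℕ} [NeZero p]
    (hd : Fintype.card J * (d - 1) < p) (hd1 : 1 ≤ d) (ν : ℕ) :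
    ∃ A : Finset (Fin ν → ZMod p), (d : ℝ) ^ ν / (ν * d ^ 2 + 1) ≤ A.card ∧ MeanFree J A := by
  classical
  have hJ : 1 ≤ Fintype.card J := Fintype.card_pos
  have hdp : d - 1 < p := lt_of_le_of_lt (Nat.le_mul_of_pos_left _ hJ) hd
  set sq : (Fin ν → Fin d) → ℕ := fun x => ∑ l, (x l : ℕ) ^ 2 with hsq
  have hmaps : ∀ x ∈ (Finset.univ : Finset (Fin ν → Fin d)), sq x ∈ Finset.range (ν * d ^ 2 + 1) := by
    intro x _
    rw [Finset.mem_range, Nat.lt_succ_iff]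
    calc ∑ l, (x l : ℕ) ^ 2 ≤ ∑ _l : Fin ν, d ^ 2 :=
          Finset.sum_le_sum fun l _ => Nat.pow_le_pow_left (x l).2.le 2
      _ = ν * d ^ 2 := by simp
  obtain ⟨R, -, hR⟩ := Finset.exists_le_of_sum_le (s := Finset.range (ν * d ^ 2 + 1))
    (f := fun _ => (d : ℝ) ^ ν / (ν * d ^ 2 + 1))
    (g := fun R => ((Finset.univ.filter fun x => sq x = R).card : ℝ)) ⟨0, by simp⟩ (by
      rw [Finset.sum_const, Finset.card_range, nsmul_eq_mul, ← Nat.cast_sum,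
        ← Finset.card_eq_sum_card_fiberwise hmaps]
      simp only [Finset.card_univ, Fintype.card_pi, Fintype.card_fin, Finset.prod_const]
      push_cast
      rw [mul_div_cancel₀ _ (by positivity)])
  set cst : (Fin ν → Fin d) → (Fin ν → ZMod p) := fun x l => ((x l : ℕ) : ZMod p) with hcst
  have hinj : Function.Injective cst := by
    intro x y h
    funext l
    have h1 := (ZMod.natCast_eq_natCast_iff' _ _ _).mp (congrFun h l)
    have hx := (x l).2
    have hy := (y l).2
    rw [Nat.mod_eq_of_lt (by omega), Nat.mod_eq_of_lt (by omega)] at h1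
    exact Fin.ext h1
  refine ⟨(Finset.univ.filter fun x => sq x = R).image cst, ?_, ?_⟩
  · rwa [Finset.card_image_of_injective _ hinj]
  intro a b ha hb hab
  simp only [Finset.mem_image, Finset.mem_filter, Finset.mem_univ, true_and] at ha hb
  choose α hα hα' using ha
  obtain ⟨β, hβ, rfl⟩ := hb
  have hle : ∀ x : Fin d, (x : ℕ) ≤ d - 1 := fun x => by have := x.2; omega
  have h1 : ∀ l, ∑ j, (α j l : ℕ) = Fintype.card J * β l := by
    intro l
    have h2 := congrFun hab l
    rw [Finset.sum_apply] at h2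
    simp only [← hα'] at h2
    simp only [hcst, Pi.smul_apply, nsmul_eq_mul] at h2
    rw [← Nat.cast_sum, ← Nat.cast_mul, ZMod.natCast_eq_natCast_iff'] at h2
    have h3 : ∑ j, (α j l : ℕ) ≤ Fintype.card J * (d - 1) := by
      calc ∑ j, (α j l : ℕ) ≤ ∑ _j : J, (d - 1) := Finset.sum_le_sum fun j _ => hle _
        _ = _ := by simp
    rwa [Nat.mod_eq_of_lt (by omega),
      Nat.mod_eq_of_lt (lt_of_le_of_lt (Nat.mul_le_mul_left _ (hle _)) hd)] at h2
  -- the points lie on a sphere around the origin and have mean `β`, so their variance is zero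
  have h4 : ∑ j, ∑ l, ((α j l : ℤ) - β l) ^ 2 = 0 := by
    have h5 : ∀ j, ∑ l, ((α j l : ℤ) - β l) ^ 2 = 2 * R - 2 * ∑ l, (α j l : ℤ) * β l := by
      intro j
      have h6 : (∑ l, (α j l : ℤ) ^ 2) = R := by exact_mod_cast hα j
      have h7 : (∑ l, (β l : ℤ) ^ 2) = R := by exact_mod_cast hβ
      simp only [sub_sq, Finset.sum_add_distrib, Finset.sum_sub_distrib, h6, h7, mul_assoc,
        ← Finset.mul_sum]
      ring
    simp only [h5, Finset.sum_sub_distrib, ← Finset.mul_sum]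
    rw [Finset.sum_comm]
    simp only [← Finset.sum_mul]
    have h8 : ∀ l, (∑ j, (α j l : ℤ)) = Fintype.card J * β l := fun l => by exact_mod_cast h1 l
    have h7 : (∑ l, (β l : ℤ) * β l) = R := by
      simp only [← pow_two]; exact_mod_cast hβ
    simp only [h8, mul_assoc, ← Finset.mul_sum, h7, Finset.sum_const, Finset.card_univ,
      nsmul_eq_mul]
    ring
  intro j
  rw [← hα']
  congr 1
  funext l
  have h5 := (Finset.sum_eq_zero_iff_of_nonneg fun j _ =>
    Finset.sum_nonneg fun l _ => sq_nonneg _).mp h4 j (Finset.mem_univ j)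
  have h6 := (Finset.sum_eq_zero_iff_of_nonneg fun l _ => sq_nonneg _).mp h5 l (Finset.mem_univ l)
  have h7 := sub_eq_zero.mp (pow_eq_zero_iff (two_ne_zero)|>.mp h6)
  exact Fin.ext (by exact_mod_cast h7)

/-! ### Linear hashing -/

section
variable {K : Type*} [Field K] {m k n ν : ℕ}

open Module Matrix

theorem card_ker_linearCombination [Fintype K] [DecidableEq K] (z : Fin n → Fin k → K) :
    (Finset.univ.filter fun v : Fin n → K => ∑ t, v t • z t = 0).card
      * Fintype.card K ^ finrank K (Submodule.span K (Set.range z)) = Fintype.card K ^ n := by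
  set f := Fintype.linearCombination K z with hf
  have h1 := LinearMap.finrank_range_add_finrank_ker f
  rw [finrank_fintype_fun_eq_card, Fintype.card_fin, hf, Fintype.range_linearCombination,
    ← hf] at h1
  have h2 : (Finset.univ.filter fun v : Fin n → K => ∑ t, v t • z t = 0).card
      = Nat.card (LinearMap.ker f) := by
    rw [← Fintype.card_subtype, ← Nat.card_eq_fintype_card]
    exact Nat.card_congr (Equiv.subtypeEquivRight fun v => by
      rw [LinearMap.mem_ker, hf, Fintype.linearCombination_apply])
  rw [h2, Module.natCard_eq_pow_finrank (K := K), Nat.card_eq_fintype_card, ← pow_add, add_comm,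
    h1]

/-- The matrices whose rows all kill given vectors. -/
theorem card_matrix_kill [Fintype K] [DecidableEq K] (z : Fin n → Fin k → K) :
    (Finset.univ.filter fun u : Matrix (Fin ν) (Fin n) K => ∀ l, ∑ t, u l t • z t = 0).card
      * (Fintype.card K ^ ν) ^ finrank K (Submodule.span K (Set.range z))
      = Fintype.card (Matrix (Fin ν) (Fin n) K) := by
  classical
  have h1 : (Finset.univ.filter fun u : Matrix (Fin ν) (Fin n) K => ∀ l, ∑ t, u l t • z t = 0).card
      = (Finset.univ.filter fun v : Fin n → K => ∑ t, v t • z t = 0).card ^ ν := by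
    have := Fintype.card_piFinset_const
      (Finset.univ.filter fun v : Fin n → K => ∑ t, v t • z t = 0) ν
    rw [← this]
    congr 1
    ext u
    rw [Finset.mem_filter, and_iff_right (Finset.mem_univ u)]
    refine Iff.trans ?_ (Fintype.mem_piFinset (f := u)).symm
    simp
  have h2 : Fintype.card (Matrix (Fin ν) (Fin n) K) = (Fintype.card K ^ n) ^ ν := by
    have : Fintype.card (Matrix (Fin ν) (Fin n) K) = Fintype.card (Fin ν → Fin n → K) := rfl
    rw [this]
    simp
  rw [h1, h2, ← card_ker_linearCombination z, mul_pow, pow_right_comm]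

/-- The `i`-th row of a sequence of tuples, with entries in `K`. -/
def rowVec (K : Type*) [Field K] {m k n : ℕ} (e : Fin n → Simplex m k) (i : Fin k) : Fin n → K :=
  fun t => (e t).vec K i

/-- The rows other than the row `i₀` are all hashed to the same element of `A`, by the linear map
given by the matrix `u` followed by translations `r`. Nothing is required of the row `i₀`, which is
determined by the others as the entries of each tuple have sum `m - 1`. -/
def Kept {i₀ : Fin k} (A : Finset (Fin ν → K)) (u : Matrix (Fin ν) (Fin n) K)
    (r : {i // i ≠ i₀} → Fin ν → K) (e : Fin n → Simplex m k) : Prop :=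
  ∃ a ∈ A, ∀ i : {i // i ≠ i₀}, u *ᵥ rowVec K e i + r i = a

/-- The sequences `e` and `e'` have a row in common. -/
def ShareRow (e e' : Fin n → Simplex m k) : Prop :=
  ∃ j, ∀ t, (e' t).1 j = (e t).1 j

theorem rowVec_congr {e e' : Fin n → Simplex m k} {j : Fin k}
    (h : ∀ t, (e' t).1 j = (e t).1 j) : rowVec K e' j = rowVec K e j := by
  funext t
  simp [rowVec, Simplex.vec, h t]

theorem sum_rowVec_add (i₀ : Fin k) (e : Fin n → Simplex m k) :
    (∑ i : {i // i ≠ i₀}, rowVec K e i) + rowVec K e i₀ = fun _ => (m : K) - 1 := by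
  classical
  funext t
  rw [Pi.add_apply, Finset.sum_apply, ← sum_vec (K := K) (e t), add_sub_cancel_right,
    ← Fintype.sum_subtype_add_sum_subtype (fun i => i ≠ i₀) fun i => (e t).vec K i]
  congr 1
  have h : ∀ x : {i : Fin k // ¬ i ≠ i₀}, x.1 = i₀ := fun x => not_not.mp x.2
  have : Unique {i : Fin k // ¬ i ≠ i₀} := ⟨⟨⟨i₀, by simp⟩⟩, fun x => Subtype.ext (h x)⟩
  rw [Fintype.sum_unique]
  exact (congrArg ((e t).vec K) (h _)).symm

theorem sum_mulVec_rowVec_congr {i₀ : Fin k} {e e' : Fin n → Simplex m k}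
    (h : rowVec K e' i₀ = rowVec K e i₀) (u : Matrix (Fin ν) (Fin n) K) :
    ∑ i : {i // i ≠ i₀}, u *ᵥ rowVec K e' i = ∑ i : {i // i ≠ i₀}, u *ᵥ rowVec K e i := by
  have h1 := (sum_rowVec_add (K := K) i₀ e').trans (sum_rowVec_add i₀ e).symm
  rw [h] at h1
  rw [← Matrix.mulVec_sum, ← Matrix.mulVec_sum, add_right_cancel h1]

/-- A sequence whose rows are rows of kept sequences is itself kept: the row `i₀` determines the sum
of the hashes of the other rows, so the mean of these is an element of `A`. -/
theorem Kept.mix {i₀ : Fin k} {A : Finset (Fin ν → K)} (hA : MeanFree {i // i ≠ i₀} A)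
    {u : Matrix (Fin ν) (Fin n) K} {r : {i // i ≠ i₀} → Fin ν → K}
    {e : Fin k → Fin n → Simplex m k} (he : ∀ i, Kept A u r (e i)) {f : Fin n → Simplex m k}
    (hf : ∀ i t, (f t).1 i = (e i t).1 i) : Kept A u r f := by
  choose a ha hae using he
  have h1 : ∀ i : {i // i ≠ i₀}, u *ᵥ rowVec K f i + r i = a i := fun i => by
    rw [rowVec_congr (hf i), hae]
  have h2 : ∑ i : {i // i ≠ i₀}, a i = Fintype.card {i // i ≠ i₀} • a i₀ := by
    rw [← Finset.card_univ, ← Finset.sum_const]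
    calc ∑ i : {i // i ≠ i₀}, a i = ∑ i : {i // i ≠ i₀}, (u *ᵥ rowVec K f i + r i) :=
          Finset.sum_congr rfl fun i _ => (h1 i).symm
      _ = ∑ i : {i // i ≠ i₀}, (u *ᵥ rowVec K (e i₀) i + r i) := by
          rw [Finset.sum_add_distrib, Finset.sum_add_distrib,
            sum_mulVec_rowVec_congr (rowVec_congr (hf i₀))]
      _ = _ := Finset.sum_congr rfl fun i _ => hae i₀ i
  have h3 := hA (fun i => a i) (a i₀) (fun i => ha i) (ha i₀) h2
  exact ⟨a i₀, ha i₀, fun i => (h1 i).trans (h3 i)⟩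

/-- Two kept sequences with a common row are hashed to the same element of `A`. -/
theorem Kept.kill_of_shareRow {i₀ : Fin k} (hk : ((k - 1 : ℕ) : K) ≠ 0) {A : Finset (Fin ν → K)}
    {u : Matrix (Fin ν) (Fin n) K} {r : {i // i ≠ i₀} → Fin ν → K}
    {e e' : Fin n → Simplex m k} (he : Kept A u r e) (he' : Kept A u r e')
    (h : ShareRow e e') : ∀ l, ∑ t, u l t • ((e' t).vec K - (e t).vec K) = 0 := by
  classical
  obtain ⟨a, -, hae⟩ := he
  obtain ⟨a', -, hae'⟩ := he'
  obtain ⟨j, hj⟩ := h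
  have haa : a' = a := by
    by_cases hji : j = i₀
    · subst hji
      have h1 := sum_mulVec_rowVec_congr (rowVec_congr (K := K) hj) u
      have h2 : ∑ i : {i // i ≠ j}, (u *ᵥ rowVec K e' i + r i)
          = ∑ i : {i // i ≠ j}, (u *ᵥ rowVec K e i + r i) := by
        rw [Finset.sum_add_distrib, Finset.sum_add_distrib, h1]
      rw [Finset.sum_congr rfl fun i _ => hae i, Finset.sum_congr rfl fun i _ => hae' i,
        Finset.sum_const, Finset.sum_const, Finset.card_univ, Fintype.card_subtype_compl,
        Fintype.card_fin, Fintype.card_subtype_eq, ← Nat.cast_smul_eq_nsmul K,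
        ← Nat.cast_smul_eq_nsmul K] at h2
      exact smul_right_injective _ hk h2
    · rw [← hae ⟨j, hji⟩, ← hae' ⟨j, hji⟩, rowVec_congr hj]
  have h1 : ∀ i : {i // i ≠ i₀}, u *ᵥ rowVec K e' i = u *ᵥ rowVec K e i := fun i =>
    add_right_cancel ((hae' i).trans (haa.trans (hae i).symm))
  have h2 : u *ᵥ rowVec K e' i₀ = u *ᵥ rowVec K e i₀ := by
    have h3 := congrArg (u *ᵥ ·)
      ((sum_rowVec_add (K := K) i₀ e').trans (sum_rowVec_add i₀ e).symm)
    simp only [Matrix.mulVec_add, Matrix.mulVec_sum] at h3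
    rw [Finset.sum_congr rfl fun i _ => h1 i] at h3
    exact add_left_cancel h3
  intro l
  funext i
  have h4 : u *ᵥ rowVec K e' i = u *ᵥ rowVec K e i := by
    by_cases hi : i = i₀
    · rw [hi, h2]
    · exact h1 ⟨i, hi⟩
  have h5 := congrFun h4 l
  simp only [Matrix.mulVec, dotProduct, rowVec] at h5
  simp only [Finset.sum_apply, Pi.smul_apply, Pi.sub_apply, smul_eq_mul, mul_sub,
    Finset.sum_sub_distrib, h5, sub_self, Pi.zero_apply]

open Classical in
theorem card_kept [Fintype K] {i₀ : Fin k} [Nonempty {i // i ≠ i₀}] (A : Finset (Fin ν → K))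
    (u : Matrix (Fin ν) (Fin n) K) (e : Fin n → Simplex m k) :
    (Finset.univ.filter fun r : {i // i ≠ i₀} → Fin ν → K => Kept A u r e).card = A.card := by
  have h : (Finset.univ.filter fun r : {i // i ≠ i₀} → Fin ν → K => Kept A u r e)
      = A.image fun a (i : {i // i ≠ i₀}) => a - u *ᵥ rowVec K e i := by
    ext r
    rw [Finset.mem_filter, and_iff_right (Finset.mem_univ r), Finset.mem_image]
    refine exists_congr fun a => and_congr_right fun _ => ?_
    rw [funext_iff]
    exact forall_congr' fun i => by rw [sub_eq_iff_eq_add, eq_comm, add_comm]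
  rw [h, Finset.card_image_of_injective]
  intro a b hab
  obtain ⟨i⟩ := (inferInstance : Nonempty {i // i ≠ i₀})
  exact sub_left_injective (congrFun hab i)

end

/-! ### Isolated sequences -/

section
variable {K : Type*} [Field K] {m k n ν : ℕ}

open Module

/-- The sequence `e` is kept and shares no row with another kept sequence with marginals `c`. -/
def Isolated {i₀ : Fin k} (A : Finset (Fin ν → K)) (u : Matrix (Fin ν) (Fin n) K)
    (r : {i // i ≠ i₀} → Fin ν → K) (c : Fin k → Fin m → ℕ) (e : Fin n → Simplex m k) : Prop :=
  Kept A u r e ∧ ∀ e', marginalCount e' = c → Kept A u r e' → ShareRow e e' → e' = e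

/-- The span of the termwise differences of two sequences of tuples. -/
def diffSpan (K : Type*) [Field K] {m k n : ℕ} (e e' : Fin n → Simplex m k) :
    Submodule K (Fin k → K) :=
  Submodule.span K (Set.range fun t => (e' t).vec K - (e t).vec K)

open Classical in
/-- For a random hash the expected number of pairs of kept sequences with a common row is at most
half of the expected number of kept sequences; so many kept sequences are isolated. -/
theorem exists_card_isolated [Fintype K] {i₀ : Fin k} [Nonempty {i // i ≠ i₀}]
    (hk : ((k - 1 : ℕ) : K) ≠ 0) (A : Finset (Fin ν → K)) (c : Fin k → Fin m → ℕ)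
    (E : Finset (Fin n → Simplex m k))
    (hE : ∀ e ∈ E, ∑ e' with marginalCount e' = c ∧ ShareRow e e' ∧ e' ≠ e,
      (((Fintype.card K : ℝ) ^ ν) ^ finrank K (diffSpan K e e'))⁻¹ ≤ 1 / 2) :
    ∃ (u : Matrix (Fin ν) (Fin n) K) (r : {i // i ≠ i₀} → Fin ν → K),
      (E.card : ℝ) * A.card ≤ 2 * ((Fintype.card K : ℝ) ^ ν) ^ (k - 1)
        * (E.filter fun e => Isolated A u r c e).card := by
  set M : ℝ := ((Fintype.card (Matrix (Fin ν) (Fin n) K) : ℕ) : ℝ) with hM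
  set Q : ℝ := (Fintype.card K : ℝ) ^ ν with hQ
  have hQ0 : 0 < Q := by
    have : 0 < Fintype.card K := Fintype.card_pos
    positivity
  have hM0 : 0 < M := by
    have : 0 < Fintype.card (Matrix (Fin ν) (Fin n) K) := Fintype.card_pos
    rw [hM]
    exact_mod_cast this
  set Ω := Matrix (Fin ν) (Fin n) K × ({i // i ≠ i₀} → Fin ν → K) with hΩ
  set κ : (Fin n → Simplex m k) → Ω → ℝ := fun e ω => if Kept A ω.1 ω.2 e then 1 else 0 with hκ
  have hκsum : ∀ e, ∑ ω, κ e ω = M * A.card := by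
    intro e
    rw [Fintype.sum_prod_type]
    simp only [hκ, Finset.sum_boole, card_kept, Finset.sum_const, Finset.card_univ, nsmul_eq_mul]
    rfl
  -- given `u`, the number of suitable `r` is `A.card`; and `u` must kill the differences
  have hpair : ∀ e e', ShareRow e e' →
      ∑ ω, κ e ω * κ e' ω ≤ M * A.card * (Q ^ finrank K (diffSpan K e e'))⁻¹ := by
    intro e e' hs
    have hkill : ((Finset.univ.filter fun u : Matrix (Fin ν) (Fin n) K =>
        ∀ l, ∑ t, u l t • ((e' t).vec K - (e t).vec K) = 0).card : ℝ)
        = M * (Q ^ finrank K (diffSpan K e e'))⁻¹ := by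
      rw [eq_mul_inv_iff_mul_eq₀ (by positivity)]
      have := card_matrix_kill (ν := ν) fun t => (e' t).vec K - (e t).vec K
      rw [hM, hQ]
      exact_mod_cast this
    have h1 : ∀ ω ∈ (Finset.univ : Finset Ω), κ e ω * κ e' ω
        ≤ (if ∀ l, ∑ t, ω.1 l t • ((e' t).vec K - (e t).vec K) = 0 then 1 else 0) * κ e ω := by
      intro ω _
      simp only [hκ]
      by_cases h2 : Kept A ω.1 ω.2 e <;> by_cases h3 : Kept A ω.1 ω.2 e'
      · simp [h2, h3, h2.kill_of_shareRow hk h3 hs]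
      all_goals simp [h2, h3]
      split_ifs <;> norm_num
    refine (Finset.sum_le_sum h1).trans (le_of_eq ?_)
    rw [Fintype.sum_prod_type]
    simp only [hκ, ← Finset.mul_sum, Finset.sum_boole, card_kept]
    rw [← Finset.sum_mul, Finset.sum_boole, hkill]
    ring
  -- union bound over the sequences `e'` colliding with `e`
  have hiso : ∀ e ∈ E, M * A.card / 2 ≤ ∑ ω : Ω, if Isolated A ω.1 ω.2 c e then (1 : ℝ) else 0 := by
    intro e he
    have h1 : ∀ ω ∈ (Finset.univ : Finset Ω), κ e ω
        - ∑ e' with marginalCount e' = c ∧ ShareRow e e' ∧ e' ≠ e, κ e ω * κ e' ω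
        ≤ if Isolated A ω.1 ω.2 c e then (1 : ℝ) else 0 := by
      intro ω _
      have hnn : ∀ e', 0 ≤ κ e ω * κ e' ω := fun e' => by
        simp only [hκ]; split_ifs <;> norm_num
      split_ifs with h2
      · have h3 : κ e ω ≤ 1 := by simp only [hκ]; split_ifs <;> norm_num
        have := Finset.sum_nonneg (s := Finset.univ.filter fun e' =>
          marginalCount e' = c ∧ ShareRow e e' ∧ e' ≠ e) fun e' _ => hnn e'
        linarith
      · rw [sub_nonpos]
        by_cases h3 : Kept A ω.1 ω.2 e
        · have h4 : ∃ e', marginalCount e' = c ∧ Kept A ω.1 ω.2 e' ∧ ShareRow e e' ∧ e' ≠ e := by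
            by_contra! hcon
            exact h2 ⟨h3, hcon⟩
          obtain ⟨e', hc, hk', hs, hne⟩ := h4
          refine le_trans (le_of_eq ?_) (Finset.single_le_sum (fun e' _ => hnn e')
            (Finset.mem_filter.mpr ⟨Finset.mem_univ e', hc, hs, hne⟩))
          simp [hκ, h3, hk']
        · simp [hκ, h3]
    refine le_trans ?_ (Finset.sum_le_sum h1)
    rw [Finset.sum_sub_distrib, hκsum, Finset.sum_comm]
    have h2 : ∑ e' with marginalCount e' = c ∧ ShareRow e e' ∧ e' ≠ e, ∑ ω, κ e ω * κ e' ω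
        ≤ M * A.card * (1 / 2) := by
      refine le_trans (Finset.sum_le_sum fun e' he' =>
        hpair e e' (Finset.mem_filter.mp he').2.2.1) ?_
      rw [← Finset.mul_sum]
      exact mul_le_mul_of_nonneg_left (hE e he) (by positivity)
    linarith
  have htot : ∑ _ω : Ω, (E.card : ℝ) * A.card / (2 * Q ^ (k - 1))
      ≤ ∑ ω : Ω, ((E.filter fun e => Isolated A ω.1 ω.2 c e).card : ℝ) := by
    simp only [← Finset.sum_boole]
    rw [Finset.sum_comm]
    refine le_trans (le_of_eq ?_) (Finset.card_nsmul_le_sum _ _ _ hiso)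
    have hcard : ((Finset.univ : Finset Ω).card : ℝ) = M * Q ^ (k - 1) := by
      rw [Finset.card_univ, Fintype.card_prod]
      simp only [Fintype.card_pi, Finset.prod_const, Finset.card_univ, Fintype.card_fin,
        Fintype.card_subtype_compl, Fintype.card_subtype_eq]
      push_cast
      rfl
    rw [Finset.sum_const, nsmul_eq_mul, nsmul_eq_mul, hcard]
    field_simp
  obtain ⟨⟨u, r⟩, -, hω⟩ := Finset.exists_le_of_sum_le Finset.univ_nonempty htot
  refine ⟨u, r, ?_⟩
  rw [div_le_iff₀ (by positivity)] at hω
  linarith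

theorem diffSpan_le_pinnedSubspace {e e' : Fin n → Simplex m k} {j : Fin k}
    (h : ∀ t, (e' t).1 j = (e t).1 j) : diffSpan K e e' ≤ pinnedSubspace K j := by
  refine Submodule.span_le.mpr ?_
  rintro _ ⟨t, rfl⟩
  refine ⟨by simp [Simplex.vec, h t], ?_⟩
  have h1 := sum_vec (K := K) (e t)
  have h2 := sum_vec (K := K) (e' t)
  simp only [Pi.sub_apply, Finset.sum_sub_distrib]
  rw [sub_eq_zero]
  exact add_right_cancel (h2.trans h1.symm)

theorem one_le_finrank_diffSpan (hinj : ∀ a b, a < m → b < m → (a : K) = b → a = b)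
    {e e' : Fin n → Simplex m k} (h : e' ≠ e) : 1 ≤ finrank K (diffSpan K e e') := by
  rw [Nat.one_le_iff_ne_zero, Ne, Submodule.finrank_eq_zero, diffSpan, Submodule.span_eq_bot]
  intro hz
  refine h (funext fun t => (modRel_bot_iff hinj).mp ?_)
  exact (Submodule.mem_bot K).mpr (hz _ ⟨t, rfl⟩)

/-- The sequences sharing a row with `e` are grouped by the set of pairs occurring in them, hence
there are boundedly many groups, in each of which the span of the differences is constant. -/
theorem sum_inv_pow_finrank_diffSpan_le (hinj : ∀ a b, a < m → b < m → (a : K) = b → a = b)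
    {e : Fin n → Simplex m k} (B : Finset (Fin n → Simplex m k))
    (hB : ∀ e' ∈ B, ShareRow e e' ∧ e' ≠ e) {X Y Q : ℝ} (hX : 0 ≤ X) (hQ : 0 < Q) (hXQ : X ≤ Q)
    (hY : 0 ≤ Y) (hcount : ∀ (j : Fin k) (U : Submodule K (Fin k → K)), U ≤ pinnedSubspace K j →
      ∀ D ⊆ B, (∀ e' ∈ D, ∀ t, modRel U (e t) (e' t)) → (D.card : ℝ) ≤ Y * X ^ finrank K U) :
    ∑ e' ∈ B, (Q ^ finrank K (diffSpan K e e'))⁻¹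
      ≤ 2 ^ (Fintype.card (Simplex m k) ^ 2) * (Y * (X / Q)) := by
  classical
  set g : (Fin n → Simplex m k) → Finset (Simplex m k × Simplex m k) := fun e' =>
    Finset.univ.image fun t => (e t, e' t) with hg
  have hspan : ∀ e', diffSpan K e e'
      = Submodule.span K ((fun x : Simplex m k × Simplex m k => x.2.vec K - x.1.vec K) '' g e') := by
    intro e'
    rw [diffSpan, hg]
    simp only [Finset.coe_image, Finset.coe_univ, Set.image_univ]
    rw [← Set.range_comp]
    rfl
  have hcard : (2 : ℝ) ^ (Fintype.card (Simplex m k) ^ 2)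
      = ((Finset.univ : Finset (Finset (Simplex m k × Simplex m k))).card : ℝ) := by
    rw [Finset.card_univ, Fintype.card_finset, Fintype.card_prod, pow_two]
    push_cast
    rfl
  rw [← Finset.sum_fiberwise B g, hcard, ← nsmul_eq_mul]
  refine Finset.sum_le_card_nsmul _ _ _ fun S _ => ?_
  rcases (B.filter fun e' => g e' = S).eq_empty_or_nonempty with h | ⟨e₁, he₁⟩
  · rw [h, Finset.sum_empty]; positivity
  obtain ⟨he₁B, he₁S⟩ := Finset.mem_filter.mp he₁
  obtain ⟨⟨j, hj⟩, hne⟩ := hB e₁ he₁B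
  have hconst : ∀ e' ∈ B.filter (fun e' => g e' = S), diffSpan K e e' = diffSpan K e e₁ := by
    intro e' he'
    rw [hspan, hspan, he₁S, (Finset.mem_filter.mp he').2]
  rw [Finset.sum_congr rfl fun e' he' => by rw [hconst e' he'], Finset.sum_const, nsmul_eq_mul]
  have h1 := hcount j (diffSpan K e e₁) (diffSpan_le_pinnedSubspace hj) _
    (Finset.filter_subset _ _) fun e' he' t => by
      rw [← hconst e' he']
      exact Submodule.subset_span ⟨t, rfl⟩
  have h2 := one_le_finrank_diffSpan hinj hne
  have hXQ' : X / Q ≤ 1 := (div_le_one hQ).mpr hXQ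
  calc _ ≤ Y * X ^ finrank K (diffSpan K e e₁) * (Q ^ finrank K (diffSpan K e e₁))⁻¹ :=
        mul_le_mul_of_nonneg_right h1 (by positivity)
    _ = Y * (X / Q) ^ finrank K (diffSpan K e e₁) := by
        rw [div_pow, mul_assoc, div_eq_mul_inv]
    _ ≤ Y * (X / Q) := by
        refine mul_le_mul_of_nonneg_left ?_ hY
        exact pow_le_of_le_one (by positivity) hXQ' (by omega)

end

/-! ### Colored sum-free sets from sequences of tuples -/

/-- A set of sequences with common marginals, such that no sequence with these marginals can be
composed of rows of different sequences of the set, gives a colored sum-free set: a sum of rows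
which vanishes modulo `m` after adding `1` is at least `m - 1` in each position, hence equal to
`m - 1` as the total is prescribed by the marginals. -/
theorem exists_isColoredSumFree_of_mix {m k n : ℕ} (i₀ : Fin k) {c : Fin k → Fin m → ℕ}
    {S : Finset (Fin n → Simplex m k)} (hc : ∀ e ∈ S, marginalCount e = c)
    (hmix : ∀ e : Fin k → Fin n → Simplex m k, (∀ i, e i ∈ S) → ∀ f : Fin n → Simplex m k,
      (∀ i t, (f t).1 i = (e i t).1 i) → marginalCount f = c → ∀ i, f = e i) :
    ∃ x : Fin k → Fin S.card → Fin n → ZMod m, IsColoredSumFree x := by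
  set E : Fin S.card → Fin n → Simplex m k := fun j => (S.equivFin.symm j).1 with hE
  have hES : ∀ j, E j ∈ S := fun j => (S.equivFin.symm j).2
  have hEinj : Function.Injective E := fun a b h =>
    S.equivFin.symm.injective (Subtype.ext h)
  refine ⟨fun i j t => ((E j t).1 i : ℕ) + if i = i₀ then 1 else 0, fun j => ?_⟩
  have hsum : ∀ t, (∑ i, (fun t => (((E (j i) t).1 i : ℕ) : ZMod m) + if i = i₀ then 1 else 0)) t
      = ((∑ i, ((E (j i) t).1 i : ℕ) + 1 : ℕ) : ZMod m) := by
    intro t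
    rw [Finset.sum_apply, Finset.sum_add_distrib]
    simp
  constructor
  · intro h
    have hdvd : ∀ t, m ∣ ∑ i, ((E (j i) t).1 i : ℕ) + 1 := fun t => by
      rw [← ZMod.natCast_eq_zero_iff, ← hsum t, h]
      rfl
    -- the rows come from different sequences, but the row sums depend only on the marginals
    have htot : ∑ t, (∑ i, ((E (j i) t).1 i : ℕ) + 1) = ∑ _t : Fin n, m := by
      rw [← Finset.sum_congr rfl fun t _ => (E (j i₀) t).2, Finset.sum_add_distrib,
        Finset.sum_add_distrib, Finset.sum_comm, Finset.sum_comm (s := Finset.univ)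
        (f := fun t i => ((E (j i₀) t).1 i : ℕ))]
      congr 1
      refine Finset.sum_congr rfl fun i _ => ?_
      rw [sum_apply_eq_sum_marginalCount (E (j i)) i fun a => (a : ℕ),
        sum_apply_eq_sum_marginalCount (E (j i₀)) i fun a => (a : ℕ), hc _ (hES _), hc _ (hES _)]
    have heq := (Finset.sum_eq_sum_iff_of_le fun t _ =>
      Nat.le_of_dvd (Nat.succ_pos _) (hdvd t)).mp htot.symm
    set f : Fin n → Simplex m k := fun t => ⟨fun i => (E (j i) t).1 i,
      (heq t (Finset.mem_univ t)).symm⟩ with hf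
    have hfc : marginalCount f = c := by
      funext i a
      rw [← hc _ (hES (j i))]
      rfl
    have h1 := hmix (fun i => E (j i)) (fun i => hES _) f (fun i t => rfl) hfc
    exact fun a b => hEinj ((h1 a).symm.trans (h1 b))
  · intro h
    funext t
    refine (hsum t).trans ?_
    rw [Finset.sum_congr rfl fun i _ => by rw [h i i₀], (E (j i₀) t).2]
    simp

/-! ### Binomial coefficients modulo a prime -/

/-- The binomial coefficient `N.choose (p ^ r - 1)` detects divisibility of `N + 1` by `p ^ r`. -/
theorem cast_choose_prime_pow_sub_one {p : ℕ} [hp : Fact p.Prime] (r : ℕ) : ∀ N : ℕ,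
    ((N.choose (p ^ r - 1) : ℕ) : ZMod p) = if p ^ r ∣ N + 1 then 1 else 0 := by
  have hp2 := hp.out.two_le
  induction r with
  | zero => intro N; simp
  | succ r ih =>
    intro N
    have hpr : 1 ≤ p ^ r := Nat.one_le_pow _ _ (by omega)
    obtain ⟨w, hw⟩ : ∃ w, p ^ r = w + 1 := ⟨p ^ r - 1, by omega⟩
    have e : p ^ (r + 1) - 1 = (p - 1) + p * (p ^ r - 1) := by
      rw [pow_succ, hw, Nat.add_sub_cancel, add_mul, one_mul, mul_comm w p]; omega
    have e1 : (p ^ (r + 1) - 1) % p = p - 1 := by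
      rw [e, Nat.add_mul_mod_self_left, Nat.mod_eq_of_lt (by omega)]
    have e2 : (p ^ (r + 1) - 1) / p = p ^ r - 1 := by
      rw [e, Nat.add_mul_div_left _ _ (by omega), Nat.div_eq_of_lt (by omega), zero_add]
    have h := (ZMod.natCast_eq_natCast_iff _ _ _).mpr
      (Choose.choose_modEq_choose_mod_mul_choose_div_nat (p := p) (n := N) (k := p ^ (r + 1) - 1))
    rw [h, e1, e2, Nat.cast_mul, ih (N / p)]
    have hlt : N % p < p := Nat.mod_lt _ (by omega)
    have hdm := Nat.div_add_mod N p
    by_cases hN : N % p = p - 1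
    · have h3 : N + 1 = p * (N / p + 1) := by rw [mul_add, mul_one]; omega
      have h4 : p ^ (r + 1) ∣ N + 1 ↔ p ^ r ∣ N / p + 1 := by
        rw [h3, pow_succ, mul_comm (p ^ r) p, Nat.mul_dvd_mul_iff_left (by omega)]
      rw [hN, Nat.choose_self, Nat.cast_one, one_mul]
      simp only [h4]
    · have h4 : ¬ p ^ (r + 1) ∣ N + 1 := by
        intro hd
        have h5 : p ∣ N + 1 := (dvd_pow_self p (by omega)).trans hd
        obtain ⟨q, hq⟩ := h5
        have : N % p = p - 1 := by
          rcases q with _ | q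
          · omega
          have : N = (p - 1) + p * q := by rw [mul_add] at hq; omega
          rw [this, Nat.add_mul_mod_self_left, Nat.mod_eq_of_lt (by omega)]
        exact hN this
      rw [if_neg h4, Nat.choose_eq_zero_of_lt (by omega)]
      simp

/-- Vandermonde's identity for several summands. -/
theorem sum_choose_eq_sum_piAntidiag {ι : Type*} [DecidableEq ι] (s : Finset ι) (N : ι → ℕ) (d : ℕ) :
    (∑ i ∈ s, N i).choose d = ∑ a ∈ s.piAntidiag d, ∏ i ∈ s, (N i).choose (a i) := by
  induction s using Finset.cons_induction generalizing d with
  | empty => 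
    rcases Nat.eq_zero_or_pos d with rfl | hd
    · simp
    · rw [Finset.piAntidiag_empty_of_ne_zero (by omega)]
      simp [Nat.choose_eq_zero_of_lt hd]
  | cons i s hi ih =>
    rw [Finset.sum_cons, Nat.add_choose_eq, Finset.piAntidiag_cons, Finset.sum_disjiUnion]
    refine Finset.sum_congr rfl fun z hz => ?_
    rw [Finset.sum_map, ih, Finset.mul_sum]
    refine Finset.sum_congr rfl fun a ha => ?_
    have hai : a i = 0 := by
      by_contra h
      exact hi ((Finset.mem_piAntidiag.mp ha).2 i h)
    rw [Finset.prod_cons]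
    congr 1
    · simp [hai]
    · refine Finset.prod_congr rfl fun j hj => ?_
      have : j ≠ i := fun h => hi (h ▸ hj)
      simp [this]

/-! ### Products of elements of subspaces of a function space -/

section
variable {F ι : Type*} [Field F] [Fintype ι]

open Module

/-- A subspace of a function space contains a function whose support is at least as large as the
dimension of the subspace. -/
theorem exists_mem_finrank_le_card_support (B : Submodule F (ι → F)) :
    ∃ h ∈ B, finrank F B ≤ {y | h y ≠ 0}.ncard := by
  classical
  obtain ⟨N, hN, hmax⟩ : ∃ N, (∃ h ∈ B, {y | h y ≠ 0}.ncard = N) ∧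
      ∀ N', (∃ h ∈ B, {y | h y ≠ 0}.ncard = N') → N' ≤ N := by
    have hex : ∃ N, ∃ h ∈ B, {y | h y ≠ 0}.ncard = N := ⟨_, 0, B.zero_mem, rfl⟩
    have hbd : ∀ N, (∃ h ∈ B, {y | h y ≠ 0}.ncard = N) → N ≤ Fintype.card ι := by
      rintro _ ⟨h, _, rfl⟩
      rw [← Nat.card_eq_fintype_card]
      exact Set.ncard_le_card _
    exact ⟨_, Nat.findGreatest_spec (P := fun N => ∃ h ∈ B, {y | h y ≠ 0}.ncard = N)
      (hbd _ hex.choose_spec) hex.choose_spec, fun N' h' => Nat.le_findGreatest (hbd _ h') h'⟩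
  obtain ⟨h, hB, rfl⟩ := hN
  refine ⟨h, hB, ?_⟩
  by_contra! hlt
  -- otherwise some nonzero element of `B` vanishes on the support of `h`
  set S := {y | h y ≠ 0} with hS
  set R : B →ₗ[F] (S → F) := (LinearMap.funLeft F F (Subtype.val : S → ι)).comp B.subtype with hR
  have hker : LinearMap.ker R ≠ ⊥ := by
    apply LinearMap.ker_ne_bot_of_finrank_lt
    rw [finrank_fintype_fun_eq_card, ← Nat.card_eq_fintype_card]
    exact hlt
  obtain ⟨v, hv, hv0⟩ := (Submodule.ne_bot_iff _).mp hker
  have hvS : ∀ y, h y ≠ 0 → v.1 y = 0 := by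
    intro y hy
    have := congrFun (LinearMap.mem_ker.mp hv) ⟨y, hy⟩
    simpa [hR] using this
  obtain ⟨y0, hy0⟩ : ∃ y, v.1 y ≠ 0 := by
    by_contra! hall
    exact hv0 (Subtype.ext (funext hall))
  have hy0S : h y0 = 0 := by
    by_contra hne
    exact hy0 (hvS y0 hne)
  have := hmax _ ⟨h + v.1, B.add_mem hB v.2, rfl⟩
  refine absurd this (not_le.mpr (Set.ncard_lt_ncard ⟨fun y hy => ?_, fun hsub => ?_⟩ (Set.toFinite _)))
  · change h y + v.1 y ≠ 0
    rw [hvS y hy, add_zero]; exact hy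
  · have h1 : y0 ∈ {y | (h + v.1) y ≠ 0} := by
      change h y0 + v.1 y0 ≠ 0
      rw [hy0S, zero_add]; exact hy0
    exact hsub h1 hy0S

/-- Given subspaces `A` and `B`, there is a subspace consisting of products of elements of `A` and of
`B` whose codimension is at most the sum of the codimensions. -/
theorem exists_submodule_of_products (A B : Submodule F (ι → F)) :
    ∃ D : Submodule F (ι → F), finrank F A + finrank F B ≤ finrank F D + Fintype.card ι ∧
      ∀ d ∈ D, ∃ a ∈ A, ∃ b ∈ B, d = a * b := by
  classical
  obtain ⟨h, hB, hsupp⟩ := exists_mem_finrank_le_card_support B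
  set μ : A →ₗ[F] (ι → F) := (LinearMap.mulLeft F h).comp A.subtype with hμ
  refine ⟨LinearMap.range μ, ?_, ?_⟩
  · have h1 := LinearMap.finrank_range_add_finrank_ker μ
    set S := {y | h y ≠ 0} with hS
    set R : LinearMap.ker μ →ₗ[F] ((Sᶜ : Set ι) → F) :=
      (LinearMap.funLeft F F (Subtype.val : (Sᶜ : Set ι) → ι)).comp
        (A.subtype.comp (LinearMap.ker μ).subtype) with hR
    have hinj : Function.Injective R := by
      have hvan : ∀ v : LinearMap.ker μ, ∀ y, h y ≠ 0 → v.1.1 y = 0 := by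
        intro v y hy
        have h2 : h y * v.1.1 y = 0 := congrFun (LinearMap.mem_ker.mp v.2) y
        exact (mul_eq_zero.mp h2).resolve_left hy
      intro v w hvw
      apply Subtype.ext; apply Subtype.ext; funext y
      by_cases hy : h y = 0
      · exact congrFun hvw ⟨y, by simp [hS, hy]⟩
      · rw [hvan v y hy, hvan w y hy]
    have h2 := LinearMap.finrank_le_finrank_of_injective hinj
    rw [finrank_fintype_fun_eq_card, ← Nat.card_eq_fintype_card, Nat.card_coe_set_eq] at h2
    have h3 := Set.ncard_add_ncard_compl S
    rw [Nat.card_eq_fintype_card] at h3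
    omega
  · rintro _ ⟨a, rfl⟩
    exact ⟨a.1, a.2, h, hB, by simp [hμ, mul_comm]⟩

/-- Iterated form of `exists_submodule_of_products`, for `n + 1` subspaces. -/
theorem exists_submodule_of_prod (n : ℕ) (V : Fin (n + 1) → Submodule F (ι → F)) :
    ∃ D : Submodule F (ι → F), ∑ l, finrank F (V l) ≤ finrank F D + n * Fintype.card ι ∧
      ∀ d ∈ D, ∃ v : Fin (n + 1) → ι → F, (∀ l, v l ∈ V l) ∧ d = ∏ l, v l := by
  induction n with
  | zero => exact ⟨V 0, by simp, fun d hd => ⟨fun _ => d, by simpa [Fin.forall_fin_one] using hd, by simp⟩⟩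
  | succ n ih =>
    obtain ⟨D, hD, hprod⟩ := ih fun l => V l.castSucc
    obtain ⟨E, hE, hEprod⟩ := exists_submodule_of_products D (V (Fin.last (n + 1)))
    refine ⟨E, ?_, fun e he => ?_⟩
    · rw [Fin.sum_univ_castSucc, add_mul, one_mul]; omega
    · obtain ⟨a, ha, b, hb, rfl⟩ := hEprod e he
      obtain ⟨v, hv, rfl⟩ := hprod a ha
      refine ⟨Fin.snoc (α := fun _ => ι → F) v b, fun l => ?_, ?_⟩
      · refine Fin.lastCases ?_ (fun l => ?_) l
        · simpa using hb
        · simpa using hv l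
      · rw [Fin.prod_univ_castSucc (Fin.snoc (α := fun _ => ι → F) v b)]
        simp only [Fin.snoc_castSucc, Fin.snoc_last]

/-- If the sums of all products `∏ l, v l` with `v l ∈ V l` vanish, then the codimensions of the
`V l` add up to at least the dimension of the function space. This replaces the lower bound for
the slice rank of a diagonal tensor. -/
theorem card_le_sum_codim (n : ℕ) (V : Fin (n + 2) → Submodule F (ι → F))
    (hV : ∀ v : Fin (n + 2) → ι → F, (∀ l, v l ∈ V l) → ∑ y, ∏ l, v l y = 0) :
    Fintype.card ι ≤ ∑ l, (Fintype.card ι - finrank F (V l)) := by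
  classical
  obtain ⟨D, hD, hprod⟩ := exists_submodule_of_prod n fun l => V l.castSucc
  set W := V (Fin.last (n + 1)) with hW
  have horth : ∀ d ∈ D, ∀ w ∈ W, d ⬝ᵥ w = 0 := by
    intro d hd w hw
    obtain ⟨v, hv, rfl⟩ := hprod d hd
    have := hV (Fin.snoc (α := fun _ => ι → F) v w) (fun l => by
      refine Fin.lastCases ?_ (fun l => ?_) l
      · simpa using hw
      · simpa using hv l)
    simpa [dotProduct, Fin.prod_univ_castSucc, Finset.prod_apply] using this
  have hdim : finrank F D + finrank F W ≤ Fintype.card ι := by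
    have hle : D.map (dotProductEquiv F ι).toLinearMap ≤ W.dualAnnihilator := by
      rintro _ ⟨d, hd, rfl⟩
      rw [Submodule.mem_dualAnnihilator]
      exact fun w hw => horth d hd w hw
    have h1 := Submodule.finrank_mono hle
    rw [LinearEquiv.finrank_map_eq] at h1
    have h2 := Subspace.finrank_add_finrank_dualAnnihilator_eq W
    rw [finrank_fintype_fun_eq_card] at h2
    omega
  have hle : ∀ l, finrank F (V l) ≤ Fintype.card ι := fun l => by
    simpa using Submodule.finrank_le (V l)
  have h1 : ∑ l, (Fintype.card ι - finrank F (V l)) + ∑ l, finrank F (V l)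
      = (n + 2) * Fintype.card ι := by
    rw [← Finset.sum_add_distrib, Finset.sum_congr rfl fun l _ => Nat.sub_add_cancel (hle l)]
    simp
  rw [Fin.sum_univ_castSucc (fun l => finrank F (V l)), ← hW] at h1
  have : (n + 2) * Fintype.card ι = n * Fintype.card ι + 2 * Fintype.card ι := by ring
  omega

end

/-! ### The upper bound -/

open Module in
/-- A `k`-colored sum-free family in `(ℤ/p^r)^κ` is at most `k` times as large as the set of
exponent vectors of degree at most a `1/k` proportion of the maximal degree. -/
theorem card_le_mul_card_low_degree {m p r n : ℕ} [Fact p.Prime] {κ ι : Type*} [Fintype κ]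
    [DecidableEq κ] [Fintype ι] [DecidableEq ι] (hm : 2 ≤ m) (hmdef : m = p ^ r)
    (x : Fin (n + 2) → ι → κ → ZMod m)
    (hx : ∀ j : Fin (n + 2) → ι, ∑ i, x i (j i) = 0 ↔ ∀ a b, j a = j b) :
    Fintype.card ι ≤ (n + 2) * (Finset.univ.filter fun a : κ → Fin m =>
      (n + 2) * ∑ t, (a t : ℕ) ≤ (m - 1) * Fintype.card κ).card := by
  have hchoose : ∀ N : ℕ, ((N.choose (m - 1) : ℕ) : ZMod p) = if m ∣ N + 1 then 1 else 0 := by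
    rw [hmdef]; exact cast_choose_prime_pow_sub_one r
  have : NeZero m := ⟨by omega⟩
  set low := Finset.univ.filter fun a : κ → Fin m =>
    (n + 2) * ∑ t, (a t : ℕ) ≤ (m - 1) * Fintype.card κ with hlow
  -- shift one colour so that the sums to be detected are congruent to `-1`
  set z : Fin (n + 2) → ι → κ → ZMod m := fun i y t => x i y t - if i = 0 then 1 else 0 with hz
  set φ : Fin (n + 2) → (κ → ℕ) → ι → ZMod p := fun i a y =>
    ∏ t, (((z i y t).val.choose (a t) : ℕ) : ZMod p) with hφ
  set Λ : Fin (n + 2) → (ι → ZMod p) →ₗ[ZMod p] (low → ZMod p) := fun i =>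
    LinearMap.pi fun a => dotProductBilin (ZMod p) (ZMod p) (φ i fun t => (a.1 t : ℕ)) with hΛ
  have hmem : ∀ i h, h ∈ LinearMap.ker (Λ i) → ∀ a : κ → ℕ, (∀ t, a t < m) →
      (n + 2) * ∑ t, a t ≤ (m - 1) * Fintype.card κ → ∑ y, φ i a y * h y = 0 := by
    intro i h hh a ha hdeg
    exact congrFun (LinearMap.mem_ker.mp hh) ⟨fun t => ⟨a t, ha t⟩, by simpa [hlow] using hdeg⟩
  have hind : ∀ j : Fin (n + 2) → ι,
      ∏ t, (((∑ i, (z i (j i) t).val).choose (m - 1) : ℕ) : ZMod p)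
        = if ∀ a b, j a = j b then 1 else 0 := by
    intro j
    have hdvd : ∀ t, m ∣ ∑ i, (z i (j i) t).val + 1 ↔ (∑ i, x i (j i)) t = 0 := by
      intro t
      rw [← ZMod.natCast_eq_zero_iff]
      push_cast
      simp only [ZMod.natCast_zmod_val, hz, Finset.sum_sub_distrib, Finset.sum_ite_eq',
        Finset.mem_univ, if_true, sub_add_cancel, Finset.sum_apply]
    simp only [hchoose, hdvd]
    by_cases h : ∀ a b, j a = j b
    · rw [if_pos h]
      have h0 := (hx j).mpr h
      exact Finset.prod_eq_one fun t _ => if_pos (by rw [h0]; rfl)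
    · rw [if_neg h]
      have : ∑ i, x i (j i) ≠ 0 := fun h0 => h ((hx j).mp h0)
      obtain ⟨t, ht⟩ := Function.ne_iff.mp this
      exact Finset.prod_eq_zero (Finset.mem_univ t) (if_neg ht)
  have hexpand : ∀ j : Fin (n + 2) → ι,
      ∏ t, (((∑ i, (z i (j i) t).val).choose (m - 1) : ℕ) : ZMod p)
        = ∑ a ∈ Fintype.piFinset fun _ : κ => (Finset.univ : Finset (Fin (n + 2))).piAntidiag (m - 1),
          ∏ i, φ i (fun t => a t i) (j i) := by
    intro j
    simp only [sum_choose_eq_sum_piAntidiag, Nat.cast_sum, Nat.cast_prod]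
    rw [Finset.prod_univ_sum]
    refine Finset.sum_congr rfl fun a _ => ?_
    rw [Finset.prod_comm]
  have hV : ∀ v : Fin (n + 2) → ι → ZMod p, (∀ l, v l ∈ LinearMap.ker (Λ l)) →
      ∑ y, ∏ l, v l y = 0 := by
    intro v hv
    have h1 : ∑ j : Fin (n + 2) → ι, (if ∀ a b, j a = j b then (1 : ZMod p) else 0) *
        ∏ l, v l (j l) = ∑ y, ∏ l, v l y := by
      simp only [ite_mul, one_mul, zero_mul]
      rw [← Finset.sum_filter]
      symm
      refine Finset.sum_bij (fun y _ => fun _ => y) (by simp) (fun y _ y' _ h => congrFun h 0)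
        (fun j hj => ⟨j 0, Finset.mem_univ _, ?_⟩) (by simp)
      funext a
      exact (Finset.mem_filter.mp hj).2 0 a
    rw [← h1]
    simp only [← hind, hexpand, Finset.sum_mul, ← Finset.prod_mul_distrib]
    rw [Finset.sum_comm]
    refine Finset.sum_eq_zero fun a ha => ?_
    have e := Fintype.prod_sum (R := ZMod p) (κ := fun _ : Fin (n + 2) => ι)
      fun l y => φ l (fun t => a t l) y * v l y
    rw [← e]
    have ha' : ∀ t, ∑ l, a t l = m - 1 := fun t => by
      simpa using Fintype.mem_piFinset.mp ha t
    -- some colour has low degree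
    obtain ⟨l, hl⟩ : ∃ l, (n + 2) * ∑ t, a t l ≤ (m - 1) * Fintype.card κ := by
      by_contra! hcon
      have h2 : ∑ _l : Fin (n + 2), (m - 1) * Fintype.card κ
          < ∑ l : Fin (n + 2), (n + 2) * ∑ t, a t l :=
        Finset.sum_lt_sum_of_nonempty Finset.univ_nonempty fun l _ => hcon l
      rw [← Finset.mul_sum Finset.univ (fun l => ∑ t, a t l), Finset.sum_comm] at h2
      simp only [ha', Finset.sum_const, Finset.card_univ, Fintype.card_fin, smul_eq_mul] at h2
      rw [mul_comm (Fintype.card κ)] at h2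
      exact lt_irrefl _ h2
    refine Finset.prod_eq_zero (Finset.mem_univ l) (hmem l (v l) (hv l) _ (fun t => ?_) hl)
    have := Finset.single_le_sum (f := a t) (fun _ _ => Nat.zero_le _) (Finset.mem_univ l)
    rw [ha' t] at this
    omega
  refine (card_le_sum_codim n _ hV).trans ?_
  calc ∑ l, (Fintype.card ι - finrank (ZMod p) (LinearMap.ker (Λ l)))
      ≤ ∑ _l : Fin (n + 2), low.card := by
        refine Finset.sum_le_sum fun l _ => ?_
        have h1 := LinearMap.finrank_range_add_finrank_ker (Λ l)
        have h2 := Submodule.finrank_le (LinearMap.range (Λ l))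
        rw [finrank_fintype_fun_eq_card] at h1 h2
        rw [Fintype.card_coe] at h2
        omega
    _ = (n + 2) * low.card := by simp

/-- Weighting an exponent vector `a` with `γ ^ (∑ t, a t)`, where `γ` is the minimiser of `gammaFun`,
bounds the number of vectors of low degree. -/
theorem card_low_degree_le {m k : ℕ} (hm : 2 ≤ m) (hk : 3 ≤ k) {κ : Type*} [Fintype κ]
    [DecidableEq κ] : ((Finset.univ.filter fun a : κ → Fin m =>
      k * ∑ t, (a t : ℕ) ≤ (m - 1) * Fintype.card κ).card : ℝ) ≤ gammaConst m k ^ Fintype.card κ := by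
  obtain ⟨γ, ⟨h0, h1⟩, hγ⟩ := (isLeast_gammaConst hm hk).1
  have hk0 : (0 : ℝ) < k := by positivity
  rw [← hγ, gammaFun]
  set e := ((m : ℝ) - 1) / k with he
  rw [div_pow, le_div_iff₀ (pow_pos (Real.rpow_pos_of_pos h0 _) _)]
  have hsum : (∑ i ∈ Finset.range m, γ ^ i) ^ Fintype.card κ
      = ∑ a : κ → Fin m, γ ^ ∑ t, (a t : ℕ) := by
    rw [Finset.sum_range, ← Finset.card_univ, ← Finset.prod_const,
      Fintype.prod_sum (κ := fun _ : κ => Fin m) fun _ i => γ ^ (i : ℕ)]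
    simp only [Finset.prod_pow_eq_pow_sum]
  rw [hsum, ← nsmul_eq_mul, ← Finset.sum_const]
  refine le_trans (Finset.sum_le_sum fun a ha => ?_) (Finset.sum_le_univ_sum_of_nonneg fun a => by positivity)
  have h2 := (Finset.mem_filter.mp ha).2
  rw [← Real.rpow_natCast, ← Real.rpow_mul h0.le, ← Real.rpow_natCast]
  refine Real.rpow_le_rpow_of_exponent_ge h0 h1.le ?_
  rw [he, div_mul_eq_mul_div, le_div_iff₀ hk0]
  have h3 : ((k * ∑ t, (a t : ℕ) : ℕ) : ℝ) ≤ (((m - 1) * Fintype.card κ : ℕ) : ℝ) := by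
    exact_mod_cast h2
  rw [Nat.cast_mul, Nat.cast_mul, Nat.cast_sub (by omega), Nat.cast_one] at h3
  linarith

/-- The factor `k` is removed by passing to powers of the given family. -/
theorem card_le_gammaConst_pow {m k : ℕ} (hm : 2 ≤ m) (hk : 3 ≤ k) (hpp : IsPrimePow m)
    (n L : ℕ) (x : Fin k → Fin L → (Fin n → ZMod m)) (hx : IsColoredSumFree x) :
    (L : ℝ) ≤ gammaConst m k ^ n := by
  obtain ⟨p, r, hp, hr, rfl⟩ := (isPrimePow_nat_iff m).mp hpp
  have : Fact p.Prime := ⟨hp⟩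
  obtain ⟨k, rfl⟩ : ∃ k', k = k' + 2 := ⟨k - 2, by omega⟩
  obtain ⟨γ, ⟨h0, h1⟩, hγ⟩ := (isLeast_gammaConst hm hk).1
  have hpos : 0 < gammaConst (p ^ r) (k + 2) := by
    rw [← hγ, gammaFun]
    refine div_pos (Finset.sum_pos (fun i _ => by positivity) ?_) (Real.rpow_pos_of_pos h0 _)
    exact ⟨0, Finset.mem_range.mpr (by omega)⟩
  set Γ := gammaConst (p ^ r) (k + 2) ^ n with hΓ
  have hΓ0 : 0 < Γ := pow_pos hpos n
  -- the `N`-fold power of the family is colored sum-free in `(ZMod m) ^ (N * n)`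
  have hpow : ∀ N : ℕ, ((L : ℝ) / Γ) ^ N ≤ k + 2 := by
    intro N
    have h2 := card_le_mul_card_low_degree (κ := Fin N × Fin n) (ι := Fin N → Fin L) hm rfl
      (fun i y t => x i (y t.1) t.2) (fun j => by
        have e : (∑ i, (fun t : Fin N × Fin n => x i (j i t.1) t.2)) = 0 ↔
            ∀ u : Fin N, ∑ i, x i (j i u) = 0 := by
          constructor
          · intro h u
            funext t
            simpa using congrFun h (u, t)
          · intro h
            funext t
            simpa using congrFun (h t.1) t.2
        rw [e]
        constructor
        · intro h a b
          funext u
          exact (hx fun i => j i u).mp (h u) a b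
        · intro h u
          exact (hx fun i => j i u).mpr fun a b => congrFun (h a b) u)
    have h3 := card_low_degree_le (κ := Fin N × Fin n) hm hk
    simp only [Fintype.card_pi, Finset.prod_const, Finset.card_univ, Fintype.card_fin,
      Fintype.card_prod] at h2 h3
    rw [div_pow, div_le_iff₀ (pow_pos hΓ0 _)]
    have h4 : ((L ^ N : ℕ) : ℝ) ≤ _ := Nat.cast_le.mpr h2
    push_cast at h4
    refine h4.trans ?_
    rw [hΓ, ← pow_mul, mul_comm n N]
    exact mul_le_mul_of_nonneg_left h3 (by positivity)
  by_contra! hlt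
  have h2 : 1 < (L : ℝ) / Γ := (one_lt_div hΓ0).mpr hlt
  obtain ⟨N, hN⟩ := pow_unbounded_of_one_lt ((k : ℝ) + 2) h2
  exact absurd (hpow N) (not_le.mpr hN)

/-! ### The minimiser of `gammaFun` -/

theorem gammaConst_eq_exp_log {m k : ℕ} (hm : 2 ≤ m) (hk : 3 ≤ k) :
    0 < Real.log (gammaConst m k) ∧ Real.exp (Real.log (gammaConst m k)) = gammaConst m k := by
  obtain ⟨γ, ⟨h0, h1⟩, h⟩ := (isLeast_gammaConst hm hk).1
  have hm' : (2 : ℝ) ≤ m := by exact_mod_cast hm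
  have hk' : (3 : ℝ) ≤ k := by exact_mod_cast hk
  have h2 : γ ^ (((m : ℝ) - 1) / k) < 1 :=
    Real.rpow_lt_one h0.le h1 (div_pos (by linarith) (by linarith))
  have h3 : 1 ≤ ∑ i ∈ Finset.range m, γ ^ i := by
    have := Finset.single_le_sum (f := fun i => γ ^ i) (s := Finset.range m)
      (fun i _ => by positivity) (Finset.mem_range.mpr (by omega : 0 < m))
    simpa using this
  have h4 : 1 < gammaConst m k := by
    rw [← h, gammaFun, one_lt_div (Real.rpow_pos_of_pos h0 _)]
    linarith
  exact ⟨Real.log_pos h4, Real.exp_log (by linarith)⟩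

/-- At the minimiser `γ`, the distribution proportional to `γ ^ a` has mean `(m - 1) / k`. -/
theorem exists_gammaFun_eq_gammaConst {m k : ℕ} (hm : 2 ≤ m) (hk : 3 ≤ k) :
    ∃ γ : ℝ, 0 < γ ∧ γ < 1 ∧ gammaFun m k γ = gammaConst m k ∧
      k * ∑ a ∈ Finset.range m, γ ^ a * a = (m - 1) * ∑ a ∈ Finset.range m, γ ^ a := by
  obtain ⟨⟨γ, ⟨h0, h1⟩, h⟩, hle⟩ := isLeast_gammaConst hm hk
  refine ⟨γ, h0, h1, h, ?_⟩
  have hk0 : (k : ℝ) ≠ 0 := by positivity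
  obtain ⟨s, hs⟩ : ∃ s : ℝ, s = ((m : ℝ) - 1) / (k : ℝ) := ⟨_, rfl⟩
  have hg : gammaFun m k = fun γ => (∑ i ∈ Finset.range m, γ ^ i) / γ ^ s := by
    funext γ; rw [gammaFun, hs]
  have hd1 : HasDerivAt (fun γ : ℝ => ∑ i ∈ Finset.range m, γ ^ i)
      (∑ i ∈ Finset.range m, (i : ℝ) * γ ^ (i - 1)) γ :=
    HasDerivAt.fun_sum fun i _ => hasDerivAt_pow i γ
  have hd2 : HasDerivAt (fun γ : ℝ => γ ^ s) (s * γ ^ (s - 1)) γ :=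
    Real.hasDerivAt_rpow_const (Or.inl h0.ne')
  have hpos := Real.rpow_pos_of_pos h0 s
  have hd3 := hd1.fun_div hd2 hpos.ne'
  rw [← hg] at hd3
  have hmin : IsLocalMin (gammaFun m k) γ := by
    filter_upwards [Ioo_mem_nhds h0 h1] with x hx
    rw [h]
    exact hle ⟨x, hx, rfl⟩
  have hz := hmin.hasDerivAt_eq_zero hd3
  rw [div_eq_zero_iff, or_iff_left (pow_ne_zero 2 hpos.ne'), Real.rpow_sub_one h0.ne'] at hz
  have h2 : (∑ i ∈ Finset.range m, (i : ℝ) * γ ^ (i - 1)) * γ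
      = ∑ a ∈ Finset.range m, γ ^ a * a := by
    rw [Finset.sum_mul]
    refine Finset.sum_congr rfl fun i _ => ?_
    rcases i with _ | i
    · simp
    · rw [Nat.add_sub_cancel, pow_succ]; ring
  have h3 : (∑ i ∈ Finset.range m, (i : ℝ) * γ ^ (i - 1)) * γ
      = s * ∑ a ∈ Finset.range m, γ ^ a := by
    have h4 : ((∑ i ∈ Finset.range m, (i : ℝ) * γ ^ (i - 1)) * γ
        - s * ∑ a ∈ Finset.range m, γ ^ a) * γ ^ s = 0 := by
      have := congrArg (· * γ) hz
      simp only [zero_mul] at this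
      rw [← this]
      field_simp
    exact sub_eq_zero.mp ((mul_eq_zero.mp h4).resolve_right hpos.ne')
  rw [← h2, h3, hs]
  field_simp

/-- A symmetric distribution on the simplex whose marginals have entropy `log Γ`. -/
theorem exists_coupling_gammaConst {m k : ℕ} (hm : 2 ≤ m) (hk : 3 ≤ k) :
    ∃ (θ : Fin m → ℝ) (ψ : Fin m → ℝ),
      (∀ i a, ∑ τ : Simplex m k with τ.1 i = a, Real.exp (∑ j, θ (τ.1 j)) = ψ a) ∧
      ∑ a, ψ a = 1 ∧ ∑ a, ψ a * -Real.log (ψ a) = Real.log (gammaConst m k) := by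
  obtain ⟨γ, h0, h1, hγ, hmean⟩ := exists_gammaFun_eq_gammaConst hm hk
  set Z := ∑ a ∈ Finset.range m, γ ^ a with hZ
  have hZ0 : 0 < Z := Finset.sum_pos (fun a _ => by positivity) ⟨0, by simp; omega⟩
  have hk0 : (k : ℝ) ≠ 0 := by positivity
  set ψ : ℕ → ℝ := fun a => γ ^ a / Z with hψ
  have hsum : ∑ a ∈ Finset.range m, ψ a = 1 := by
    rw [← Finset.sum_div, div_self hZ0.ne']
  have hmean' : (k : ℝ) * ∑ a ∈ Finset.range m, ψ a * a = m - 1 := by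
    have : ∑ a ∈ Finset.range m, ψ a * a = (∑ a ∈ Finset.range m, γ ^ a * a) / Z := by
      rw [Finset.sum_div]
      exact Finset.sum_congr rfl fun a _ => by simp only [hψ]; ring
    rw [this, mul_div_assoc', hmean, mul_div_assoc, div_self hZ0.ne', mul_one]
  obtain ⟨θ, hθ⟩ := exists_coupling hm hk (ψ := ψ)
    (fun a _ => div_lt_div_of_pos_right (by
      rw [pow_succ]; exact mul_lt_of_lt_one_right (by positivity) h1) hZ0)
    (by positivity) hsum hmean'
  refine ⟨θ, fun a => ψ a, hθ, ?_, ?_⟩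
  · rw [Fin.sum_univ_eq_sum_range, hsum]
  · rw [Fin.sum_univ_eq_sum_range (fun a => ψ a * -Real.log (ψ a))]
    have hlog : ∀ a ∈ Finset.range m, ψ a * -Real.log (ψ a)
        = ψ a * Real.log Z - ψ a * a * Real.log γ := by
      intro a _
      simp only [hψ]
      rw [Real.log_div (by positivity) hZ0.ne', Real.log_pow]
      ring
    rw [Finset.sum_congr rfl hlog, Finset.sum_sub_distrib, ← Finset.sum_mul, ← Finset.sum_mul,
      hsum, ← hγ, gammaFun, Real.log_div hZ0.ne' (Real.rpow_pos_of_pos h0 _).ne',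
      Real.log_rpow h0, one_mul, ← hmean']
    congr 1
    field_simp

/-! ### The entropy of the coupling modulo subspaces -/

section
variable {m k : ℕ} {π : Simplex m k → ℝ} {ψ : Fin m → ℝ}

theorem sum_eq_one_of_marginals (hψ : ∀ i a, ∑ τ : Simplex m k with τ.1 i = a, π τ = ψ a)
    (hsum : ∑ a, ψ a = 1) (i : Fin k) : ∑ τ, π τ = 1 := by
  rw [← hsum, ← Finset.sum_fiberwise Finset.univ fun τ : Simplex m k => τ.1 i]
  exact Finset.sum_congr rfl fun a _ => hψ i a

/-- The entropy of the partition by the value of the `i`-th entry is that of the marginal. -/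
theorem relEntropy_eq_of_marginals (hψ : ∀ i a, ∑ τ : Simplex m k with τ.1 i = a, π τ = ψ a)
    (i : Fin k) {r : Simplex m k → Simplex m k → Prop} (hr : ∀ τ τ', r τ τ' ↔ τ'.1 i = τ.1 i) :
    relEntropy π r = ∑ a, ψ a * -Real.log (ψ a) := by
  classical
  have h1 : ∀ τ, relMass π r τ = ψ (τ.1 i) := by
    intro τ
    rw [← hψ i]
    unfold relMass
    congr 1
    ext τ'
    simp [hr]
  unfold relEntropy
  simp only [h1]
  rw [← Finset.sum_fiberwise Finset.univ fun τ : Simplex m k => τ.1 i]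
  refine Finset.sum_congr rfl fun a _ => ?_
  rw [← hψ i, Finset.sum_mul, hψ]
  refine Finset.sum_congr rfl fun τ hτ => ?_
  rw [(Finset.mem_filter.mp hτ).2]

/-- The bound of `entropy_slope_le` with a slope independent of the field. -/
theorem entropy_sub_le_finrank_mul {K : Type*} [Field K] [Finite K]
    (hinj : ∀ a b, a < m → b < m → (a : K) = b → a = b) (hk : 3 ≤ k)
    (hk1 : ((k - 1 : ℕ) : K) ≠ 0) (hπ : ∀ τ, 0 < π τ)
    (hsym : ∀ σ τ, π (Simplex.perm σ τ) = π τ)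
    (hψ : ∀ i a, ∑ τ : Simplex m k with τ.1 i = a, π τ = ψ a) (hsum : ∑ a, ψ a = 1)
    {j : Fin k} {U : Submodule K (Fin k → K)} (hU : U ≤ pinnedSubspace K j) :
    relEntropy π Eq - relEntropy π (modRel U) ≤ Module.finrank K U *
      ((relEntropy π Eq - ∑ a, ψ a * -Real.log (ψ a)) / (k - 2)) := by
  have hk' : (3 : ℝ) ≤ k := by exact_mod_cast hk
  have h1 := entropy_slope_le hk1 hπ (sum_eq_one_of_marginals hψ hsum j) hsym hU
  have hEq : modRel (m := m) (⊥ : Submodule K (Fin k → K)) = Eq := by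
    funext τ τ'
    exact propext ((modRel_bot_iff hinj).trans eq_comm)
  rw [hEq, relEntropy_eq_of_marginals hψ j fun _ _ => modRel_pinnedSubspace_iff hinj] at h1
  have h2 : (k : ℝ) - 2 ≤ Module.finrank K (pinnedSubspace K j) := by
    have : (k : ℝ) ≤ Module.finrank K (pinnedSubspace K j) + 2 := by
      exact_mod_cast le_finrank_pinnedSubspace (K := K) j
    linarith
  have h3 : 0 ≤ relEntropy π Eq - relEntropy π (modRel U) := by
    rw [← hEq, sub_nonneg]
    refine relEntropy_anti hπ (modRel_equivalence _) fun τ τ' h => ?_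
    exact (bot_le : ⊥ ≤ U) h
  rw [mul_div_assoc', le_div_iff₀ (by linarith), mul_comm]
  exact (mul_le_mul_of_nonneg_right h2 h3).trans h1

end

/-! ### Large colored sum-free sets -/

section
variable {m k : ℕ} {π : Simplex m k → ℝ} {ψ : Fin m → ℝ}

/-- Hashing a class of sequences with values in `(ZMod p) ^ ν`, where `p ^ ν` is large enough for
collisions to be rare. -/
theorem exists_isColoredSumFree_of_class (hk : 3 ≤ k) (hπ : ∀ τ, 0 < π τ)
    (hsym : ∀ σ τ, π (Simplex.perm σ τ) = π τ)
    (hψ : ∀ i a, ∑ τ : Simplex m k with τ.1 i = a, π τ = ψ a) (hsum : ∑ a, ψ a = 1)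
    {Φ δ : ℝ} (hΦ : Φ = (relEntropy π Eq - ∑ a, ψ a * -Real.log (ψ a)) / (k - 2)) (hδ : 0 ≤ δ)
    {n : ℕ} {c : Fin k → Fin m → ℕ} {E : Finset (Fin n → Simplex m k)}
    (hc : ∀ e ∈ E, marginalCount e = c)
    (hcount : ∀ r : Simplex m k → Simplex m k → Prop, Equivalence r → ∀ e ∈ E,
      ∀ D : Finset (Fin n → Simplex m k),
      (∀ e' ∈ D, marginalCount e' = c ∧ ∀ t, r (e t) (e' t)) →
      (D.card : ℝ) ≤ Real.exp (n * (relEntropy π Eq - relEntropy π r) + δ))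
    {p ν : ℕ} (hp : p.Prime) (hmp : m ≤ p) (hkp : k ≤ p)
    (hQ : 2 * 2 ^ (Fintype.card (Simplex m k) ^ 2) * Real.exp (n * Φ + δ) ≤ (p : ℝ) ^ ν) :
    ∃ (L : ℕ) (x : Fin k → Fin L → Fin n → ZMod m), IsColoredSumFree x ∧
      E.card * (((p / (k - 1) : ℕ) : ℝ) ^ ν / (ν * ((p / (k - 1) : ℕ) : ℝ) ^ 2 + 1))
        ≤ 2 * ((p : ℝ) ^ ν) ^ (k - 1) * L := by
  classical
  have : Fact p.Prime := ⟨hp⟩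
  have hinj : ∀ a b, a < m → b < m → (a : ZMod p) = b → a = b := by
    intro a b ha hb h
    rwa [ZMod.natCast_eq_natCast_iff', Nat.mod_eq_of_lt (by omega), Nat.mod_eq_of_lt (by omega)]
      at h
  have hk1 : ((k - 1 : ℕ) : ZMod p) ≠ 0 := by
    rw [Ne, ZMod.natCast_eq_zero_iff]
    intro h
    have := Nat.le_of_dvd (by omega) h
    omega
  set i₀ : Fin k := ⟨0, by omega⟩ with hi₀
  have : Nonempty {i // i ≠ i₀} := ⟨⟨⟨1, by omega⟩, by simp [hi₀]⟩⟩
  have hJ : Fintype.card {i // i ≠ i₀} = k - 1 := by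
    rw [Fintype.card_subtype_compl, Fintype.card_fin, Fintype.card_subtype_eq]
  have hd1 : 1 ≤ p / (k - 1) := (Nat.one_le_div_iff (by omega)).mpr (by omega)
  obtain ⟨A, hAcard, hA⟩ := exists_meanFree {i // i ≠ i₀} (p := p) (d := p / (k - 1)) (by
    rw [hJ]
    have h1 := Nat.mul_div_le p (k - 1)
    have h2 : (k - 1) * (p / (k - 1) - 1) < (k - 1) * (p / (k - 1)) :=
      Nat.mul_lt_mul_of_pos_left (by omega) (by omega)
    omega) hd1 ν
  set Q : ℝ := (p : ℝ) ^ ν with hQdef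
  have hp0 : (0 : ℝ) < p := by exact_mod_cast hp.pos
  have hQ0 : 0 < Q := by positivity
  have hN1 : (1 : ℝ) ≤ 2 ^ (Fintype.card (Simplex m k) ^ 2) := one_le_pow₀ (by norm_num)
  have hXQ : Real.exp (n * Φ) ≤ Q := by
    refine le_trans ?_ hQ
    have h1 : Real.exp (n * Φ) ≤ Real.exp (n * Φ + δ) := Real.exp_le_exp.mpr (by linarith)
    have h2 := Real.exp_pos (n * Φ + δ)
    nlinarith
  obtain ⟨u, r, hur⟩ := exists_card_isolated (ν := ν) (i₀ := i₀) hk1 A c E (by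
    intro e he
    rw [ZMod.card]
    refine (sum_inv_pow_finrank_diffSpan_le hinj _
      (fun e' he' => (Finset.mem_filter.mp he').2.2) (X := Real.exp (n * Φ)) (Y := Real.exp δ)
      (Real.exp_pos _).le hQ0 hXQ (Real.exp_pos _).le ?_).trans ?_
    · intro j U hU D hD hDU
      refine (hcount (modRel U) (modRel_equivalence U) e he D fun e' he' =>
        ⟨(Finset.mem_filter.mp (hD he')).2.1, hDU e' he'⟩).trans ?_
      rw [← Real.exp_nat_mul, ← Real.exp_add, Real.exp_le_exp]
      have h1 := entropy_sub_le_finrank_mul hinj hk hk1 hπ hsym hψ hsum hU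
      rw [← hΦ] at h1
      have h2 := mul_le_mul_of_nonneg_left h1 (Nat.cast_nonneg (α := ℝ) n)
      linarith
    · rw [Real.exp_add] at hQ
      rw [mul_div_assoc', mul_div_assoc', div_le_iff₀ hQ0]
      linarith)
  rw [ZMod.card] at hur
  set S := E.filter fun e => Isolated A u r c e with hS
  obtain ⟨x, hx⟩ := exists_isColoredSumFree_of_mix i₀ (S := S) (c := c)
    (fun e he => hc e (Finset.mem_filter.mp he).1) (by
      intro e he f hf hfc i
      have h1 := fun i => (Finset.mem_filter.mp (he i)).2
      exact (h1 i).2 f hfc (Kept.mix hA (fun i => (h1 i).1) hf) ⟨i, hf i⟩)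
  exact ⟨S.card, x, hx, (mul_le_mul_of_nonneg_left hAcard (Nat.cast_nonneg _)).trans hur⟩

end

/-- A prime between `exp s` and `exp (O(s))`, exceeding a given number. -/
theorem exists_prime_between_exp (N : ℕ) {s : ℝ} (hs : 1 ≤ s) :
    ∃ p : ℕ, p.Prime ∧ N ≤ p ∧ s ≤ Real.log p ∧ Real.log p ≤ (2 * N + 5) * s := by
  obtain ⟨p, hp, hlt, hle⟩ := Nat.exists_prime_lt_and_le_two_mul (⌈Real.exp s⌉₊ + N)
    (by have := Nat.ceil_pos.mpr (Real.exp_pos s); omega)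
  have hp0 : (0 : ℝ) < p := by exact_mod_cast hp.pos
  refine ⟨p, hp, by omega, ?_, ?_⟩
  · rw [Real.le_log_iff_exp_le hp0]
    refine (Nat.le_ceil _).trans ?_
    exact_mod_cast (by omega : ⌈Real.exp s⌉₊ ≤ p)
  · rw [Real.log_le_iff_le_exp hp0]
    have h1 : (p : ℝ) ≤ 2 * (⌈Real.exp s⌉₊ + N) := by exact_mod_cast hle
    have h2 := (Nat.ceil_lt_add_one (Real.exp_pos s).le).le
    have h3 : 1 ≤ Real.exp s := Real.one_le_exp (by linarith)
    have h4 : (2 * N + 4 : ℝ) ≤ Real.exp ((2 * N + 4) * s) := by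
      have h5 := Real.add_one_le_exp ((2 * N + 4 : ℝ) * s)
      have h6 : (2 * N + 4 : ℝ) ≤ (2 * N + 4) * s := le_mul_of_one_le_right (by positivity) hs
      linarith
    calc (p : ℝ) ≤ (2 * N + 4) * Real.exp s := by nlinarith [Nat.cast_nonneg (α := ℝ) N]
      _ ≤ Real.exp ((2 * N + 4) * s) * Real.exp s := by gcongr
      _ = Real.exp ((2 * N + 5) * s) := by rw [← Real.exp_add]; ring_nf

/-- The losses of the hashing argument are all of the form `exp (O(s))`. -/
theorem exp_sub_mul_le_of_mul_le {k M n p ν : ℕ} {h g Φ C C₁ C₂ C₃ s N L : ℝ} (hk : 3 ≤ k)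
    (hs1 : 1 ≤ s) (hss : s * s = n) (hΦg : (k - 2) * Φ = h - g) (hkp : k ≤ p)
    (hlog : Real.log p ≤ C₂ * s) (hν₁ : ν * Real.log p ≤ n * Φ + C₁ * s + C₂ * s)
    (hν₂ : ν ≤ C₃ * s) (hN : Real.exp (n * h - C * s) / (2 * ((n : ℝ) + 1) ^ M) ≤ N)
    (hL : N * (((p / (k - 1) : ℕ) : ℝ) ^ ν / (ν * ((p / (k - 1) : ℕ) : ℝ) ^ 2 + 1))
      ≤ 2 * ((p : ℝ) ^ ν) ^ (k - 1) * L) (hL0 : 0 ≤ L) :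
    Real.exp (n * g - (C + 2 + 2 * M + C₃ + 2 * C₂ + 2 * k * C₃ + (k - 2) * (C₁ + C₂)) * s)
      ≤ L := by
  have hk' : (3 : ℝ) ≤ k := by exact_mod_cast hk
  have hp0 : (0 : ℝ) < p := by exact_mod_cast (by omega : 0 < p)
  have hpexp : (p : ℝ) ^ ν = Real.exp (ν * Real.log p) := by
    rw [Real.exp_nat_mul, Real.exp_log hp0]
  set d : ℝ := ((p / (k - 1) : ℕ) : ℝ) with hd
  have hd1 : 1 ≤ p / (k - 1) := (Nat.one_le_div_iff (by omega)).mpr (by omega)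
  have hdp : d ≤ p := by rw [hd]; exact_mod_cast Nat.div_le_self _ _
  have hpd : (p : ℝ) ≤ d * (2 * k) := by
    have h1 : p < (k - 1) * (p / (k - 1) + 1) := Nat.lt_mul_div_succ p (by omega)
    have h2 : (k - 1) * (p / (k - 1) + 1) ≤ k * (2 * (p / (k - 1))) :=
      Nat.mul_le_mul (by omega) (by omega)
    have h3 : p ≤ p / (k - 1) * (2 * k) := by
      calc p ≤ k * (2 * (p / (k - 1))) := by omega
        _ = _ := by ring
    rw [hd]
    exact_mod_cast h3
  have hd0 : 0 < d := by rw [hd]; exact_mod_cast hd1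
  -- combine the lower bounds, using `p / (2 * k) ≤ d`
  have hmain : Real.exp (n * h - C * s) ≤ 4 * ((n : ℝ) + 1) ^ M * (ν * d ^ 2 + 1)
      * (2 * k) ^ ν * ((p : ℝ) ^ ν) ^ (k - 2) * L := by
    have h1 := (mul_le_mul_of_nonneg_right hN (by positivity :
      0 ≤ d ^ ν / (ν * d ^ 2 + 1))).trans hL
    rw [div_mul_div_comm, div_le_iff₀ (by positivity)] at h1
    have h2 : (p : ℝ) ^ ν ≤ d ^ ν * (2 * k) ^ ν := by
      rw [← mul_pow]; exact pow_le_pow_left₀ hp0.le hpd ν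
    have hpν : 0 < (p : ℝ) ^ ν := by positivity
    have h3 : ((p : ℝ) ^ ν) ^ (k - 1) = ((p : ℝ) ^ ν) ^ (k - 2) * (p : ℝ) ^ ν := by
      rw [← pow_succ]; congr 1; omega
    refine le_of_mul_le_mul_right ?_ hpν
    calc Real.exp (n * h - C * s) * (p : ℝ) ^ ν
        ≤ Real.exp (n * h - C * s) * (d ^ ν * (2 * k) ^ ν) := by gcongr
      _ = Real.exp (n * h - C * s) * d ^ ν * (2 * k) ^ ν := by ring
      _ ≤ 2 * ((p : ℝ) ^ ν) ^ (k - 1) * L * (2 * ((n : ℝ) + 1) ^ M * (ν * d ^ 2 + 1))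
          * (2 * k) ^ ν := by gcongr
      _ = _ := by rw [h3]; ring
  have e1 : (4 : ℝ) ≤ Real.exp (2 * s) := by
    have h1 : (2 : ℝ) ≤ Real.exp s := by linarith [Real.add_one_le_exp s]
    rw [two_mul, Real.exp_add]
    nlinarith
  have e2 : ((n : ℝ) + 1) ^ M ≤ Real.exp (M * (2 * s)) := by
    rw [Real.exp_nat_mul]
    refine pow_le_pow_left₀ (by positivity) ?_ _
    have h1 := Real.add_one_le_exp s
    rw [two_mul, Real.exp_add]
    nlinarith
  have e3 : (ν * d ^ 2 + 1 : ℝ) ≤ Real.exp (C₃ * s + 2 * (C₂ * s)) := by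
    have h1 := Real.add_one_le_exp (ν : ℝ)
    have h2 : d ≤ Real.exp (C₂ * s) := by
      refine hdp.trans ?_
      rw [← Real.log_le_iff_le_exp hp0]
      exact hlog
    have h3 : d ^ 2 ≤ Real.exp (2 * (C₂ * s)) := by
      have := pow_le_pow_left₀ hd0.le h2 2
      rwa [← Real.exp_nat_mul, Nat.cast_ofNat] at this
    have h4 : 1 ≤ d ^ 2 := one_le_pow₀ (by rw [hd]; exact_mod_cast hd1)
    calc (ν * d ^ 2 + 1 : ℝ) ≤ (ν + 1) * d ^ 2 := by nlinarith
      _ ≤ Real.exp ν * Real.exp (2 * (C₂ * s)) := by gcongr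
      _ ≤ _ := by rw [← Real.exp_add, Real.exp_le_exp]; linarith
  have e4 : (2 * k : ℝ) ^ ν ≤ Real.exp (2 * k * (C₃ * s)) := by
    have h1 : (2 * k : ℝ) ≤ Real.exp (2 * k) := by linarith [Real.add_one_le_exp (2 * k : ℝ)]
    refine (pow_le_pow_left₀ (by positivity) h1 ν).trans ?_
    rw [← Real.exp_nat_mul, Real.exp_le_exp, mul_comm]
    exact mul_le_mul_of_nonneg_left hν₂ (by positivity)
  have e5 : ((p : ℝ) ^ ν) ^ (k - 2) ≤ Real.exp (n * (h - g) + (k - 2) * (C₁ + C₂) * s) := by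
    rw [hpexp, ← Real.exp_nat_mul, Real.exp_le_exp, Nat.cast_sub (by omega), Nat.cast_ofNat,
      ← hΦg]
    have := mul_le_mul_of_nonneg_left hν₁ (by linarith : (0 : ℝ) ≤ k - 2)
    linarith
  have hfin : Real.exp (n * h - C * s) ≤ Real.exp (2 * s) * Real.exp (M * (2 * s))
      * Real.exp (C₃ * s + 2 * (C₂ * s)) * Real.exp (2 * k * (C₃ * s))
      * Real.exp (n * (h - g) + (k - 2) * (C₁ + C₂) * s) * L :=
    hmain.trans (by gcongr)
  rw [← Real.exp_add, ← Real.exp_add, ← Real.exp_add, ← Real.exp_add] at hfin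
  rw [← div_le_iff₀' (Real.exp_pos _), ← Real.exp_sub] at hfin
  refine le_trans (le_of_eq ?_) hfin
  congr 1
  ring

/-- Colored sum-free sets of size `exp (n log Γ - O(√n))`. -/
theorem exists_isColoredSumFree_exp {m k : ℕ} (hm : 2 ≤ m) (hk : 3 ≤ k) :
    ∃ B : ℝ, ∀ n : ℕ, 1 ≤ n → ∃ (L : ℕ) (x : Fin k → Fin L → Fin n → ZMod m),
      IsColoredSumFree x ∧ Real.exp (n * Real.log (gammaConst m k) - B * √n) ≤ L := by
  obtain ⟨θ, ψ, hψ, hsum, hent⟩ := exists_coupling_gammaConst hm hk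
  set π : Simplex m k → ℝ := fun τ => Real.exp (∑ j, θ (τ.1 j)) with hπdef
  have hπ : ∀ τ, 0 < π τ := fun τ => Real.exp_pos _
  have hsym : ∀ σ τ, π (Simplex.perm σ τ) = π τ := fun σ τ =>
    congrArg Real.exp (Equiv.sum_comp σ fun j => θ (τ.1 j))
  have hk' : (3 : ℝ) ≤ k := by exact_mod_cast hk
  have hπsum : ∑ τ, π τ = 1 := sum_eq_one_of_marginals hψ hsum ⟨0, by omega⟩
  obtain ⟨C, hC, H⟩ := exists_typical_class (fun _ => rfl : ∀ τ, π τ = _) hπsum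
  set h := relEntropy π Eq with hh
  set g := Real.log (gammaConst m k) with hg
  obtain ⟨Φ, hΦ⟩ : ∃ Φ, Φ = (h - ∑ a, ψ a * -Real.log (ψ a)) / (k - 2) := ⟨_, rfl⟩
  have hΦg : (k - 2) * Φ = h - g := by
    rw [hΦ, hent, mul_div_cancel₀ _ (by linarith)]
  have hΦ0 : 0 ≤ Φ := by
    have h1 : g ≤ h := by
      rw [← hent, ← relEntropy_eq_of_marginals hψ ⟨0, by omega⟩
        (r := fun τ τ' => τ'.1 ⟨0, by omega⟩ = τ.1 ⟨0, by omega⟩) fun _ _ => Iff.rfl]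
      exact relEntropy_anti hπ eq_equivalence fun τ τ' h => by rw [h]
    rw [hΦ, hent]
    exact div_nonneg (by linarith) (by linarith)
  obtain ⟨b, hb⟩ : ∃ b, b = Real.log (2 * 2 ^ (Fintype.card (Simplex m k) ^ 2)) := ⟨_, rfl⟩
  have hN1 : (1 : ℝ) ≤ 2 ^ (Fintype.card (Simplex m k) ^ 2) := one_le_pow₀ (by norm_num)
  have hb0 : 0 ≤ b := by rw [hb]; exact Real.log_nonneg (by linarith)
  have hbexp : 2 * 2 ^ (Fintype.card (Simplex m k) ^ 2) = Real.exp b := by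
    rw [hb, Real.exp_log (by positivity)]
  obtain ⟨C₁, hC₁⟩ : ∃ C₁, C₁ = 2 * C + b := ⟨_, rfl⟩
  obtain ⟨C₂, hC₂⟩ : ∃ C₂ : ℝ, C₂ = 2 * ((m + k : ℕ) : ℝ) + 5 := ⟨_, rfl⟩
  obtain ⟨C₃, hC₃⟩ : ∃ C₃, C₃ = Φ + C₁ + 1 := ⟨_, rfl⟩
  refine ⟨C + 2 + 2 * (k * m : ℕ) + C₃ + 2 * C₂ + 2 * k * C₃ + (k - 2) * (C₁ + C₂), fun n hn => ?_⟩
  obtain ⟨c, E, hc, hEcard, hcount⟩ := H n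
  obtain ⟨s, hs⟩ : ∃ s, s = √(n : ℝ) := ⟨_, rfl⟩
  have hn' : (1 : ℝ) ≤ n := by exact_mod_cast hn
  have hs1 : 1 ≤ s := by rw [hs]; exact Real.one_le_sqrt.mpr hn'
  have hss : s * s = n := by rw [hs]; exact Real.mul_self_sqrt (by linarith)
  rw [← hs] at hEcard hcount ⊢
  obtain ⟨p, hp, hmkp, hlog1, hlog2⟩ := exists_prime_between_exp (m + k) hs1
  rw [← hC₂] at hlog2
  have hp0 : (0 : ℝ) < p := by exact_mod_cast hp.pos
  have hlogpos : 0 < Real.log p := by linarith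
  -- the least dimension for which `p ^ ν` is at least `exp (n Φ + C₁ s)`
  set ν := ⌈(n * Φ + C₁ * s) / Real.log p⌉₊ with hν
  have hC₁0 : 0 ≤ C₁ := by rw [hC₁]; linarith
  have hnum : 0 ≤ n * Φ + C₁ * s := by positivity
  have hν1 : n * Φ + C₁ * s ≤ ν * Real.log p := by
    rw [← div_le_iff₀ hlogpos]; exact Nat.le_ceil _
  have hν2 : (ν : ℝ) ≤ (n * Φ + C₁ * s) / Real.log p + 1 :=
    (Nat.ceil_lt_add_one (div_nonneg hnum hlogpos.le)).le
  have hν3 : ν * Real.log p ≤ n * Φ + C₁ * s + C₂ * s := by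
    have := mul_le_mul_of_nonneg_right hν2 hlogpos.le
    rw [add_mul, div_mul_cancel₀ _ hlogpos.ne'] at this
    linarith
  have hν4 : (ν : ℝ) ≤ C₃ * s := by
    have h1 : (n * Φ + C₁ * s) / Real.log p ≤ (n * Φ + C₁ * s) / s :=
      div_le_div_of_nonneg_left hnum (by linarith) hlog1
    have h2 : (n * Φ + C₁ * s) / s = Φ * s + C₁ := by
      rw [← hss]; field_simp
    rw [h2] at h1
    rw [hC₃]
    nlinarith
  have hpexp : (p : ℝ) ^ ν = Real.exp (ν * Real.log p) := by
    rw [Real.exp_nat_mul, Real.exp_log hp0]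
  obtain ⟨L, x, hx, hL⟩ := exists_isColoredSumFree_of_class hk hπ hsym hψ hsum hΦ
    (δ := 2 * C * s) (by positivity) hc hcount hp (by omega) (by omega) (ν := ν) (by
      rw [hbexp, hpexp, ← Real.exp_add, Real.exp_le_exp]
      refine le_trans ?_ hν1
      rw [hC₁]
      nlinarith)
  refine ⟨L, x, hx, ?_⟩
  exact exp_sub_mul_le_of_mul_le hk hs1 hss hΦg (by omega) hlog2 hν3 hν4 hEcard hL (Nat.cast_nonneg L)

theorem theorem1p3 (m k : ℕ) (hm : 2 ≤ m) (hk : 3 ≤ k) :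
    (∃ C : ℝ, ∀ n : ℕ, ∃ (L : ℕ) (x : Fin k → Fin L → (Fin n → ZMod m)),
      IsColoredSumFree x ∧
        (gammaConst m k) ^ ((n : ℝ) - C * Real.sqrt (n : ℝ)) ≤ (L : ℝ)) ∧
    (IsPrimePow m →
      ∀ (n L : ℕ) (x : Fin k → Fin L → (Fin n → ZMod m)),
        IsColoredSumFree x → (L : ℝ) ≤ (gammaConst m k) ^ n) := by
  refine ⟨?_, fun hpp n L x hx => card_le_gammaConst_pow hm hk hpp n L x hx⟩
  obtain ⟨B, hB⟩ := exists_isColoredSumFree_exp hm hk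
  obtain ⟨hlog, hexp⟩ := gammaConst_eq_exp_log hm hk
  refine ⟨B / Real.log (gammaConst m k), fun n => ?_⟩
  -- the constant absorbs additive constants only for `n ≥ 1`; for `n = 0` one tuple suffices
  rcases Nat.eq_zero_or_pos n with rfl | hn
  · exact ⟨1, fun _ _ => 0, fun j => by simpa using fun a b => Subsingleton.elim (j a) (j b),
      by simp⟩
  · obtain ⟨L, x, hx, hL⟩ := hB n hn
    refine ⟨L, x, hx, le_trans (le_of_eq ?_) hL⟩
    rw [← hexp, Real.log_exp, ← Real.exp_mul]
    congr 1
    field_simp
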